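/- Let $f$ be holomorphic in the closed upper half-plane $\{\operatorname{Im} z\ge 0\}$ (that is, in a neighbourhood of each of its points), with $|f(z)|\le Ce^{C|z|}$ there for some constant $C$, and $f(0)=1$. Assume that: (i) the net variation of the argument of $f$ along real segments is bounded: there is $M$ with $$\left|\int_{-r}^{r}\frac{d[\arg f(t)]}{dt}\,dt\right|\le M\qquad\text{for all } r>0,$$ where $\frac{d[\arg f(t)]}{dt}=\operatorname{Im}\frac{f'(t)}{f(t)}$ when $f(t)\neq 0$, and where, if $f$ has real zeros, each real zero of order $m$ in $[-r,r]$ contributes the additional term $-m\pi$ to the integral (the argument is followed along the real line indented into the upper half-plane at the zeros); (ii) $\displaystyle\int_{-\infty}^{\infty}\frac{\bigl|\ln|f(t)|\bigr|}{1+t^2}\,dt<\infty.$ Let $n_{f+}(r)$ be the number of zeros $z$ of $f$, counted with multiplicity, with $\operatorname{Im} z>0$ and $|z|\le r$, and let $$h_f(\varphi)=\limsup_{r\to\infty}\frac{\ln|f(re^{i\varphi})|}{r}\qquad(\text{with }\ln 0=-\infty).$$ Then $h_f$ is finite on $(0,\pi)$ and integrable there, and $$\lim_{r\to\infty}\frac{n_{f+}(r)}{r}=\frac{1}{2\pi}\int_0^{\pi}h_f(\varphi)\,d\varphi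 .$$ -/

import Mathlib

open Filter Topology MeasureTheory

noncomputable section

/-- The number of zeros of `f` in the set `S`, counted with multiplicity. -/
def zeroCount (f : ℂ → ℂ) (S : Set ℂ) : ℕ :=
  ∑ᶠ z ∈ {z : ℂ | z ∈ S ∧ f z = 0}, analyticOrderNatAt f z

/-- The number of zeros of `f` in the open upper half-plane of modulus at most `r`,
counted with multiplicity. -/
def upperZeroCount (f : ℂ → ℂ) (r : ℝ) : ℕ :=
  zeroCount f {z : ℂ | 0 < z.im ∧ ‖z‖ ≤ r}

/-- The number of zeros of `f` on the real segment `[-r, r]`, counted with multiplicity. -/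
def realZeroCount (f : ℂ → ℂ) (r : ℝ) : ℕ :=
  zeroCount f {z : ℂ | z.im = 0 ∧ ‖z‖ ≤ r}

/-- The net variation of `arg f` along the real segment from `-r` to `r`.
Away from the zeros of `f`, every continuous branch of `arg f(t)` has derivative `Im (f'(t) / f(t))`.
If `f` has no real zero, this is just the integral of that derivative. At a real zero of order `m`
the line is indented into the upper half-plane, as in the argument principle, so that `arg f`
jumps by `-m π` there (the argument of `(t - a) ^ m` goes from `m π` to `0`). -/
def argVariation (f : ℂ → ℂ) (r : ℝ) : ℝ :=
  (∫ t in (-r)..r, (deriv f (t : ℂ) / f (t : ℂ)).im) - Real.pi * (realZeroCount f r : ℝ)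

/-- The indicator (with respect to order one) of `f` in the direction `φ`:
the upper limit of `ln |f (r e ^ {i φ})| / r` as `r → ∞`, with `ln 0 = -∞`. -/
def indicatorFn (f : ℂ → ℂ) (φ : ℝ) : EReal :=
  limsup (fun r : ℝ =>
    ENNReal.log ‖f ((r : ℂ) * Complex.exp ((φ : ℂ) * Complex.I))‖ₑ / (r : EReal)) atTop

end

/-! In modulus, `f` behaves like `exp(-i k z)` for some real `k`: away from zeros, `log |f(z)| - k
Im z` is `o(|z|)` in an averaged sense. Hence the indicator is `k sin φ`, the right-hand side of the
theorem equals `k / π`, and it remains to show that the zeros have density `k / π`.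

The zeros enter through Jensen's formula for a half-disc (`halfDisc_jensen`): the integral of `log
|f|` over the half-circle of radius `r` is `2π ∫₀ʳ n(t)/t dt - ∫₀ʳ A(t)/t dt`, where `A` is the
variation of the argument. Bounded `A` makes the last term `O(log r)`, so a half-circle integral
close to `2kr` gives `∫₀ʳ n(t)/t dt ~ kr/π`, and monotonicity of `n` gives `n(r) ~ kr/π`.

The constant `k` comes from the Poisson-Jensen formula in half-discs (`halfDisc_poissonJensen`), as
the radius `R` tends to infinity. The diameter term tends to the Poisson integral over the line, by
hypothesis (ii). The arc kernel is asymptotically `Im z` times a weight independent of `z`, so the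
arc term is governed by the numbers `arcMean f R`. These are bounded above by the growth of `f` and
below by the formula at one point where `f` does not vanish; a limit along a subsequence is `k`
(`exists_tendsto_arcMean`). The Green sums therefore converge, which gives the Blaschke condition
for the zeros, the upper bound `log |f| ≤ linePoisson + k Im z`, and a bound of the error by a
Poisson integral plus a Green potential (`exists_halfPlane_representation`).

Near zeros this error is not pointwise small. Both kernels are dominated by one radial kernel
`radialKer`, either on a fixed ray or after integration over the half-circle. The resulting
`radialMajorant`, call it `Λ`, satisfies `R⁻³ ∫₀ᴿ r Λ(r) dr → 0`
(`tendsto_lintegral_radialMajorant`), so it cannot exceed `ε r` throughout an interval `(R, (1 + δ)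
R)` with `R` large. The good radii found in this way are enough for the lower bound of an upper
limit (`le_indicatorFn`) and, by monotonicity of `∫₀ʳ n(t)/t dt`, for the asymptotics of that
integral (`tendsto_div_of_monotone_of_tendsto`). -/

noncomputable section

/-! ### Factoring out the zeros on a half-disc. -/

/-- The closed upper half-disc of radius `R` centred at the origin. -/
def closedHalfDisc (R : ℝ) : Set ℂ := {z : ℂ | 0 ≤ z.im ∧ ‖z‖ ≤ R}

lemma closedHalfDisc_eq (R : ℝ) :
    closedHalfDisc R = {z : ℂ | 0 ≤ z.im} ∩ Metric.closedBall 0 R := by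
  ext z; simp [closedHalfDisc]

lemma closedHalfDisc_subset (R : ℝ) : closedHalfDisc R ⊆ {z : ℂ | 0 ≤ z.im} := fun _ h => h.1

lemma isClosed_upperHalfPlane : IsClosed {z : ℂ | 0 ≤ z.im} :=
  isClosed_le continuous_const Complex.continuous_im

lemma convex_upperHalfPlane : Convex ℝ {z : ℂ | 0 ≤ z.im} := convex_halfSpace_im_ge 0

lemma isCompact_closedHalfDisc (R : ℝ) : IsCompact (closedHalfDisc R) := by
  rw [closedHalfDisc_eq]
  exact (isCompact_closedBall 0 R).inter_left isClosed_upperHalfPlane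

lemma convex_closedHalfDisc (R : ℝ) : Convex ℝ (closedHalfDisc R) := by
  rw [closedHalfDisc_eq]
  exact convex_upperHalfPlane.inter (convex_closedBall 0 R)

lemma Convex.exists_hasDerivAt_of_differentiableOn {U : Set ℂ} (hU : IsOpen U) (hc : Convex ℝ U)
    {g : ℂ → ℂ} (hg : DifferentiableOn ℂ g U) : ∃ G : ℂ → ℂ, ∀ z ∈ U, HasDerivAt G (g z) z := by
  obtain ⟨G, hG⟩ := hc.exists_forall_hasDerivWithinAt hg
  exact ⟨G, fun z hz => (hG z hz).hasDerivAt (hU.mem_nhds hz)⟩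

/-- A zero-free holomorphic function on a convex open set has a holomorphic logarithm. -/
lemma Convex.exists_exp_eq {U : Set ℂ} (hU : IsOpen U) (hc : Convex ℝ U)
    {g : ℂ → ℂ} (hg : DifferentiableOn ℂ g U) (h0 : ∀ z ∈ U, g z ≠ 0) :
    ∃ G : ℂ → ℂ, DifferentiableOn ℂ G U ∧ ∀ z ∈ U, g z = Complex.exp (G z) := by
  rcases U.eq_empty_or_nonempty with rfl | ⟨a, ha⟩
  · exact ⟨0, by simp, by simp⟩
  obtain ⟨L, hL⟩ := hc.exists_hasDerivAt_of_differentiableOn hU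
    ((hg.deriv hU).fun_div hg h0)
  -- `L` is a primitive of `g'/g`, so `g exp(-L)` has derivative zero; the additive constant
  -- normalises the logarithm at `a`.
  refine ⟨fun z => L z - L a + Complex.log (g a), ?_, ?_⟩
  · exact fun z hz => (((hL z hz).sub_const _).add_const _).differentiableAt.differentiableWithinAt
  · have key : ∀ z ∈ U, HasDerivAt (fun z => g z * Complex.exp (-L z)) 0 z := by
      intro z hz
      have h1 : HasDerivAt g (deriv g z) z := (hg.differentiableAt (hU.mem_nhds hz)).hasDerivAt
      have h2 := h1.fun_mul ((hL z hz).fun_neg.cexp)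
      have h3 : deriv g z * Complex.exp (-L z) + g z * (Complex.exp (-L z) *
          -(deriv g z / g z)) = 0 := by
        have := h0 z hz
        field_simp
        ring
      rwa [h3] at h2
    have hconst : ∀ z ∈ U, g z * Complex.exp (-L z) = g a * Complex.exp (-L a) := by
      intro z hz
      refine hc.is_const_of_fderivWithin_eq_zero (𝕜 := ℂ) (f := fun z => g z * Complex.exp (-L z))
        (fun w hw => (key w hw).differentiableAt.differentiableWithinAt) ?_ hz ha
      intro w hw
      rw [fderivWithin_of_isOpen hU hw]
      ext
      simp [(key w hw).deriv]
    intro z hz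
    have h3 := hconst z hz
    rw [Complex.exp_add, Complex.exp_log (h0 a ha), Complex.exp_sub]
    rw [Complex.exp_neg, Complex.exp_neg] at h3
    field_simp at h3 ⊢
    rw [h3]

/-- Splitting off a zero of an analytic function. -/
lemma AnalyticAt.exists_eq_pow_mul {f : ℂ → ℂ} {a : ℂ} (hf : AnalyticAt ℂ f a)
    (hfin : analyticOrderAt f a ≠ ⊤) (ha : f a = 0) :
    ∃ g : ℂ → ℂ, (∀ z, f z = (z - a) ^ analyticOrderNatAt f a * g z) ∧ g a ≠ 0 ∧
      AnalyticAt ℂ g a ∧ ∀ z, z ≠ a → (AnalyticAt ℂ f z → AnalyticAt ℂ g z ∧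
        analyticOrderAt g z = analyticOrderAt f z) := by
  classical
  obtain ⟨h, han, hne, heq⟩ := hf.analyticOrderAt_ne_top.1 hfin
  set m := analyticOrderNatAt f a with hm
  have hm0 : m ≠ 0 := by
    intro h0
    have := heq.self_of_nhds
    rw [h0] at this
    simp [ha] at this
    exact hne this.symm
  -- The local factor `h` is only controlled near `a`. Dividing `f` globally gives an identity valid
  -- at every point, which is what allows the zeros to be removed one after another.
  set g : ℂ → ℂ := fun z => if z = a then h a else f z / (z - a) ^ m with hg
  have hgh : g =ᶠ[𝓝 a] h := by
    filter_upwards [heq] with z hz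
    by_cases hza : z = a
    · simp [hg, hza]
    · simp only [hg, hza, if_false, hz, smul_eq_mul]
      field_simp [sub_ne_zero.2 hza]
  have hfg : ∀ z, f z = (z - a) ^ m * g z := by
    intro z
    by_cases hza : z = a
    · simp [hza, ha, hm0]
    · simp only [hg, hza, if_false]
      field_simp [sub_ne_zero.2 hza]
  refine ⟨g, hfg, by simpa [hg] using hne, han.congr hgh.symm, ?_⟩
  intro z hza hfz
  have hgz : AnalyticAt ℂ g z := by
    have : AnalyticAt ℂ (fun z => f z / (z - a) ^ m) z :=
      hfz.div (by fun_prop) (pow_ne_zero _ (sub_ne_zero.2 hza))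
    refine this.congr ?_
    filter_upwards [isOpen_ne.mem_nhds hza] with w hw
    have hw' : w ≠ a := hw
    simp [hg, hw']
  refine ⟨hgz, ?_⟩
  have h1 : f = (fun z => (z - a) ^ m) * g := funext hfg
  have h2 : AnalyticAt ℂ (fun z => (z - a) ^ m) z := by fun_prop
  rw [h1, analyticOrderAt_mul h2 hgz, h2.analyticOrderAt_eq_zero.2
    (pow_ne_zero _ (sub_ne_zero.2 hza)), zero_add]

/-- Splitting off finitely many zeros of an analytic function. -/
lemma exists_eq_prod_pow_mul (s : Finset ℂ) : ∀ f : ℂ → ℂ, (∀ a ∈ s, AnalyticAt ℂ f a ∧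
    analyticOrderAt f a ≠ ⊤ ∧ f a = 0) →
    ∃ g : ℂ → ℂ, (∀ z, f z = (∏ a ∈ s, (z - a) ^ analyticOrderNatAt f a) * g z) ∧
      (∀ a ∈ s, g a ≠ 0) ∧ ∀ z, AnalyticAt ℂ f z → AnalyticAt ℂ g z := by
  classical
  induction s using Finset.induction_on with
  | empty => exact fun f _ => ⟨f, by simp, by simp, fun z h => h⟩
  | insert a s has ih =>
    intro f hf
    obtain ⟨h1, h2, h3⟩ := hf a (Finset.mem_insert_self a s)
    obtain ⟨g, hg1, hg2, hg3, hg4⟩ := h1.exists_eq_pow_mul h2 h3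
    have hne : ∀ c ∈ s, c ≠ a := fun c hc h => has (h ▸ hc)
    have hga : ∀ z, AnalyticAt ℂ f z → AnalyticAt ℂ g z := by
      intro z hz
      by_cases h : z = a
      · exact h ▸ hg3
      · exact (hg4 z h hz).1
    obtain ⟨k, hk1, hk2, hk3⟩ := ih g (by
      intro c hc
      obtain ⟨h5, h6, h7⟩ := hf c (Finset.mem_insert_of_mem hc)
      obtain ⟨h8, h9⟩ := hg4 c (hne c hc) h5
      refine ⟨h8, h9 ▸ h6, ?_⟩
      have := hg1 c
      rw [h7, eq_comm, mul_eq_zero] at this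
      exact this.resolve_left (pow_ne_zero _ (sub_ne_zero.2 (hne c hc))))
    refine ⟨k, ?_, ?_, fun z hz => hk3 z (hga z hz)⟩
    · intro z
      rw [Finset.prod_insert has, mul_assoc, hg1 z, hk1 z]
      congr 2
      refine Finset.prod_congr rfl fun c hc => ?_
      rw [analyticOrderNatAt, analyticOrderNatAt,
        (hg4 c (hne c hc) (hf c (Finset.mem_insert_of_mem hc)).1).2]
    · intro c hc
      rcases Finset.mem_insert.1 hc with rfl | hc
      · have := hk1 c
        exact fun h0 => hg2 (by rw [this, h0, mul_zero])
      · exact hk2 c hc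

section HalfPlane

variable {f : ℂ → ℂ}

lemma analyticOrderAt_ne_top_of_upperHalfPlane (hf : AnalyticOnNhd ℂ f {z : ℂ | 0 ≤ z.im})
    (hf0 : f 0 ≠ 0) {a : ℂ} (ha : 0 ≤ a.im) : analyticOrderAt f a ≠ ⊤ := by
  refine hf.analyticOrderAt_ne_top_of_isPreconnected convex_upperHalfPlane.isPreconnected
    (x := 0) (by simp) ha ?_
  rw [(hf 0 (by simp)).analyticOrderAt_eq_zero.2 hf0]
  simp

lemma finite_zeros_of_isCompact (hf : AnalyticOnNhd ℂ f {z : ℂ | 0 ≤ z.im})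
    (hf0 : f 0 ≠ 0) {K : Set ℂ} (hK : IsCompact K) (hKU : K ⊆ {z : ℂ | 0 ≤ z.im}) :
    {z | z ∈ K ∧ f z = 0}.Finite := by
  by_contra hinf
  obtain ⟨x, hxK, hx⟩ := Set.Infinite.exists_accPt_of_subset_isCompact hinf hK (fun z hz => hz.1)
  have h1 : ∃ᶠ z in 𝓝[≠] x, f z = 0 :=
    (accPt_iff_frequently_nhdsNE.1 hx).mono fun z hz => hz.2
  have h2 := hf.eqOn_zero_of_preconnected_of_frequently_eq_zero
    convex_upperHalfPlane.isPreconnected (hKU hxK) h1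
  exact hf0 (h2 (by simp : (0 : ℂ) ∈ {z : ℂ | 0 ≤ z.im}))

/-- The zeros of `f` in the closed half-disc of radius `R`, as a finite set
(empty if there are infinitely many). -/
def halfDiscZeros (f : ℂ → ℂ) (R : ℝ) : Finset ℂ := by
  classical
  exact if h : {z | z ∈ closedHalfDisc R ∧ f z = 0}.Finite then h.toFinset else ∅

lemma mem_halfDiscZeros (hf : AnalyticOnNhd ℂ f {z : ℂ | 0 ≤ z.im}) (hf0 : f 0 ≠ 0) {R : ℝ}
    {a : ℂ} : a ∈ halfDiscZeros f R ↔ (0 ≤ a.im ∧ ‖a‖ ≤ R) ∧ f a = 0 := by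
  have := finite_zeros_of_isCompact hf hf0 (isCompact_closedHalfDisc R) (closedHalfDisc_subset R)
  rw [halfDiscZeros, dif_pos this]
  simp [closedHalfDisc]

/-- On a convex neighbourhood of a closed half-disc, `f` is a polynomial times an exponential. -/
lemma exists_factorization (hf : AnalyticOnNhd ℂ f {z : ℂ | 0 ≤ z.im}) (hf0 : f 0 ≠ 0) (R : ℝ) :
    ∃ (U : Set ℂ) (G : ℂ → ℂ), IsOpen U ∧ Convex ℝ U ∧ closedHalfDisc R ⊆ U ∧
      DifferentiableOn ℂ G U ∧ ∀ z ∈ U, f z =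
        (∏ a ∈ halfDiscZeros f R, (z - a) ^ analyticOrderNatAt f a) * Complex.exp (G z) := by
  obtain ⟨g, hg1, hg2, hg3⟩ := exists_eq_prod_pow_mul (halfDiscZeros f R) f (by
    intro a ha
    rw [mem_halfDiscZeros hf hf0] at ha
    exact ⟨hf a ha.1.1, analyticOrderAt_ne_top_of_upperHalfPlane hf hf0 ha.1.1, ha.2⟩)
  have hgne : ∀ z ∈ closedHalfDisc R, g z ≠ 0 := by
    intro z hz
    by_cases h : z ∈ halfDiscZeros f R
    · exact hg2 z h
    · intro h0
      exact h ((mem_halfDiscZeros hf hf0).2 ⟨hz, by rw [hg1 z, h0, mul_zero]⟩)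
  set W : Set ℂ := {z | AnalyticAt ℂ g z ∧ g z ≠ 0} with hW
  have hWo : IsOpen W := by
    rw [isOpen_iff_mem_nhds]
    rintro z ⟨hz1, hz2⟩
    filter_upwards [hz1.eventually_analyticAt, hz1.continuousAt.eventually_ne hz2] with w h1 h2
    exact ⟨h1, h2⟩
  -- The half-disc is compact and convex, so a thin thickening of it stays inside the zero-free set
  -- and is still convex; a logarithm of `g` exists there.
  obtain ⟨δ, hδ, hsub⟩ := (isCompact_closedHalfDisc R).exists_thickening_subset_open hWo
    (fun z hz => ⟨hg3 z (hf z hz.1), hgne z hz⟩)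
  have hUo : IsOpen (Metric.thickening δ (closedHalfDisc R)) := Metric.isOpen_thickening
  have hUc : Convex ℝ (Metric.thickening δ (closedHalfDisc R)) :=
    (convex_closedHalfDisc R).thickening δ
  obtain ⟨G, hG1, hG2⟩ := hUc.exists_exp_eq hUo
    (fun z hz => (hsub hz).1.differentiableAt.differentiableWithinAt) (fun z hz => (hsub hz).2)
  exact ⟨_, G, hUo, hUc, Metric.self_subset_thickening hδ _, hG1, fun z hz => by
    rw [← hG2 z hz]; exact hg1 z⟩

end HalfPlane
end

/-! ### Mean values over half-circles. -/

noncomputable section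

lemma circleMap_mem_closedHalfDisc {r R θ : ℝ} (hr : 0 ≤ r) (hrR : r ≤ R)
    (hθ : θ ∈ Set.Icc 0 Real.pi) : circleMap 0 r θ ∈ closedHalfDisc R := by
  refine ⟨?_, ?_⟩
  · rw [circleMap_zero_im]
    exact mul_nonneg hr (Real.sin_nonneg_of_mem_Icc hθ)
  · rw [norm_circleMap_zero, abs_of_nonneg hr]; exact hrR

lemma ofReal_mem_closedHalfDisc {t R : ℝ} (h : |t| ≤ R) : (t : ℂ) ∈ closedHalfDisc R :=
  ⟨by simp, by simpa using h⟩

/-- The mean of a holomorphic function over a half-circle, in terms of its real values. -/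
lemma integral_re_halfCircle {U : Set ℂ} {G : ℂ → ℂ} (hU : IsOpen U) (hG : DifferentiableOn ℂ G U)
    {r : ℝ} (hr : 0 < r) (hrU : closedHalfDisc r ⊆ U) :
    IntervalIntegrable (fun t : ℝ => ((G (t : ℂ)).im - (G (-t : ℂ)).im) / t) volume 0 r ∧
    ∫ θ in (0 : ℝ)..Real.pi, (G (circleMap 0 r θ)).re =
      Real.pi * (G 0).re - ∫ t in (0 : ℝ)..r, ((G (t : ℂ)).im - (G (-t : ℂ)).im) / t := by
  have hpi := Real.pi_pos
  -- `K` is the radial derivative of `G(t e^{iθ})`, and `i t K` is its angular derivative.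
  -- Integrating first in `t` gives the half-circle mean minus `G(0)`, integrating first in `θ`
  -- gives the increments `G(-t) - G(t)`; Fubini equates the two.
  set K : ℝ → ℝ → ℂ := fun t θ => deriv G (circleMap 0 t θ) * Complex.exp (θ * Complex.I) with hK
  have hGd : ∀ z ∈ U, HasDerivAt G (deriv G z) z := fun z hz =>
    (hG.differentiableAt (hU.mem_nhds hz)).hasDerivAt
  have hdc : ContinuousOn (deriv G) U := (hG.deriv hU).continuousOn
  have hmem : ∀ t ∈ Set.Icc 0 r, ∀ θ ∈ Set.Icc 0 Real.pi, circleMap 0 t θ ∈ U := fun t ht θ hθ =>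
    hrU (circleMap_mem_closedHalfDisc ht.1 ht.2 hθ)
  have hKc : ContinuousOn (Function.uncurry K) (Set.Icc 0 r ×ˢ Set.Icc 0 Real.pi) := by
    refine ContinuousOn.mul ?_ (by fun_prop)
    refine hdc.comp (by unfold circleMap; fun_prop) ?_
    rintro ⟨t, θ⟩ ⟨ht, hθ⟩
    exact hmem t ht θ hθ
  have hKi : Integrable (Function.uncurry K)
      ((volume.restrict (Set.Ioc 0 r)).prod (volume.restrict (Set.Ioc 0 Real.pi))) := by
    rw [Measure.prod_restrict]
    exact (hKc.integrableOn_compact (isCompact_Icc.prod isCompact_Icc)).mono_set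
      (Set.prod_mono Set.Ioc_subset_Icc_self Set.Ioc_subset_Icc_self)
  have h1 : ∀ θ ∈ Set.Icc 0 Real.pi, ∫ t in (0 : ℝ)..r, K t θ = G (circleMap 0 r θ) - G 0 := by
    intro θ hθ
    have := intervalIntegral.integral_eq_sub_of_hasDerivAt (a := 0) (b := r)
      (f := fun t : ℝ => G (circleMap 0 t θ)) (f' := fun t => K t θ) ?_ ?_
    · simpa [circleMap] using this
    · intro t ht
      rw [Set.uIcc_of_le hr.le] at ht
      have h2 : HasDerivAt (fun t : ℝ => circleMap 0 t θ) (Complex.exp (θ * Complex.I)) t := by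
        simp only [circleMap_zero]
        simpa using (Complex.ofRealCLM.hasDerivAt (x := t)).mul_const (Complex.exp (θ * Complex.I))
      exact (hGd _ (hmem t ht θ hθ)).comp t h2
    · refine ContinuousOn.intervalIntegrable ?_
      rw [Set.uIcc_of_le hr.le]
      exact hKc.comp (f := fun t => (t, θ)) (by fun_prop) fun t ht => ⟨ht, hθ⟩
  have h2 : ∀ t ∈ Set.Ioc 0 r, (∫ θ in (0 : ℝ)..Real.pi, K t θ).re =
      -(((G (t : ℂ)).im - (G (-t : ℂ)).im) / t) := by
    intro t ht
    have ht' : t ∈ Set.Icc 0 r := Set.Ioc_subset_Icc_self ht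
    have := intervalIntegral.integral_eq_sub_of_hasDerivAt (a := 0) (b := Real.pi)
      (f := fun θ : ℝ => G (circleMap 0 t θ)) (f' := fun θ => (t * Complex.I) * K t θ) ?_ ?_
    · rw [intervalIntegral.integral_const_mul] at this
      have h3 : (∫ θ in (0 : ℝ)..Real.pi, K t θ) = (G (-t) - G t) / (t * Complex.I) := by
        have ht0 : (t : ℂ) ≠ 0 := by exact_mod_cast ht.1.ne'
        rw [eq_div_iff (mul_ne_zero ht0 Complex.I_ne_zero), mul_comm, this]
        simp [circleMap]
      rw [h3]
      have h4 : (G (-t) - G t) / (t * Complex.I) = ((G (-t) - G t) * (-Complex.I)) / (t : ℝ) := by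
        rw [div_mul_eq_div_div_swap, Complex.div_I]; ring
      rw [h4, Complex.div_ofReal_re]
      rw [Complex.mul_re, Complex.neg_re, Complex.neg_im, Complex.I_re, Complex.I_im,
        Complex.sub_im]
      ring
    · intro θ hθ
      rw [Set.uIcc_of_le hpi.le] at hθ
      have h3 := (hGd _ (hmem t ht' θ hθ)).comp θ (hasDerivAt_circleMap 0 t θ)
      refine HasDerivAt.congr_deriv h3 ?_
      simp only [hK, circleMap_zero]; ring
    · refine ContinuousOn.intervalIntegrable ?_
      rw [Set.uIcc_of_le hpi.le]
      refine ContinuousOn.mul (by fun_prop) ?_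
      exact hKc.comp (f := fun θ => (t, θ)) (by fun_prop) fun θ hθ => ⟨ht', hθ⟩
  have hint : IntegrableOn (fun t => ∫ θ in (0 : ℝ)..Real.pi, K t θ) (Set.Ioc 0 r) := by
    have := hKi.integral_prod_left
    refine this.congr ?_
    filter_upwards with t
    rw [intervalIntegral.integral_of_le hpi.le]
    rfl
  have hint2 : IntervalIntegrable
      (fun t : ℝ => ((G (t : ℂ)).im - (G (-t : ℂ)).im) / t) volume 0 r := by
    rw [intervalIntegrable_iff_integrableOn_Ioc_of_le hr.le]
    have := hint.re.neg
    refine IntegrableOn.congr_fun this (fun t ht => ?_) measurableSet_Ioc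
    simp only [Pi.neg_apply, RCLike.re_to_complex, h2 t ht, neg_neg]
  refine ⟨hint2, ?_⟩
  have hswap : ∫ t in (0 : ℝ)..r, ∫ θ in (0 : ℝ)..Real.pi, K t θ =
      ∫ θ in (0 : ℝ)..Real.pi, ∫ t in (0 : ℝ)..r, K t θ := by
    simp only [intervalIntegral.integral_of_le hr.le, intervalIntegral.integral_of_le hpi.le]
    exact integral_integral_swap hKi
  have hGcont : ContinuousOn (fun θ => G (circleMap 0 r θ)) (Set.uIcc 0 Real.pi) := by
    rw [Set.uIcc_of_le hpi.le]
    exact hG.continuousOn.comp (by fun_prop) fun θ hθ => hmem r ⟨hr.le, le_rfl⟩ θ hθ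
  have e1 : ∫ θ in (0 : ℝ)..Real.pi, ∫ t in (0 : ℝ)..r, K t θ =
      (∫ θ in (0 : ℝ)..Real.pi, G (circleMap 0 r θ)) - Real.pi * G 0 := by
    rw [intervalIntegral.integral_congr (g := fun θ => G (circleMap 0 r θ) - G 0)
      (fun θ hθ => h1 θ (by rwa [Set.uIcc_of_le hpi.le] at hθ)),
      intervalIntegral.integral_sub hGcont.intervalIntegrable (by simp)]
    simp
  have e2 : (∫ t in (0 : ℝ)..r, ∫ θ in (0 : ℝ)..Real.pi, K t θ).re =
      - ∫ t in (0 : ℝ)..r, ((G (t : ℂ)).im - (G (-t : ℂ)).im) / t := by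
    rw [← intervalIntegral.integral_neg, intervalIntegral.integral_of_le hr.le,
      intervalIntegral.integral_of_le hr.le, ← RCLike.re_to_complex, ← integral_re hint]
    exact setIntegral_congr_fun measurableSet_Ioc h2
  have e3 : (∫ θ in (0 : ℝ)..Real.pi, G (circleMap 0 r θ)).re =
      ∫ θ in (0 : ℝ)..Real.pi, (G (circleMap 0 r θ)).re := by
    rw [intervalIntegral.integral_of_le hpi.le, intervalIntegral.integral_of_le hpi.le,
      ← RCLike.re_to_complex, ← integral_re]
    · rfl
    · exact (intervalIntegrable_iff_integrableOn_Ioc_of_le hpi.le).1 hGcont.intervalIntegrable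
  rw [hswap, e1] at e2
  simp only [Complex.sub_re, e3] at e2
  have : ((Real.pi : ℂ) * G 0).re = Real.pi * (G 0).re := by simp
  linarith

/-- Reflecting a half-circle in the real axis. -/
lemma integral_log_norm_sub_add_conj {a : ℂ} {r : ℝ} (hr : 0 < r) :
    (∫ θ in (0 : ℝ)..Real.pi, Real.log ‖circleMap 0 r θ - a‖) +
      (∫ θ in (0 : ℝ)..Real.pi, Real.log ‖circleMap 0 r θ - (starRingEnd ℂ) a‖) =
      2 * Real.pi * (Real.log r + Real.posLog (r⁻¹ * ‖a‖)) := by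
  have hpi := Real.pi_pos
  have h := circleAverage_log_norm_sub_const_eq_log_radius_add_posLog (a := a) (c := 0) hr.ne'
  have hint : IntervalIntegrable (fun θ => Real.log ‖circleMap 0 r θ - a‖) volume 0
      (2 * Real.pi) := circleIntegrable_log_norm_sub_const (a := a) (c := 0) r
  have hi1 : IntervalIntegrable (fun θ => Real.log ‖circleMap 0 r θ - a‖) volume 0 Real.pi := by
    refine hint.mono_set ?_
    rw [Set.uIcc_of_le hpi.le, Set.uIcc_of_le (by positivity)]
    exact Set.Icc_subset_Icc le_rfl (by linarith)
  have hi2 : IntervalIntegrable (fun θ => Real.log ‖circleMap 0 r θ - a‖) volume Real.pi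
      (2 * Real.pi) := by
    refine hint.mono_set ?_
    rw [Set.uIcc_of_le (by linarith), Set.uIcc_of_le (by positivity)]
    exact Set.Icc_subset_Icc hpi.le le_rfl
  have h2 : (∫ θ in (0 : ℝ)..Real.pi, Real.log ‖circleMap 0 r θ - (starRingEnd ℂ) a‖) =
      ∫ θ in Real.pi..(2 * Real.pi), Real.log ‖circleMap 0 r θ - a‖ := by
    have := intervalIntegral.integral_comp_sub_left (a := 0) (b := Real.pi)
      (fun θ => Real.log ‖circleMap 0 r θ - a‖) (2 * Real.pi)
    rw [show 2 * Real.pi - Real.pi = Real.pi by ring, sub_zero] at this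
    rw [← this]
    refine intervalIntegral.integral_congr fun θ _ => ?_
    have h3 : circleMap 0 r (2 * Real.pi - θ) = (starRingEnd ℂ) (circleMap 0 r θ) := by
      apply Complex.ext
      · simp only [circleMap_zero_re, Complex.conj_re]
        rw [Real.cos_two_pi_sub]
      · simp only [circleMap_zero_im, Complex.conj_im]
        rw [Real.sin_two_pi_sub]; ring
    simp only [h3]
    rw [← Complex.norm_conj, map_sub, Complex.conj_conj]
  rw [h2, intervalIntegral.integral_add_adjacent_intervals hi1 hi2]
  rw [Real.circleAverage_def, smul_eq_mul] at h
  rw [zero_sub, norm_neg] at h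
  rw [← h]
  field_simp

lemma log_add_posLog_inv_mul {r b : ℝ} (hr : 0 < r) (hb : 0 < b) :
    Real.log r + Real.posLog (r⁻¹ * b) = Real.log b + Real.posLog (r / b) := by
  rw [show r⁻¹ * b = (r / b)⁻¹ by field_simp]
  have h1 := Real.posLog_sub_posLog_inv (x := r / b)
  rw [Real.log_div hr.ne' hb.ne'] at h1
  linarith

/-- The integral of `1 / t` over the part of `[0, r]` beyond `b` is `log⁺ (r / b)`. -/
lemma integral_indicator_div {r b : ℝ} (hr : 0 < r) (hb : 0 < b) :
    IntervalIntegrable (fun t : ℝ => (if b ≤ t then (1 : ℝ) else 0) / t) volume 0 r ∧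
    ∫ t in (0 : ℝ)..r, (if b ≤ t then (1 : ℝ) else 0) / t = Real.posLog (r / b) := by
  have heq : (fun t : ℝ => (if b ≤ t then (1 : ℝ) else 0) / t) =
      (Set.Ici b).indicator (fun t => t⁻¹) := by
    ext t
    by_cases h : b ≤ t <;> simp [Set.indicator, h]
  rw [heq]
  have hIc : Set.Ici b ∩ Set.Ioc 0 r = Set.Icc b r := by
    ext t; constructor
    · rintro ⟨h1, h2⟩; exact ⟨h1, h2.2⟩
    · rintro ⟨h1, h2⟩; exact ⟨h1, lt_of_lt_of_le hb h1, h2⟩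
  have hcont : ContinuousOn (fun t : ℝ => t⁻¹) (Set.Icc b r) :=
    continuousOn_inv₀.mono fun t ht => (lt_of_lt_of_le hb ht.1).ne'
  constructor
  · rw [intervalIntegrable_iff_integrableOn_Ioc_of_le hr.le, IntegrableOn,
      integrable_indicator_iff measurableSet_Ici, IntegrableOn,
      Measure.restrict_restrict measurableSet_Ici, hIc]
    exact hcont.integrableOn_compact isCompact_Icc
  · rw [intervalIntegral.integral_of_le hr.le, integral_indicator measurableSet_Ici,
      Measure.restrict_restrict measurableSet_Ici, hIc]
    rcases le_or_gt b r with h | h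
    · rw [integral_Icc_eq_integral_Ioc, ← intervalIntegral.integral_of_le h,
        integral_inv_of_pos hb hr, Real.posLog_def]
      simp only [Pi.sup_apply, Pi.zero_apply]
      rw [sup_eq_right.2]
      exact Real.log_nonneg ((one_le_div hb).2 h)
    · rw [Set.Icc_eq_empty (not_le.2 h), Measure.restrict_empty, integral_zero_measure, eq_comm,
        Real.posLog_eq_zero_iff, abs_of_pos (by positivity)]
      exact (div_le_one hb).2 h.le
end

/-! ### Jensen's formula for the half-disc. -/

noncomputable section

/-- The contribution of a zero `a` of the closed upper half-plane to the variation of the argument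
along `[-t, t]`. -/
def zeroArg (a : ℂ) (t : ℝ) : ℝ :=
  if 0 < a.im then ∫ x in (-t)..t, (((x : ℂ) - a)⁻¹).im else if ‖a‖ ≤ t then -Real.pi else 0

/-- The contribution of a zero `a` to the number of zeros in the open upper half-disc. -/
def zeroMark (a : ℂ) (t : ℝ) : ℝ := if 0 < a.im ∧ ‖a‖ ≤ t then 1 else 0

lemma intervalIntegrable_sum_fun {ι : Type*} {s : Finset ι} {g : ι → ℝ → ℝ} {a b : ℝ}
    (h : ∀ i ∈ s, IntervalIntegrable (g i) volume a b) :
    IntervalIntegrable (fun x => ∑ i ∈ s, g i x) volume a b := by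
  simpa only [Finset.sum_fn] using IntervalIntegrable.sum s h

lemma ofReal_sub_ne_zero {a : ℂ} (ha : a.im ≠ 0) (x : ℝ) : (x : ℂ) - a ≠ 0 := by
  intro h
  apply ha
  have := congrArg Complex.im h
  simpa using this

lemma continuous_inv_ofReal_sub_im {a : ℂ} (ha : a.im ≠ 0) :
    Continuous fun x : ℝ => (((x : ℂ) - a)⁻¹).im :=
  Complex.continuous_im.comp ((Complex.continuous_ofReal.sub continuous_const).inv₀
    (ofReal_sub_ne_zero ha))

lemma inv_ofReal_sub_im_of_real {a : ℂ} (ha : a.im = 0) (x : ℝ) : (((x : ℂ) - a)⁻¹).im = 0 := by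
  simp [Complex.inv_im, ha]

lemma integral_im_deriv {U : Set ℂ} {G : ℂ → ℂ} (hU : IsOpen U) (hG : DifferentiableOn ℂ G U)
    {t : ℝ} (ht : 0 ≤ t) (hrU : ∀ x ∈ Set.Icc (-t) t, ((x : ℝ) : ℂ) ∈ U) :
    IntervalIntegrable (fun x : ℝ => (deriv G x).im) volume (-t) t ∧
    ∫ x in (-t)..t, (deriv G x).im = (G t).im - (G (-t : ℂ)).im := by
  have hle : -t ≤ t := by linarith
  have hc : ContinuousOn (fun x : ℝ => (deriv G x).im) (Set.uIcc (-t) t) := by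
    rw [Set.uIcc_of_le hle]
    exact Complex.continuous_im.comp_continuousOn
      ((hG.deriv hU).continuousOn.comp Complex.continuous_ofReal.continuousOn hrU)
  refine ⟨hc.intervalIntegrable, ?_⟩
  have := intervalIntegral.integral_eq_sub_of_hasDerivAt (a := -t) (b := t)
    (f := fun x : ℝ => (G x).im) (f' := fun x => (deriv G x).im) (fun x hx => ?_)
    hc.intervalIntegrable
  · simpa using this
  · rw [Set.uIcc_of_le hle] at hx
    have h1 := (hG.differentiableAt (hU.mem_nhds (hrU x hx))).hasDerivAt.comp_ofReal
    exact Complex.imCLM.hasFDerivAt.comp_hasDerivAt x h1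

/-- Jensen's formula for a single factor `z - a`. Together with its mirror image `z - ā` it
integrates over the half-circle to a full-circle mean, which is classical. The image factor has no
zero in the closed upper half-plane, so `integral_re_halfCircle` evaluates it, and on the real line
its argument varies oppositely to that of `z - a`. For real `a` the two factors coincide and the
jump `-π` in `zeroArg` accounts for the result. -/
lemma halfCircle_integral_log_norm_sub {a : ℂ} (ha : 0 ≤ a.im) (ha0 : a ≠ 0) {r : ℝ} (hr : 0 < r) :
    IntervalIntegrable (fun t => zeroArg a t / t) volume 0 r ∧
    IntervalIntegrable (fun t => zeroMark a t / t) volume 0 r ∧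
    ∫ θ in (0 : ℝ)..Real.pi, Real.log ‖circleMap 0 r θ - a‖ =
      Real.pi * Real.log ‖a‖ + 2 * Real.pi * (∫ t in (0 : ℝ)..r, zeroMark a t / t) -
        ∫ t in (0 : ℝ)..r, zeroArg a t / t := by
  have hb : 0 < ‖a‖ := norm_pos_iff.2 ha0
  obtain ⟨hi, he⟩ := integral_indicator_div hr hb
  have hconj := integral_log_norm_sub_add_conj (a := a) hr
  rw [log_add_posLog_inv_mul hr hb] at hconj
  rcases ha.eq_or_lt with h0 | h0
  · have hA : ∀ t, zeroArg a t / t = (-Real.pi) * ((if ‖a‖ ≤ t then (1 : ℝ) else 0) / t) := by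
      intro t
      rw [zeroArg, if_neg (by rw [← h0]; simp)]
      split_ifs <;> ring
    have hM : ∀ t, zeroMark a t / t = 0 := by
      intro t
      rw [zeroMark, if_neg (by rw [← h0]; simp), zero_div]
    simp only [hA, hM]
    refine ⟨hi.const_mul _, by simp, ?_⟩
    rw [intervalIntegral.integral_const_mul, he]
    have : (starRingEnd ℂ) a = a := Complex.conj_eq_iff_im.2 h0.symm
    rw [this] at hconj
    simp only [intervalIntegral.integral_zero]
    linarith
  · set V : Set ℂ := {z | -a.im < z.im} with hV
    have hVo : IsOpen V := isOpen_lt continuous_const Complex.continuous_im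
    have hVc : Convex ℝ V := convex_halfSpace_im_gt _
    have hsub : ∀ z : ℂ, 0 ≤ z.im → z ∈ V := fun z hz => by
      simp only [hV]; exact lt_of_lt_of_le (by linarith) hz
    have hne : ∀ z ∈ V, z - (starRingEnd ℂ) a ≠ 0 := by
      intro z hz h
      have := congrArg Complex.im h
      simp at this
      have hz' : -a.im < z.im := hz
      linarith
    obtain ⟨G, hG, hGe⟩ := hVc.exists_exp_eq hVo (g := fun z => z - (starRingEnd ℂ) a)
      (by fun_prop) hne
    have hGre : ∀ z ∈ V, (G z).re = Real.log ‖z - (starRingEnd ℂ) a‖ := by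
      intro z hz
      have := hGe z hz
      rw [this, Complex.norm_exp, Real.log_exp]
    have hGd : ∀ z ∈ V, deriv G z = (z - (starRingEnd ℂ) a)⁻¹ := by
      intro z hz
      have h1 : HasDerivAt G (deriv G z) z := (hG.differentiableAt (hVo.mem_nhds hz)).hasDerivAt
      have h2 : HasDerivAt (fun z => z - (starRingEnd ℂ) a) (Complex.exp (G z) * deriv G z) z := by
        refine h1.cexp.congr_of_eventuallyEq ?_
        filter_upwards [hVo.mem_nhds hz] with w hw using hGe w hw
      have h3 := h2.unique ((hasDerivAt_id z).sub_const _)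
      rw [← hGe z hz] at h3
      exact eq_inv_of_mul_eq_one_right h3
    have hA : ∀ t, 0 < t → zeroArg a t / t = -(((G (t : ℂ)).im - (G (-t : ℂ)).im) / t) := by
      intro t ht
      rw [zeroArg, if_pos h0, ← (integral_im_deriv hVo hG ht.le
        (fun x _ => hsub _ (by simp))).2, ← neg_div, ← intervalIntegral.integral_neg]
      congr 1
      refine intervalIntegral.integral_congr fun x _ => ?_
      simp only [hGd x (hsub _ (by simp)), Complex.inv_im, Complex.sub_im, Complex.conj_im,
        Complex.ofReal_im, Complex.normSq_apply, Complex.sub_re, Complex.conj_re, Complex.ofReal_re]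
      ring
    obtain ⟨hG1, hG2⟩ := integral_re_halfCircle hVo hG hr
      (fun z hz => hsub z hz.1)
    have hM : ∀ t, zeroMark a t / t = (if ‖a‖ ≤ t then (1 : ℝ) else 0) / t := by
      intro t; simp [zeroMark, h0]
    have hL : ∫ θ in (0 : ℝ)..Real.pi, (G (circleMap 0 r θ)).re =
        ∫ θ in (0 : ℝ)..Real.pi, Real.log ‖circleMap 0 r θ - (starRingEnd ℂ) a‖ := by
      refine intervalIntegral.integral_congr fun θ hθ => ?_
      rw [Set.uIcc_of_le Real.pi_pos.le] at hθ
      exact hGre _ (hsub _ (circleMap_mem_closedHalfDisc hr.le le_rfl hθ).1)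
    have hG0 : (G 0).re = Real.log ‖a‖ := by
      rw [hGre 0 (hsub 0 (by simp)), zero_sub, norm_neg, Complex.norm_conj]
    have hAint : ∫ t in (0 : ℝ)..r, zeroArg a t / t =
        -∫ t in (0 : ℝ)..r, ((G (t : ℂ)).im - (G (-t : ℂ)).im) / t := by
      rw [← intervalIntegral.integral_neg]
      refine intervalIntegral.integral_congr_ae ?_
      filter_upwards with t ht
      rw [Set.uIoc_of_le hr.le] at ht
      exact hA t ht.1
    refine ⟨?_, by simpa only [hM] using hi, ?_⟩
    · refine hG1.neg.congr fun t ht => ?_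
      rw [Set.uIoc_of_le hr.le] at ht
      exact (hA t ht.1).symm
    · simp only [hM]
      rw [he, hAint]
      rw [hL, hG0] at hG2
      linarith

section Jensen

variable {f : ℂ → ℂ}

lemma zeroCount_eq_sum (hf : AnalyticOnNhd ℂ f {z : ℂ | 0 ≤ z.im}) (hf0 : f 0 ≠ 0) {R : ℝ}
    (S : Set ℂ) [DecidablePred (· ∈ S)] (hS : S ⊆ closedHalfDisc R) :
    (zeroCount f S : ℝ) = ∑ a ∈ halfDiscZeros f R,
      (analyticOrderNatAt f a : ℝ) * (if a ∈ S then 1 else 0) := by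
  have hset : {z : ℂ | z ∈ S ∧ f z = 0} = ((halfDiscZeros f R).filter (· ∈ S) : Finset ℂ) := by
    ext z
    simp only [Finset.coe_filter, mem_halfDiscZeros hf hf0]
    constructor
    · rintro ⟨h1, h2⟩; exact ⟨⟨hS h1, h2⟩, h1⟩
    · rintro ⟨⟨_, h2⟩, h1⟩; exact ⟨h1, h2⟩
  rw [zeroCount, hset, finsum_mem_coe_finset, Finset.sum_filter]
  push_cast
  refine Finset.sum_congr rfl fun a _ => ?_
  split_ifs <;> simp

lemma upperZeroCount_eq_sum (hf : AnalyticOnNhd ℂ f {z : ℂ | 0 ≤ z.im}) (hf0 : f 0 ≠ 0) {t R : ℝ}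
    (htR : t ≤ R) : (upperZeroCount f t : ℝ) = ∑ a ∈ halfDiscZeros f R,
      (analyticOrderNatAt f a : ℝ) * zeroMark a t := by
  classical
  rw [upperZeroCount, zeroCount_eq_sum hf hf0 (R := R)]
  · rfl
  · rintro z ⟨h1, h2⟩; exact ⟨h1.le, h2.trans htR⟩

lemma realZeroCount_eq_sum (hf : AnalyticOnNhd ℂ f {z : ℂ | 0 ≤ z.im}) (hf0 : f 0 ≠ 0) {t R : ℝ}
    (htR : t ≤ R) : (realZeroCount f t : ℝ) = ∑ a ∈ halfDiscZeros f R,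
      (analyticOrderNatAt f a : ℝ) * (if a.im = 0 ∧ ‖a‖ ≤ t then 1 else 0) := by
  classical
  rw [realZeroCount, zeroCount_eq_sum hf hf0 (R := R)]
  · rfl
  · rintro z ⟨h1, h2⟩; exact ⟨h1.ge, h2.trans htR⟩

lemma logDeriv_prod_pow_mul_exp {s : Finset ℂ} {m : ℂ → ℕ} {G : ℂ → ℂ} {z : ℂ}
    (hG : DifferentiableAt ℂ G z) (hz : z ∉ s) (hfz : f =ᶠ[𝓝 z]
      fun w => (∏ a ∈ s, (w - a) ^ m a) * Complex.exp (G w)) :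
    deriv f z / f z = (∑ a ∈ s, (m a : ℂ) * (z - a)⁻¹) + deriv G z := by
  have hne : ∀ a ∈ s, (z - a) ^ m a ≠ 0 := fun a ha =>
    pow_ne_zero _ (sub_ne_zero.2 fun h => hz (h ▸ ha))
  rw [hfz.deriv_eq, hfz.self_of_nhds, ← logDeriv_apply, logDeriv_mul
    (g := fun w => Complex.exp (G w)) z (Finset.prod_ne_zero_iff.2 hne) (Complex.exp_ne_zero _)
    (by fun_prop) (by fun_prop), logDeriv_prod hne (by intros; fun_prop)]
  congr 1
  · refine Finset.sum_congr rfl fun a ha => ?_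
    rw [logDeriv_fun_pow (by fun_prop), logDeriv_apply]
    simp
  · rw [logDeriv_apply, deriv_cexp hG, mul_div_cancel_left₀ _ (Complex.exp_ne_zero _)]

/-- The argument is additive over the factors. A real zero is invisible in the integral, because `Im
(x - a)⁻¹ = 0` for real `x` and `a`; it contributes only through the term `-π` per real zero, which
is the value of `zeroArg` there. -/
lemma argVariation_eq_sum (hf : AnalyticOnNhd ℂ f {z : ℂ | 0 ≤ z.im}) (hf0 : f 0 ≠ 0) {t R : ℝ}
    (ht : 0 < t) (htR : t ≤ R) {U : Set ℂ} {G : ℂ → ℂ} (hU : IsOpen U)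
    (hRU : closedHalfDisc R ⊆ U) (hG : DifferentiableOn ℂ G U) (hfU : ∀ z ∈ U, f z =
        (∏ a ∈ halfDiscZeros f R, (z - a) ^ analyticOrderNatAt f a) * Complex.exp (G z)) :
    argVariation f t = (∑ a ∈ halfDiscZeros f R, (analyticOrderNatAt f a : ℝ) * zeroArg a t) +
      ((G t).im - (G (-t : ℂ)).im) := by
  have hle : -t ≤ t := by linarith
  have hmem : ∀ x ∈ Set.Icc (-t) t, ((x : ℝ) : ℂ) ∈ U := fun x hx =>
    hRU (ofReal_mem_closedHalfDisc ((abs_le.2 hx).trans htR))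
  obtain ⟨hi, he⟩ := integral_im_deriv hU hG ht.le hmem
  have hint : ∀ a : ℂ, IntervalIntegrable (fun x : ℝ => (((x : ℂ) - a)⁻¹).im) volume (-t) t := by
    intro a
    by_cases ha : a.im = 0
    · simp [inv_ofReal_sub_im_of_real ha]
    · exact (continuous_inv_ofReal_sub_im ha).intervalIntegrable _ _
  have h1 : ∫ x in (-t)..t, (deriv f (x : ℂ) / f (x : ℂ)).im =
      ∫ x in (-t)..t, ((∑ a ∈ halfDiscZeros f R, (analyticOrderNatAt f a : ℝ) *
        (((x : ℂ) - a)⁻¹).im) + (deriv G x).im) := by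
    refine intervalIntegral.integral_congr_ae ?_
    have hfin : ((fun x : ℝ => (x : ℂ)) ⁻¹' (halfDiscZeros f R : Set ℂ)).Finite :=
      (Finset.finite_toSet _).preimage Complex.ofReal_injective.injOn
    filter_upwards [compl_mem_ae_iff.2 (hfin.measure_zero volume)] with x hx hxt
    rw [Set.uIoc_of_le hle] at hxt
    have hxU := hmem x (Set.Ioc_subset_Icc_self hxt)
    rw [logDeriv_prod_pow_mul_exp (hG.differentiableAt (hU.mem_nhds hxU)) (by simpa using hx)
      (by filter_upwards [hU.mem_nhds hxU] with w hw using hfU w hw)]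
    rw [Complex.add_im, Complex.im_sum]
    congr 1
    refine Finset.sum_congr rfl fun a _ => ?_
    rw [← Complex.ofReal_natCast, Complex.im_ofReal_mul]
  rw [argVariation, h1, intervalIntegral.integral_add
    (intervalIntegrable_sum_fun fun a _ => (hint a).const_mul _) hi, he,
    intervalIntegral.integral_finsetSum (fun a _ => (hint a).const_mul _),
    realZeroCount_eq_sum hf hf0 htR, Finset.mul_sum, add_sub_right_comm, ← Finset.sum_sub_distrib]
  congr 1
  refine Finset.sum_congr rfl fun a ha => ?_
  rw [intervalIntegral.integral_const_mul, zeroArg]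
  have hai := ((mem_halfDiscZeros hf hf0).1 ha).1.1
  rcases hai.eq_or_lt with h0 | h0
  · rw [← h0]
    simp only [inv_ofReal_sub_im_of_real h0.symm, intervalIntegral.integral_zero, lt_irrefl,
      if_false, true_and]
    split_ifs <;> ring
  · simp [h0, h0.ne']

lemma halfCircle_intervalIntegrable_log_norm {g : ℂ → ℂ} {r : ℝ} (hr : 0 < r)
    (hg : AnalyticOnNhd ℂ g {z : ℂ | 0 ≤ z.im}) :
    IntervalIntegrable (fun θ => Real.log ‖g (circleMap 0 r θ)‖) volume 0 Real.pi := by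
  refine MeromorphicOn.intervalIntegrable_log_norm (f := fun θ : ℝ => g (circleMap 0 r θ)) ?_
  intro θ hθ
  rw [Set.uIcc_of_le Real.pi_pos.le] at hθ
  have h1 : AnalyticAt ℂ g (circleMap 0 r θ) := hg _ (circleMap_mem_closedHalfDisc hr.le le_rfl hθ).1
  have h2 : AnalyticAt ℝ (fun θ : ℝ => circleMap 0 r θ) θ := analyticOnNhd_circleMap 0 r θ (Set.mem_univ _)
  exact (h1.restrictScalars.comp h2).meromorphicAt

/-- Jensen's formula for the upper half-disc. -/
theorem halfDisc_jensen (hf : AnalyticOnNhd ℂ f {z : ℂ | 0 ≤ z.im}) (hf0 : f 0 = 1) {r : ℝ}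
    (hr : 0 < r) :
    IntervalIntegrable (fun t => argVariation f t / t) volume 0 r ∧
    IntervalIntegrable (fun t => (upperZeroCount f t : ℝ) / t) volume 0 r ∧
    ∫ θ in (0 : ℝ)..Real.pi, Real.log ‖f (circleMap 0 r θ)‖ =
      2 * Real.pi * (∫ t in (0 : ℝ)..r, (upperZeroCount f t : ℝ) / t) -
        ∫ t in (0 : ℝ)..r, argVariation f t / t := by
  have hpi := Real.pi_pos
  have hf0' : f 0 ≠ 0 := by simp [hf0]
  obtain ⟨U, G, hU, -, hRU, hG, hfU⟩ := exists_factorization hf hf0' r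
  obtain ⟨hGi, hGe⟩ := integral_re_halfCircle hU hG hr hRU
  set s := halfDiscZeros f r with hs
  have hsz : ∀ a ∈ s, 0 ≤ a.im ∧ a ≠ 0 := fun a ha => by
    have := (mem_halfDiscZeros hf hf0').1 ha
    exact ⟨this.1.1, fun h => hf0' (h ▸ this.2)⟩
  have key := fun a (ha : a ∈ s) => halfCircle_integral_log_norm_sub (hsz a ha).1 (hsz a ha).2 hr
  have hA : ∀ t ∈ Set.Ioc 0 r, argVariation f t / t =
      (∑ a ∈ s, (analyticOrderNatAt f a : ℝ) * (zeroArg a t / t)) +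
      ((G t).im - (G (-t : ℂ)).im) / t := by
    intro t ht
    rw [argVariation_eq_sum hf hf0' ht.1 ht.2 hU hRU hG hfU, add_div, Finset.sum_div]
    simp only [mul_div_assoc, hs]
  have hN : ∀ t ∈ Set.Ioc 0 r, (upperZeroCount f t : ℝ) / t =
      ∑ a ∈ s, (analyticOrderNatAt f a : ℝ) * (zeroMark a t / t) := by
    intro t ht
    rw [upperZeroCount_eq_sum hf hf0' ht.2, Finset.sum_div]
    simp only [mul_div_assoc, hs]
  have hIoc : Set.uIoc 0 r = Set.Ioc 0 r := Set.uIoc_of_le hr.le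
  have iA : IntervalIntegrable (fun t => ∑ a ∈ s, (analyticOrderNatAt f a : ℝ) * (zeroArg a t / t))
      volume 0 r := intervalIntegrable_sum_fun fun a ha => (key a ha).1.const_mul _
  have iN : IntervalIntegrable (fun t => ∑ a ∈ s, (analyticOrderNatAt f a : ℝ) * (zeroMark a t / t))
      volume 0 r := intervalIntegrable_sum_fun fun a ha => (key a ha).2.1.const_mul _
  refine ⟨(iA.add hGi).congr fun t ht => (hA t (hIoc ▸ ht)).symm,
    iN.congr fun t ht => (hN t (hIoc ▸ ht)).symm, ?_⟩
  have eA : ∫ t in (0 : ℝ)..r, argVariation f t / t =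
      (∑ a ∈ s, (analyticOrderNatAt f a : ℝ) * ∫ t in (0 : ℝ)..r, zeroArg a t / t) +
      ∫ t in (0 : ℝ)..r, ((G t).im - (G (-t : ℂ)).im) / t := by
    rw [intervalIntegral.integral_congr_ae (g := fun t =>
      (∑ a ∈ s, (analyticOrderNatAt f a : ℝ) * (zeroArg a t / t)) +
      ((G t).im - (G (-t : ℂ)).im) / t) (by filter_upwards with t ht using hA t (hIoc ▸ ht)),
      intervalIntegral.integral_add iA hGi,
      intervalIntegral.integral_finsetSum fun a ha => (key a ha).1.const_mul _]
    simp only [intervalIntegral.integral_const_mul]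
  have eN : ∫ t in (0 : ℝ)..r, (upperZeroCount f t : ℝ) / t =
      ∑ a ∈ s, (analyticOrderNatAt f a : ℝ) * ∫ t in (0 : ℝ)..r, zeroMark a t / t := by
    rw [intervalIntegral.integral_congr_ae (g := fun t =>
      ∑ a ∈ s, (analyticOrderNatAt f a : ℝ) * (zeroMark a t / t))
      (by filter_upwards with t ht using hN t (hIoc ▸ ht)),
      intervalIntegral.integral_finsetSum fun a ha => (key a ha).2.1.const_mul _]
    simp only [intervalIntegral.integral_const_mul]
  have hlog : ∀ z ∈ U, z ∉ s → Real.log ‖f z‖ =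
      (∑ a ∈ s, (analyticOrderNatAt f a : ℝ) * Real.log ‖z - a‖) + (G z).re := by
    intro z hz hzs
    have hne : ∀ a ∈ s, ‖z - a‖ ^ analyticOrderNatAt f a ≠ 0 := fun a ha =>
      pow_ne_zero _ (norm_ne_zero_iff.2 (sub_ne_zero.2 fun h => hzs (h ▸ ha)))
    rw [hfU z hz, norm_mul, norm_prod, Complex.norm_exp]
    simp only [norm_pow]
    rw [Real.log_mul (Finset.prod_ne_zero_iff.2 hne) (Real.exp_ne_zero _), Real.log_exp,
      Real.log_prod hne]
    simp only [Real.log_pow]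
  have hint : ∀ a : ℂ, IntervalIntegrable (fun θ => Real.log ‖circleMap 0 r θ - a‖) volume 0
      Real.pi := fun a =>
    halfCircle_intervalIntegrable_log_norm (g := fun z => z - a) hr (fun z _ => by fun_prop)
  have iG : IntervalIntegrable (fun θ => (G (circleMap 0 r θ)).re) volume 0 Real.pi := by
    refine ContinuousOn.intervalIntegrable ?_
    rw [Set.uIcc_of_le hpi.le]
    exact Complex.continuous_re.comp_continuousOn (hG.continuousOn.comp (by fun_prop)
      fun θ hθ => hRU (circleMap_mem_closedHalfDisc hr.le le_rfl hθ))
  have eI : ∫ θ in (0 : ℝ)..Real.pi, Real.log ‖f (circleMap 0 r θ)‖ =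
      (∑ a ∈ s, (analyticOrderNatAt f a : ℝ) *
        ∫ θ in (0 : ℝ)..Real.pi, Real.log ‖circleMap 0 r θ - a‖) +
      ∫ θ in (0 : ℝ)..Real.pi, (G (circleMap 0 r θ)).re := by
    rw [intervalIntegral.integral_congr_ae (g := fun θ => (∑ a ∈ s, (analyticOrderNatAt f a : ℝ) *
      Real.log ‖circleMap 0 r θ - a‖) + (G (circleMap 0 r θ)).re),
      intervalIntegral.integral_add (intervalIntegrable_sum_fun fun a _ => (hint a).const_mul _) iG,
      intervalIntegral.integral_finsetSum fun a _ => (hint a).const_mul _]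
    · simp only [intervalIntegral.integral_const_mul]
    · have hcount : ((fun θ : ℝ => circleMap 0 r θ) ⁻¹' (s : Set ℂ)).Countable :=
        s.countable_toSet.preimage_circleMap 0 hr.ne'
      filter_upwards [compl_mem_ae_iff.2 (hcount.measure_zero volume)] with θ hθ hθ2
      rw [Set.uIoc_of_le hpi.le] at hθ2
      exact hlog _ (hRU (circleMap_mem_closedHalfDisc hr.le le_rfl (Set.Ioc_subset_Icc_self hθ2)))
        (by simpa using hθ)
  -- The normalisation `f 0 = 1` identifies `Re G(0)`, so that it cancels the terms `π log ‖a‖`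
  -- coming from the individual factors.
  have h0 : 0 = (∑ a ∈ s, (analyticOrderNatAt f a : ℝ) * Real.log ‖a‖) + (G 0).re := by
    have := hlog 0 (hRU ⟨by simp, by simpa using hr.le⟩) (fun h => (hsz 0 h).2 rfl)
    simpa [hf0] using this
  rw [eI, hGe, eA, eN]
  have hsum : (∑ a ∈ s, (analyticOrderNatAt f a : ℝ) *
        ∫ θ in (0 : ℝ)..Real.pi, Real.log ‖circleMap 0 r θ - a‖) =
      Real.pi * (∑ a ∈ s, (analyticOrderNatAt f a : ℝ) * Real.log ‖a‖) +
      2 * Real.pi * (∑ a ∈ s, (analyticOrderNatAt f a : ℝ) * ∫ t in (0 : ℝ)..r, zeroMark a t / t) -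
      ∑ a ∈ s, (analyticOrderNatAt f a : ℝ) * ∫ t in (0 : ℝ)..r, zeroArg a t / t := by
    rw [Finset.mul_sum, Finset.mul_sum, ← Finset.sum_add_distrib, ← Finset.sum_sub_distrib]
    refine Finset.sum_congr rfl fun a ha => ?_
    rw [(key a ha).2.2]; ring
  rw [hsum]
  have h0' : (G 0).re = -(∑ a ∈ s, (analyticOrderNatAt f a : ℝ) * Real.log ‖a‖) := by linarith
  rw [h0']; ring

end Jensen
end

/-! ### Poisson's formula in the half-disc. -/

noncomputable section

/-- Poisson kernel of the upper half-disc of radius `R` at a point `t` of the diameter. -/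
def segKer (R : ℝ) (z : ℂ) (t : ℝ) : ℝ :=
  z.im / Real.pi * (1 / Complex.normSq (t - z) - R ^ 2 / Complex.normSq (R ^ 2 - t * z))

/-- Poisson kernel of the upper half-disc of radius `R` at the point `R e ^ {i θ}` of the arc. -/
def arcKer (R : ℝ) (z : ℂ) (θ : ℝ) : ℝ :=
  (R ^ 2 - ‖z‖ ^ 2) / (2 * Real.pi) * (1 / Complex.normSq (circleMap 0 R θ - z) -
    1 / Complex.normSq (circleMap 0 R θ - (starRingEnd ℂ) z))

/-- The Poisson integral of `u` over the boundary of the upper half-disc of radius `R`. -/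
def halfDiscPoisson (R : ℝ) (z : ℂ) (u : ℂ → ℝ) : ℝ :=
  (∫ t in (-R)..R, u t * segKer R z t) +
    ∫ θ in (0 : ℝ)..Real.pi, u (circleMap 0 R θ) * arcKer R z θ

variable {R : ℝ} {z : ℂ}

lemma halfDisc_mem_nhds (hz : 0 < z.im) (hzR : ‖z‖ < R) : closedHalfDisc R ∈ 𝓝 z := by
  have h1 : {w : ℂ | 0 < w.im} ∈ 𝓝 z := (isOpen_lt continuous_const Complex.continuous_im).mem_nhds hz
  have h2 : {w : ℂ | ‖w‖ < R} ∈ 𝓝 z := (isOpen_lt continuous_norm continuous_const).mem_nhds hzR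
  filter_upwards [h1, h2] with w h3 h4
  exact ⟨(show 0 < w.im from h3).le, (show ‖w‖ < R from h4).le⟩

/-- Cauchy's theorem for the upper half-disc. -/
lemma halfDisc_cauchy (hR : 0 < R) {g : ℂ → ℂ} (hg : DifferentiableOn ℂ g (closedHalfDisc R)) :
    (∫ t in (-R)..R, g t) + ∫ θ in (0 : ℝ)..Real.pi,
      g (circleMap 0 R θ) * (circleMap 0 R θ * Complex.I) = 0 := by
  have hpi := Real.pi_pos
  obtain ⟨G, hG⟩ := (convex_closedHalfDisc R).exists_forall_hasDerivWithinAt hg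
  have hle : -R ≤ R := by linarith
  have hGc : ContinuousOn G (closedHalfDisc R) := fun w hw => (hG w hw).continuousWithinAt
  have m1 : ∀ t ∈ Set.Icc (-R) R, ((t : ℝ) : ℂ) ∈ closedHalfDisc R := fun t ht =>
    ofReal_mem_closedHalfDisc (abs_le.2 ht)
  have m2 : ∀ θ ∈ Set.Icc 0 Real.pi, circleMap 0 R θ ∈ closedHalfDisc R := fun θ hθ =>
    circleMap_mem_closedHalfDisc hR.le le_rfl hθ
  have e1 : ∫ t in (-R)..R, g t = G R - G (-R : ℝ) := by
    refine intervalIntegral.integral_eq_sub_of_hasDerivAt_of_le hle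
      (f := fun t : ℝ => G t)
      (hGc.comp Complex.continuous_ofReal.continuousOn m1) ?_ ?_
    · intro t ht
      have h1 : HasDerivWithinAt (fun t : ℝ => (t : ℂ)) 1 (Set.Icc (-R) R) t :=
        (Complex.ofRealCLM.hasDerivAt (x := t)).hasDerivWithinAt
      have := (hG t (m1 t (Set.Ioo_subset_Icc_self ht))).scomp t h1 m1
      refine (this.hasDerivAt (Icc_mem_nhds ht.1 ht.2)).congr_deriv ?_
      rw [one_smul]
    · refine ContinuousOn.intervalIntegrable ?_
      rw [Set.uIcc_of_le hle]
      exact hg.continuousOn.comp Complex.continuous_ofReal.continuousOn m1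
  have e2 : ∫ θ in (0 : ℝ)..Real.pi, g (circleMap 0 R θ) * (circleMap 0 R θ * Complex.I) =
      G (circleMap 0 R Real.pi) - G (circleMap 0 R 0) := by
    refine intervalIntegral.integral_eq_sub_of_hasDerivAt_of_le hpi.le
      (f := fun θ : ℝ => G (circleMap 0 R θ))
      (hGc.comp (by fun_prop) m2) ?_ ?_
    · intro θ hθ
      have h1 := (hasDerivAt_circleMap 0 R θ).hasDerivWithinAt (s := Set.Icc 0 Real.pi)
      have := (hG _ (m2 θ (Set.Ioo_subset_Icc_self hθ))).scomp θ h1 m2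
      refine (this.hasDerivAt (Icc_mem_nhds hθ.1 hθ.2)).congr_deriv ?_
      rw [smul_eq_mul, mul_comm]
    · refine ContinuousOn.intervalIntegrable ?_
      rw [Set.uIcc_of_le hpi.le]
      exact (hg.continuousOn.comp (by fun_prop) m2).mul (by fun_prop)
  rw [e1, e2]
  simp [circleMap]

lemma halfDisc_sub_ne_zero (hzR : ‖z‖ < R) (θ : ℝ) : circleMap 0 R θ - z ≠ 0 := by
  intro h
  have h1 : ‖circleMap 0 R θ‖ = ‖z‖ := by rw [sub_eq_zero.1 h]
  rw [norm_circleMap_zero] at h1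
  have := le_abs_self R
  linarith

/-- Since `w + z` has no zero in the half-disc, Cauchy's theorem applies to `(w + z)⁻¹`. Read
through `w ↦ -w`, it says that the lower half of the circle may be replaced by the diameter in the
integral of `(w - z)⁻¹` over the full circle. -/
lemma halfDisc_integral_inv (hz : 0 < z.im) (hzR : ‖z‖ < R) :
    (∫ t in (-R)..R, ((t : ℂ) - z)⁻¹) + ∫ θ in (0 : ℝ)..Real.pi,
      (circleMap 0 R θ - z)⁻¹ * (circleMap 0 R θ * Complex.I) = 2 * Real.pi * Complex.I := by
  have hR : 0 < R := (norm_nonneg z).trans_lt hzR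
  have hpi := Real.pi_pos
  have h1 := halfDisc_cauchy hR (g := fun w => (w + z)⁻¹) (by
    intro w hw
    refine (DifferentiableAt.inv (by fun_prop) ?_).differentiableWithinAt
    intro h
    have := congrArg Complex.im h
    simp at this
    have := hw.1
    linarith)
  have h2 : ∫ t in (-R)..R, ((t : ℂ) + z)⁻¹ = -∫ t in (-R)..R, ((t : ℂ) - z)⁻¹ := by
    rw [← intervalIntegral.integral_neg]
    have := intervalIntegral.integral_comp_neg (a := -R) (b := R) (fun t : ℝ => -((t : ℂ) - z)⁻¹)
    rw [neg_neg] at this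
    rw [← this]
    refine intervalIntegral.integral_congr fun t _ => ?_
    simp only [Complex.ofReal_neg, ← inv_neg]
    ring
  have hc : Continuous fun θ => (circleMap 0 R θ - z)⁻¹ * (circleMap 0 R θ * Complex.I) :=
    (((continuous_circleMap 0 R).sub continuous_const).inv₀ (halfDisc_sub_ne_zero hzR)).mul
      (by fun_prop)
  have h3 : ∫ θ in (0 : ℝ)..Real.pi, (circleMap 0 R θ + z)⁻¹ * (circleMap 0 R θ * Complex.I) =
      ∫ θ in Real.pi..(2 * Real.pi), (circleMap 0 R θ - z)⁻¹ * (circleMap 0 R θ * Complex.I) := by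
    have := intervalIntegral.integral_comp_add_right (a := 0) (b := Real.pi)
      (fun θ => (circleMap 0 R θ - z)⁻¹ * (circleMap 0 R θ * Complex.I)) Real.pi
    rw [zero_add, show Real.pi + Real.pi = 2 * Real.pi by ring] at this
    rw [← this]
    refine intervalIntegral.integral_congr fun θ _ => ?_
    have h4 : circleMap 0 R (θ + Real.pi) = -circleMap 0 R θ := by
      simp [circleMap_zero, add_mul, Complex.exp_add]
    simp only [h4]
    rw [show -circleMap 0 R θ - z = -(circleMap 0 R θ + z) by ring, inv_neg]
    ring
  have h5 := circleIntegral.integral_sub_inv_of_mem_ball (c := 0) (w := z) (R := R) (by simpa using hzR)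
  rw [circleIntegral] at h5
  have h6 : ∫ θ in (0 : ℝ)..2 * Real.pi, deriv (circleMap 0 R) θ • (circleMap 0 R θ - z)⁻¹ =
      ∫ θ in (0 : ℝ)..2 * Real.pi, (circleMap 0 R θ - z)⁻¹ * (circleMap 0 R θ * Complex.I) := by
    refine intervalIntegral.integral_congr fun θ _ => ?_
    simp only [deriv_circleMap, smul_eq_mul]; ring
  rw [h6, ← intervalIntegral.integral_add_adjacent_intervals (b := Real.pi)
    (hc.intervalIntegrable _ _) (hc.intervalIntegrable _ _), ← h3] at h5
  rw [h2] at h1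
  linear_combination h5 - h1

/-- The Cauchy-type kernel whose boundary values are the Poisson kernels of the half-disc. -/
def halfDiscCauchyKer (R : ℝ) (z w : ℂ) : ℂ :=
  (w - z)⁻¹ - ((w - (starRingEnd ℂ) z)⁻¹ - z * (z * w - R ^ 2)⁻¹ +
    (starRingEnd ℂ) z * ((starRingEnd ℂ) z * w - R ^ 2)⁻¹)

lemma ofReal_sq_sub_mul_ne_zero (hR : 0 < R) (hz : z.im ≠ 0) (t : ℝ) :
    ((R : ℂ) ^ 2 - t * z) ≠ 0 := by
  intro h
  have h1 := congrArg Complex.im h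
  simp [← Complex.ofReal_pow, hz] at h1
  have : (R : ℂ) ^ 2 = 0 := by simpa [h1] using h
  simp [hR.ne'] at this

lemma halfDiscCauchyKer_ofReal (hR : 0 < R) (hz : z.im ≠ 0) (t : ℝ) :
    halfDiscCauchyKer R z t = 2 * Real.pi * Complex.I * (segKer R z t : ℝ) := by
  have h1 := ofReal_sub_ne_zero hz t
  have h2 : (t : ℂ) - (starRingEnd ℂ) z ≠ 0 := ofReal_sub_ne_zero (by simpa using hz) t
  have h3 := ofReal_sq_sub_mul_ne_zero hR hz t
  have h4 := ofReal_sq_sub_mul_ne_zero hR (z := (starRingEnd ℂ) z) (by simpa using hz) t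
  have hp : (Real.pi : ℂ) ≠ 0 := by exact_mod_cast Real.pi_ne_zero
  have e1 : ((Complex.normSq (t - z) : ℝ) : ℂ) = (t - z) * (t - (starRingEnd ℂ) z) := by
    rw [← Complex.mul_conj]; simp
  have e2 : ((Complex.normSq (R ^ 2 - t * z) : ℝ) : ℂ) =
      (R ^ 2 - t * z) * (R ^ 2 - t * (starRingEnd ℂ) z) := by
    rw [← Complex.mul_conj]; simp
  have e3 : ((z.im : ℝ) : ℂ) = (z - (starRingEnd ℂ) z) / (2 * Complex.I) := by
    rw [Complex.sub_conj]; push_cast; field_simp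
  have h3' : z * t - (R : ℂ) ^ 2 ≠ 0 := fun h => h3 (by linear_combination -h)
  have h4' : (starRingEnd ℂ) z * t - (R : ℂ) ^ 2 ≠ 0 := fun h => h4 (by linear_combination -h)
  rw [halfDiscCauchyKer, segKer]
  push_cast
  rw [e1, e2, e3]
  have h5 : (z * t - (R : ℂ) ^ 2)⁻¹ = -((R : ℂ) ^ 2 - t * z)⁻¹ := by rw [← inv_neg]; ring_nf
  have h6 : ((starRingEnd ℂ) z * t - (R : ℂ) ^ 2)⁻¹ = -((R : ℂ) ^ 2 - t * (starRingEnd ℂ) z)⁻¹ := by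
    rw [← inv_neg]; ring_nf
  rw [h5, h6]
  field_simp
  ring

lemma halfDiscCauchyKer_circleMap (hzR : ‖z‖ < R) (θ : ℝ) :
    halfDiscCauchyKer R z (circleMap 0 R θ) * (circleMap 0 R θ * Complex.I) =
      2 * Real.pi * Complex.I * (arcKer R z θ : ℝ) := by
  have hR : 0 < R := (norm_nonneg z).trans_lt hzR
  set w := circleMap 0 R θ with hw
  -- On the arc `R² = w w̄`, so the terms with poles at `R²/z` and `R²/z̄` become rational in `w`,
  -- `w̄`, `z`, `z̄`, and the claim is an algebraic identity.
  have hwn : w * (starRingEnd ℂ) w = (R : ℂ) ^ 2 := by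
    rw [Complex.mul_conj, Complex.normSq_eq_norm_sq, hw, norm_circleMap_zero, abs_of_pos hR]
    push_cast; ring
  have h1 : w - z ≠ 0 := halfDisc_sub_ne_zero hzR θ
  have h2 : w - (starRingEnd ℂ) z ≠ 0 := halfDisc_sub_ne_zero (by simpa using hzR) θ
  have h1' : (starRingEnd ℂ) w - (starRingEnd ℂ) z ≠ 0 := by
    rw [← map_sub]; exact (map_ne_zero _).2 h1
  have h2' : (starRingEnd ℂ) w - z ≠ 0 := by
    intro h; apply h2
    have := congrArg (starRingEnd ℂ) h
    simpa using this
  have hw0 : w ≠ 0 := by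
    rw [hw]; exact circleMap_ne_center hR.ne'
  have hp : (Real.pi : ℂ) ≠ 0 := by exact_mod_cast Real.pi_ne_zero
  have e1 : ((Complex.normSq (w - z) : ℝ) : ℂ) = (w - z) * ((starRingEnd ℂ) w - (starRingEnd ℂ) z) := by
    rw [← Complex.mul_conj]; simp
  have e2 : ((Complex.normSq (w - (starRingEnd ℂ) z) : ℝ) : ℂ) =
      (w - (starRingEnd ℂ) z) * ((starRingEnd ℂ) w - z) := by
    rw [← Complex.mul_conj]; simp
  have e3 : ((‖z‖ : ℝ) : ℂ) ^ 2 = z * (starRingEnd ℂ) z := by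
    rw [Complex.mul_conj, Complex.normSq_eq_norm_sq]; push_cast; ring
  rw [halfDiscCauchyKer, arcKer]
  push_cast
  rw [e1, e2, e3, ← hwn]
  have h5 : (z * w - w * (starRingEnd ℂ) w) = -(w * ((starRingEnd ℂ) w - z)) := by ring
  have h6 : ((starRingEnd ℂ) z * w - w * (starRingEnd ℂ) w) =
    -(w * ((starRingEnd ℂ) w - (starRingEnd ℂ) z)) := by ring
  rw [h5, h6]
  field_simp
  ring

lemma continuous_segKer (hR : 0 < R) (hz : z.im ≠ 0) : Continuous (segKer R z) := by
  unfold segKer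
  refine continuous_const.mul (Continuous.sub ?_ ?_)
  · exact continuous_const.div (Complex.continuous_normSq.comp (by fun_prop))
      fun t => (Complex.normSq_pos.2 (ofReal_sub_ne_zero hz t)).ne'
  · exact continuous_const.div (Complex.continuous_normSq.comp (by fun_prop))
      fun t => (Complex.normSq_pos.2 (ofReal_sq_sub_mul_ne_zero hR hz t)).ne'

lemma continuous_arcKer (hzR : ‖z‖ < R) : Continuous (arcKer R z) := by
  unfold arcKer
  refine continuous_const.mul (Continuous.sub ?_ ?_)
  · exact continuous_const.div (Complex.continuous_normSq.comp (by fun_prop))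
      fun t => (Complex.normSq_pos.2 (halfDisc_sub_ne_zero hzR t)).ne'
  · exact continuous_const.div (Complex.continuous_normSq.comp (by fun_prop))
      fun t => (Complex.normSq_pos.2 (halfDisc_sub_ne_zero (by simpa using hzR) t)).ne'

/-- Poisson's formula in the upper half-disc for the real part of a holomorphic function. -/
lemma halfDiscPoisson_re (hz : 0 < z.im) (hzR : ‖z‖ < R) {G : ℂ → ℂ}
    (hG : DifferentiableOn ℂ G (closedHalfDisc R)) :
    halfDiscPoisson R z (fun w => (G w).re) = (G z).re := by
  have hR : 0 < R := (norm_nonneg z).trans_lt hzR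
  have hpi := Real.pi_pos
  have hle : -R ≤ R := by linarith
  have m1 : ∀ t ∈ Set.Icc (-R) R, ((t : ℝ) : ℂ) ∈ closedHalfDisc R := fun t ht =>
    ofReal_mem_closedHalfDisc (abs_le.2 ht)
  have m2 : ∀ θ ∈ Set.Icc 0 Real.pi, circleMap 0 R θ ∈ closedHalfDisc R := fun θ hθ =>
    circleMap_mem_closedHalfDisc hR.le le_rfl hθ
  have hz0 : z ≠ 0 := fun h => by simp [h] at hz
  -- The three terms have their poles at the image points `z̄`, `R²/z`, `R²/z̄`, all outside the
  -- closed half-disc. Subtracting `G k` therefore does not change the Cauchy integral, while it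
  -- makes the kernel real along the boundary, so that real parts can be taken.
  set k : ℂ → ℂ := fun w => (w - (starRingEnd ℂ) z)⁻¹ - z * (z * w - R ^ 2)⁻¹ +
    (starRingEnd ℂ) z * ((starRingEnd ℂ) z * w - R ^ 2)⁻¹ with hk
  have hk1 : ∀ w ∈ closedHalfDisc R, w - (starRingEnd ℂ) z ≠ 0 := by
    intro w hw h
    have := congrArg Complex.im h
    simp at this
    have := hw.1
    linarith
  have hnorm : ∀ c : ℂ, ‖c‖ = ‖z‖ → ∀ w ∈ closedHalfDisc R, c * w - (R : ℂ) ^ 2 ≠ 0 := by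
    intro c hc w hw h
    have h1 : ‖c * w‖ = R ^ 2 := by
      rw [sub_eq_zero.1 h, norm_pow, Complex.norm_real, Real.norm_of_nonneg hR.le]
    rw [norm_mul, hc] at h1
    have h2 : ‖z‖ * ‖w‖ ≤ ‖z‖ * R := mul_le_mul_of_nonneg_left hw.2 (norm_nonneg z)
    nlinarith
  have hkd : DifferentiableOn ℂ k (closedHalfDisc R) := by
    intro w hw
    refine DifferentiableAt.differentiableWithinAt ?_
    have hq : ∀ c : ℂ, ‖c‖ = ‖z‖ → DifferentiableAt ℂ (fun w => c * (c * w - (R : ℂ) ^ 2)⁻¹) w := by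
      intro c hc
      have h1 : DifferentiableAt ℂ (fun w => c * w - (R : ℂ) ^ 2) w := by fun_prop
      exact (h1.fun_inv (hnorm c hc w hw)).const_mul c
    have h0 : DifferentiableAt ℂ (fun w => w - (starRingEnd ℂ) z) w := by fun_prop
    exact ((h0.fun_inv (hk1 w hw)).fun_sub (hq z rfl)).fun_add (hq ((starRingEnd ℂ) z) (by simp))
  -- The pole at `z` is removed by writing `G(w)/(w - z)` as the difference quotient plus `G(z)/(w -
  -- z)`: the first part falls under `halfDisc_cauchy`, the second under `halfDisc_integral_inv`.
  have hds : DifferentiableOn ℂ (dslope G z) (closedHalfDisc R) :=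
    (Complex.differentiableOn_dslope (halfDisc_mem_nhds hz hzR)).2 hG
  have hC := halfDisc_cauchy hR (g := fun w => dslope G z w - G w * k w) (hds.sub (hG.mul hkd))
  have hI := halfDisc_integral_inv hz hzR
  have hsplit : ∀ w, w ≠ z → G w * halfDiscCauchyKer R z w =
      (dslope G z w - G w * k w) + G z * (w - z)⁻¹ := by
    intro w hw
    rw [dslope_of_ne _ hw, slope_def_field, halfDiscCauchyKer]
    field_simp [sub_ne_zero.2 hw]
    ring
  have cC : ContinuousOn (fun w => dslope G z w - G w * k w) (closedHalfDisc R) :=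
    (hds.sub (hG.mul hkd)).continuousOn
  have i1 : IntervalIntegrable (fun t : ℝ => dslope G z t - G t * k t) volume (-R) R := by
    refine ContinuousOn.intervalIntegrable ?_
    rw [Set.uIcc_of_le hle]
    exact cC.comp Complex.continuous_ofReal.continuousOn m1
  have i2 : IntervalIntegrable (fun θ : ℝ => (dslope G z (circleMap 0 R θ) - G (circleMap 0 R θ) *
      k (circleMap 0 R θ)) * (circleMap 0 R θ * Complex.I)) volume 0 Real.pi := by
    refine ContinuousOn.intervalIntegrable ?_
    rw [Set.uIcc_of_le hpi.le]
    exact (cC.comp (by fun_prop) m2).mul (by fun_prop)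
  have j1 : IntervalIntegrable (fun t : ℝ => G z * ((t : ℂ) - z)⁻¹) volume (-R) R :=
    (continuous_const.mul ((Complex.continuous_ofReal.sub continuous_const).inv₀
    (ofReal_sub_ne_zero hz.ne'))).intervalIntegrable _ _
  have j2 : IntervalIntegrable (fun θ : ℝ => G z * ((circleMap 0 R θ - z)⁻¹ *
      (circleMap 0 R θ * Complex.I))) volume 0 Real.pi := by
    refine Continuous.intervalIntegrable ?_ _ _
    exact continuous_const.mul ((((continuous_circleMap 0 R).sub continuous_const).inv₀
      (halfDisc_sub_ne_zero hzR)).mul (by fun_prop))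
  have e1 : ∫ t in (-R)..R, G t * (2 * Real.pi * Complex.I * (segKer R z t : ℝ)) =
      (∫ t in (-R)..R, (dslope G z t - G t * k t)) + G z * ∫ t in (-R)..R, ((t : ℂ) - z)⁻¹ := by
    rw [← intervalIntegral.integral_const_mul, ← intervalIntegral.integral_add i1 j1]
    refine intervalIntegral.integral_congr fun t _ => ?_
    rw [← halfDiscCauchyKer_ofReal hR hz.ne', hsplit _ (sub_ne_zero.1 (ofReal_sub_ne_zero hz.ne' t))]
  have e2 : ∫ θ in (0 : ℝ)..Real.pi, G (circleMap 0 R θ) *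
        (2 * Real.pi * Complex.I * (arcKer R z θ : ℝ)) =
      (∫ θ in (0 : ℝ)..Real.pi, (dslope G z (circleMap 0 R θ) - G (circleMap 0 R θ) *
      k (circleMap 0 R θ)) * (circleMap 0 R θ * Complex.I)) + G z * ∫ θ in (0 : ℝ)..Real.pi,
        (circleMap 0 R θ - z)⁻¹ * (circleMap 0 R θ * Complex.I) := by
    rw [← intervalIntegral.integral_const_mul, ← intervalIntegral.integral_add i2 j2]
    refine intervalIntegral.integral_congr fun θ _ => ?_
    rw [← halfDiscCauchyKer_circleMap hzR, ← mul_assoc, hsplit _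
      (sub_ne_zero.1 (halfDisc_sub_ne_zero hzR θ))]
    ring
  have hsum : (∫ t in (-R)..R, G t * (segKer R z t : ℝ)) +
      ∫ θ in (0 : ℝ)..Real.pi, G (circleMap 0 R θ) * (arcKer R z θ : ℝ) = G z := by
    have h2pi : (2 * Real.pi * Complex.I : ℂ) ≠ 0 := by
      simp [Real.pi_ne_zero]
    apply mul_left_cancel₀ h2pi
    rw [mul_add, ← intervalIntegral.integral_const_mul, ← intervalIntegral.integral_const_mul]
    have r1 : ∫ t in (-R)..R, 2 * Real.pi * Complex.I * (G t * (segKer R z t : ℝ)) =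
      ∫ t in (-R)..R, G t * (2 * Real.pi * Complex.I * (segKer R z t : ℝ)) :=
      intervalIntegral.integral_congr fun t _ => by ring
    have r2 : ∫ θ in (0 : ℝ)..Real.pi, 2 * Real.pi * Complex.I *
        (G (circleMap 0 R θ) * (arcKer R z θ : ℝ)) = ∫ θ in (0 : ℝ)..Real.pi, G (circleMap 0 R θ) *
        (2 * Real.pi * Complex.I * (arcKer R z θ : ℝ)) :=
      intervalIntegral.integral_congr fun t _ => by ring
    rw [r1, r2, e1, e2]
    linear_combination hC + G z * hI
  have c1 : IntervalIntegrable (fun t : ℝ => G t * (segKer R z t : ℝ)) volume (-R) R := by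
    refine ContinuousOn.intervalIntegrable ?_
    rw [Set.uIcc_of_le hle]
    exact (hG.continuousOn.comp Complex.continuous_ofReal.continuousOn m1).mul
      (Complex.continuous_ofReal.comp (continuous_segKer hR hz.ne')).continuousOn
  have c2 : IntervalIntegrable (fun θ : ℝ => G (circleMap 0 R θ) * (arcKer R z θ : ℝ))
      volume 0 Real.pi := by
    refine ContinuousOn.intervalIntegrable ?_
    rw [Set.uIcc_of_le hpi.le]
    exact (hG.continuousOn.comp (by fun_prop) m2).mul
      (Complex.continuous_ofReal.comp (continuous_arcKer hzR)).continuousOn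
  rw [halfDiscPoisson, ← hsum, Complex.add_re]
  congr 1
  · rw [intervalIntegral.integral_of_le hle, intervalIntegral.integral_of_le hle,
      ← RCLike.re_to_complex, ← integral_re
      ((intervalIntegrable_iff_integrableOn_Ioc_of_le hle).1 c1)]
    simp
  · rw [intervalIntegral.integral_of_le hpi.le, intervalIntegral.integral_of_le hpi.le,
      ← RCLike.re_to_complex, ← integral_re
      ((intervalIntegrable_iff_integrableOn_Ioc_of_le hpi.le).1 c2)]
    simp
end

/-! ### Poisson integrals of `log ‖w - a‖`, and Green's function. -/

noncomputable section

variable {R : ℝ} {z : ℂ}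

lemma halfDiscPoisson_congr {u v : ℂ → ℝ} (hR : 0 ≤ R)
    (h1 : ∀ t ∈ Set.Icc (-R) R, u ((t : ℝ) : ℂ) = v t)
    (h2 : ∀ θ ∈ Set.Icc 0 Real.pi, u (circleMap 0 R θ) = v (circleMap 0 R θ)) :
    halfDiscPoisson R z u = halfDiscPoisson R z v := by
  rw [halfDiscPoisson, halfDiscPoisson]
  congr 1
  · refine intervalIntegral.integral_congr fun t ht => ?_
    rw [Set.uIcc_of_le (by linarith)] at ht
    simp only [h1 t ht]
  · refine intervalIntegral.integral_congr fun t ht => ?_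
    rw [Set.uIcc_of_le Real.pi_pos.le] at ht
    simp only [h2 t ht]

lemma segment_intervalIntegrable_log_norm {g : ℂ → ℂ} (hg : AnalyticOnNhd ℂ g {z : ℂ | 0 ≤ z.im})
    (a b : ℝ) : IntervalIntegrable (fun t : ℝ => Real.log ‖g t‖) volume a b := by
  refine MeromorphicOn.intervalIntegrable_log_norm (f := fun t : ℝ => g t) ?_
  intro t _
  have h1 : AnalyticAt ℂ g (t : ℂ) := hg _ (by simp)
  have h2 : AnalyticAt ℝ (fun t : ℝ => (t : ℂ)) t := Complex.ofRealCLM.analyticAt t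
  exact (h1.restrictScalars.comp h2).meromorphicAt

lemma analyticOnNhd_sub_const (a : ℂ) : AnalyticOnNhd ℂ (fun z => z - a) {z : ℂ | 0 ≤ z.im} :=
  fun z _ => by fun_prop

lemma abs_log_le_of_le {x y M : ℝ} (hx : 0 < x) (hxy : x ≤ y) (hyM : y ≤ M) :
    |Real.log y| ≤ |Real.log x| + |Real.log M| := by
  have h1 := Real.log_le_log hx hxy
  have h2 := Real.log_le_log (hx.trans_le hxy) hyM
  rw [abs_le]
  constructor
  · linarith [neg_abs_le (Real.log x), abs_nonneg (Real.log M)]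
  · linarith [le_abs_self (Real.log M), abs_nonneg (Real.log x)]

/-- If each `b n` is farther than `a` from all points of the path, the logarithms are dominated by
`|log ‖γ - a‖| + |log M|`, so a logarithmic singularity on the path survives the limit. -/
lemma tendsto_integral_log_norm_sub {γ : ℝ → ℂ} {k : ℝ → ℝ} (hγ : Continuous γ) (hk : Continuous k)
    {α β M : ℝ} (hαβ : α ≤ β) {a : ℂ} {b : ℕ → ℂ} (hb : Tendsto b atTop (𝓝 a))
    (hle : ∀ x ∈ Set.Ioc α β, ∀ n, ‖γ x - a‖ ≤ ‖γ x - b n‖ ∧ ‖γ x - b n‖ ≤ M)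
    (hne : ∀ᵐ x : ℝ, γ x ≠ a)
    (hint : IntervalIntegrable (fun x => Real.log ‖γ x - a‖) volume α β) :
    Tendsto (fun n => ∫ x in α..β, Real.log ‖γ x - b n‖ * k x) atTop
      (𝓝 (∫ x in α..β, Real.log ‖γ x - a‖ * k x)) := by
  have hIoc : Set.uIoc α β = Set.Ioc α β := Set.uIoc_of_le hαβ
  refine intervalIntegral.tendsto_integral_filter_of_dominated_convergence
    (fun x => (|Real.log ‖γ x - a‖| + |Real.log M|) * |k x|) ?_ ?_ ?_ ?_
  · refine Eventually.of_forall fun n => ?_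
    have : Measurable fun x => Real.log ‖γ x - b n‖ * k x :=
      (Real.measurable_log.comp ((hγ.sub continuous_const).norm.measurable)).mul hk.measurable
    exact this.aestronglyMeasurable
  · refine Eventually.of_forall fun n => ?_
    filter_upwards [hne] with x hx hxI
    rw [hIoc] at hxI
    rw [norm_mul, Real.norm_eq_abs, Real.norm_eq_abs]
    refine mul_le_mul_of_nonneg_right ?_ (abs_nonneg _)
    exact abs_log_le_of_le (norm_pos_iff.2 (sub_ne_zero.2 hx)) (hle x hxI n).1 (hle x hxI n).2
  · exact (hint.abs.add (by simp)).mul_continuousOn hk.abs.continuousOn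
  · filter_upwards [hne] with x hx _
    refine Tendsto.mul_const _ ?_
    have h1 : Tendsto (fun n => ‖γ x - b n‖) atTop (𝓝 ‖γ x - a‖) :=
      (tendsto_const_nhds.sub hb).norm
    exact (Real.continuousAt_log (norm_ne_zero_iff.2 (sub_ne_zero.2 hx))).tendsto.comp h1

lemma ae_ofReal_ne (a : ℂ) : ∀ᵐ t : ℝ, (t : ℂ) ≠ a := by
  have : ((fun t : ℝ => (t : ℂ)) ⁻¹' {a}).Finite :=
    (Set.finite_singleton a).preimage Complex.ofReal_injective.injOn
  exact compl_mem_ae_iff.2 (this.measure_zero volume)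

lemma ae_circleMap_ne (hR : R ≠ 0) (a : ℂ) : ∀ᵐ θ : ℝ, circleMap 0 R θ ≠ a := by
  have : ((fun θ : ℝ => circleMap 0 R θ) ⁻¹' {a}).Countable :=
    (Set.countable_singleton a).preimage_circleMap 0 hR
  exact compl_mem_ae_iff.2 (this.measure_zero volume)

/-- On a convex neighbourhood of the half-disc that avoids `a`, `log ‖w - a‖` is the real part of a
holomorphic logarithm. -/
lemma halfDiscPoisson_log_norm_sub_of_notMem (hz : 0 < z.im) (hzR : ‖z‖ < R) {a : ℂ}
    (ha : a ∉ closedHalfDisc R) :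
    halfDiscPoisson R z (fun w => Real.log ‖w - a‖) = Real.log ‖z - a‖ := by
  have hR : 0 < R := (norm_nonneg z).trans_lt hzR
  obtain ⟨δ, hδ, hsub⟩ := (isCompact_closedHalfDisc R).exists_thickening_subset_open
    (isOpen_compl_singleton (x := a)) (fun w hw h => ha (by rw [← Set.mem_singleton_iff.1 h]; exact hw))
  obtain ⟨G, hG1, hG2⟩ := ((convex_closedHalfDisc R).thickening δ).exists_exp_eq
    Metric.isOpen_thickening (g := fun w => w - a) (by fun_prop)
    (fun w hw => sub_ne_zero.2 fun h => hsub hw (by simp [h]))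
  have hself := Metric.self_subset_thickening hδ (closedHalfDisc R)
  have hre : ∀ w ∈ closedHalfDisc R, Real.log ‖w - a‖ = (G w).re := by
    intro w hw
    have := hG2 w (hself hw)
    rw [this, Complex.norm_exp, Real.log_exp]
  rw [halfDiscPoisson_congr (v := fun w => (G w).re) hR.le, halfDiscPoisson_re hz hzR (hG1.mono hself),
    hre z ⟨hz.le, hzR.le⟩]
  · exact fun t ht => hre _ (ofReal_mem_closedHalfDisc (abs_le.2 ht))
  · exact fun θ hθ => hre _ (circleMap_mem_closedHalfDisc hR.le le_rfl hθ)

/-- Poisson's formula for `log ‖· - a‖` when `a` can be approached from outside the half-disc. -/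
lemma halfDiscPoisson_log_norm_sub_of_tendsto (hz : 0 < z.im) (hzR : ‖z‖ < R) {a : ℂ} (hza : z ≠ a)
    {b : ℕ → ℂ} (hb : Tendsto b atTop (𝓝 a)) (hbR : ∀ n, b n ∉ closedHalfDisc R) {M : ℝ}
    (hle : ∀ w ∈ closedHalfDisc R, ∀ n, ‖w - a‖ ≤ ‖w - b n‖ ∧ ‖w - b n‖ ≤ M) :
    halfDiscPoisson R z (fun w => Real.log ‖w - a‖) = Real.log ‖z - a‖ := by
  have hR : 0 < R := (norm_nonneg z).trans_lt hzR
  have h1 := tendsto_integral_log_norm_sub (γ := fun t : ℝ => (t : ℂ)) Complex.continuous_ofReal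
    (continuous_segKer hR hz.ne') (α := -R) (β := R) (by linarith) hb
    (fun t ht n => hle _ (ofReal_mem_closedHalfDisc (abs_le.2 (Set.Ioc_subset_Icc_self ht))) n)
    (ae_ofReal_ne a) (segment_intervalIntegrable_log_norm (analyticOnNhd_sub_const a) _ _)
  have h2 := tendsto_integral_log_norm_sub (γ := circleMap 0 R) (continuous_circleMap 0 R)
    (continuous_arcKer hzR) (α := 0) (β := Real.pi) Real.pi_pos.le hb
    (fun t ht n => hle _ (circleMap_mem_closedHalfDisc hR.le le_rfl (Set.Ioc_subset_Icc_self ht)) n)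
    (ae_circleMap_ne hR.ne' a)
    (halfCircle_intervalIntegrable_log_norm hR (analyticOnNhd_sub_const a))
  have h3 := h1.add h2
  have h4 : Tendsto (fun n => Real.log ‖z - b n‖) atTop (𝓝 (Real.log ‖z - a‖)) :=
    (Real.continuousAt_log (norm_ne_zero_iff.2 (sub_ne_zero.2 hza))).tendsto.comp
      ((tendsto_const_nhds.sub hb).norm)
  refine tendsto_nhds_unique (h3.congr fun n => ?_) h4
  exact halfDiscPoisson_log_norm_sub_of_notMem hz hzR (hbR n)

/-- The points `a - i/(n + 1)` lie below the diameter and are farther than `a` from every point of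
the closed half-disc. -/
lemma halfDiscPoisson_log_norm_sub_of_real (hz : 0 < z.im) (hzR : ‖z‖ < R) {a : ℂ} (ha : a.im = 0)
    (haR : ‖a‖ ≤ R) : halfDiscPoisson R z (fun w => Real.log ‖w - a‖) = Real.log ‖z - a‖ := by
  have hlim : Tendsto (fun n : ℕ => (1 / ((n : ℝ) + 1))) atTop (𝓝 0) :=
    tendsto_one_div_add_atTop_nhds_zero_nat
  have hpos : ∀ n : ℕ, 0 < 1 / ((n : ℝ) + 1) := fun n => Nat.one_div_pos_of_nat
  have hle1 : ∀ n : ℕ, 1 / ((n : ℝ) + 1) ≤ 1 := fun n => by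
    rw [div_le_one (by positivity)]; linarith [n.cast_nonneg (α := ℝ)]
  refine halfDiscPoisson_log_norm_sub_of_tendsto hz hzR (fun h => by rw [h] at hz; linarith)
    (b := fun n => a - ((1 / ((n : ℝ) + 1) : ℝ) : ℂ) * Complex.I) (M := R + R + 1) ?_ ?_ ?_
  · have := (Complex.continuous_ofReal.tendsto 0).comp hlim
    have h2 := tendsto_const_nhds (x := a) |>.sub (this.mul_const Complex.I)
    simpa using h2
  · intro n hn
    have := hn.1
    simp only [Complex.sub_im, Complex.im_ofReal_mul, Complex.I_im, ha] at this
    linarith [hpos n]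
  · intro w hw n
    constructor
    · rw [Complex.norm_def, Complex.norm_def]
      refine Real.sqrt_le_sqrt ?_
      rw [Complex.normSq_apply, Complex.normSq_apply]
      simp only [Complex.sub_im, Complex.im_ofReal_mul, Complex.I_im, ha, Complex.sub_re,
        Complex.re_ofReal_mul, Complex.I_re]
      have := hw.1
      nlinarith [hpos n]
    · rw [show w - (a - ((1 / ((n : ℝ) + 1) : ℝ) : ℂ) * Complex.I) =
        w - a + ((1 / ((n : ℝ) + 1) : ℝ) : ℂ) * Complex.I by ring]
      refine (norm_add_le _ _).trans ?_
      rw [norm_mul, Complex.norm_I, Complex.norm_real, Real.norm_of_nonneg (hpos n).le, mul_one]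
      linarith [norm_sub_le w a, hw.2, hle1 n]

/-- Here `a` is pushed out radially. The distance to a point `w` of the half-disc increases because
`Re (w ā) ≤ R² = ‖a‖²`. -/
lemma halfDiscPoisson_log_norm_sub_of_norm_eq (hz : 0 < z.im) (hzR : ‖z‖ < R) {a : ℂ}
    (haR : ‖a‖ = R) : halfDiscPoisson R z (fun w => Real.log ‖w - a‖) = Real.log ‖z - a‖ := by
  have hR : 0 < R := (norm_nonneg z).trans_lt hzR
  have hlim : Tendsto (fun n : ℕ => (1 / ((n : ℝ) + 1))) atTop (𝓝 0) :=
    tendsto_one_div_add_atTop_nhds_zero_nat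
  have hpos : ∀ n : ℕ, 0 < 1 / ((n : ℝ) + 1) := fun n => Nat.one_div_pos_of_nat
  have hle1 : ∀ n : ℕ, 1 / ((n : ℝ) + 1) ≤ 1 := fun n => by
    rw [div_le_one (by positivity)]; linarith [n.cast_nonneg (α := ℝ)]
  refine halfDiscPoisson_log_norm_sub_of_tendsto hz hzR (fun h => by rw [h] at hzR; linarith)
    (b := fun n => a + ((1 / ((n : ℝ) + 1) : ℝ) : ℂ) * a) (M := R + R + R) ?_ ?_ ?_
  · have := (Complex.continuous_ofReal.tendsto 0).comp hlim
    have h2 := tendsto_const_nhds (x := a) |>.add (this.mul_const a)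
    simpa using h2
  · intro n hn
    have h1 := hn.2
    rw [show a + ((1 / ((n : ℝ) + 1) : ℝ) : ℂ) * a = ((1 + 1 / ((n : ℝ) + 1) : ℝ) : ℂ) * a by
      push_cast; ring, norm_mul, Complex.norm_real, Real.norm_of_nonneg (by linarith [hpos n]),
      haR] at h1
    nlinarith [hpos n]
  · intro w hw n
    constructor
    · have hns : w.re * a.re + w.im * a.im ≤ R ^ 2 := by
        have h1 : w.re * a.re + w.im * a.im = (w * (starRingEnd ℂ) a).re := by simp
        rw [h1]
        refine (Complex.re_le_norm _).trans ?_
        rw [norm_mul, Complex.norm_conj, haR, sq]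
        exact mul_le_mul_of_nonneg_right hw.2 hR.le
      have hns2 : a.re * a.re + a.im * a.im = R ^ 2 := by
        rw [← haR, ← Complex.normSq_eq_norm_sq, Complex.normSq_apply]
      rw [Complex.norm_def, Complex.norm_def]
      refine Real.sqrt_le_sqrt ?_
      rw [Complex.normSq_apply, Complex.normSq_apply]
      simp only [Complex.sub_im, Complex.im_ofReal_mul, Complex.sub_re,
        Complex.re_ofReal_mul, Complex.add_re, Complex.add_im]
      set ε := 1 / ((n : ℝ) + 1) with hε
      have hε0 : 0 < ε := hpos n
      nlinarith [mul_nonneg hε0.le (sub_nonneg.2 hns), sq_nonneg (ε * a.re), sq_nonneg (ε * a.im)]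
    · rw [show w - (a + ((1 / ((n : ℝ) + 1) : ℝ) : ℂ) * a) =
        w - a - ((1 / ((n : ℝ) + 1) : ℝ) : ℂ) * a by ring]
      refine (norm_sub_le _ _).trans ?_
      rw [norm_mul, Complex.norm_real, Real.norm_of_nonneg (hpos n).le, haR]
      have := mul_le_mul_of_nonneg_right (hle1 n) hR.le
      linarith [norm_sub_le w a, hw.2]

/-- Green's function of the upper half-disc of radius `R`. -/
def halfDiscGreen (R : ℝ) (z a : ℂ) : ℝ :=
  Real.log ‖z - (starRingEnd ℂ) a‖ + Real.log ‖z - R ^ 2 / (starRingEnd ℂ) a‖ -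
    Real.log ‖z - R ^ 2 / a‖ - Real.log ‖z - a‖

lemma sq_div_conj_eq_of_norm_eq {a : ℂ} (ha : a ≠ 0) (h : ‖a‖ = R) :
    (R : ℂ) ^ 2 / (starRingEnd ℂ) a = a := by
  rw [div_eq_iff ((map_ne_zero _).2 ha), Complex.mul_conj, Complex.normSq_eq_norm_sq, h]
  push_cast; ring

lemma halfDiscPoisson_add_sub {u v w : ℂ → ℝ} (hR : 0 < R) (hz : 0 < z.im) (hzR : ‖z‖ < R)
    (hu : IntervalIntegrable (fun t : ℝ => u t) volume (-R) R)
    (hv : IntervalIntegrable (fun t : ℝ => v t) volume (-R) R)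
    (hw : IntervalIntegrable (fun t : ℝ => w t) volume (-R) R)
    (hu' : IntervalIntegrable (fun θ : ℝ => u (circleMap 0 R θ)) volume 0 Real.pi)
    (hv' : IntervalIntegrable (fun θ : ℝ => v (circleMap 0 R θ)) volume 0 Real.pi)
    (hw' : IntervalIntegrable (fun θ : ℝ => w (circleMap 0 R θ)) volume 0 Real.pi) :
    halfDiscPoisson R z (fun x => u x + v x - w x) =
      halfDiscPoisson R z u + halfDiscPoisson R z v - halfDiscPoisson R z w := by
  have h1 := (continuous_segKer hR hz.ne').continuousOn (s := Set.uIcc (-R) R)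
  have h2 := (continuous_arcKer hzR).continuousOn (s := Set.uIcc 0 Real.pi)
  have e1 : ∫ t in (-R)..R, (u t + v t - w t) * segKer R z t =
      (∫ t in (-R)..R, u t * segKer R z t) + (∫ t in (-R)..R, v t * segKer R z t) -
        ∫ t in (-R)..R, w t * segKer R z t := by
    rw [← intervalIntegral.integral_add (hu.mul_continuousOn h1) (hv.mul_continuousOn h1),
      ← intervalIntegral.integral_sub ((hu.mul_continuousOn h1).add (hv.mul_continuousOn h1))
        (hw.mul_continuousOn h1)]
    exact intervalIntegral.integral_congr fun t _ => by ring
  have e2 : ∫ θ in (0 : ℝ)..Real.pi, (u (circleMap 0 R θ) + v (circleMap 0 R θ) -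
        w (circleMap 0 R θ)) * arcKer R z θ =
      (∫ θ in (0 : ℝ)..Real.pi, u (circleMap 0 R θ) * arcKer R z θ) +
      (∫ θ in (0 : ℝ)..Real.pi, v (circleMap 0 R θ) * arcKer R z θ) -
        ∫ θ in (0 : ℝ)..Real.pi, w (circleMap 0 R θ) * arcKer R z θ := by
    rw [← intervalIntegral.integral_add (hu'.mul_continuousOn h2) (hv'.mul_continuousOn h2),
      ← intervalIntegral.integral_sub ((hu'.mul_continuousOn h2).add (hv'.mul_continuousOn h2))
        (hw'.mul_continuousOn h2)]
    exact intervalIntegral.integral_congr fun t _ => by ring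
  simp only [halfDiscPoisson]
  rw [e1, e2]
  ring

lemma norm_sub_sq_div {w c : ℂ} (hw : ‖w‖ = R) (hc : c ≠ 0) :
    ‖w - R ^ 2 / c‖ = R / ‖c‖ * ‖w - (starRingEnd ℂ) c‖ := by
  have hwc : (R : ℂ) ^ 2 = w * (starRingEnd ℂ) w := by
    rw [Complex.mul_conj, Complex.normSq_eq_norm_sq, hw]; push_cast; ring
  have h : w - R ^ 2 / c = (w / c) * (starRingEnd ℂ) ((starRingEnd ℂ) c - w) := by
    rw [hwc, map_sub, Complex.conj_conj]; field_simp
  rw [h, norm_mul, norm_div, hw, Complex.norm_conj, norm_sub_rev]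

/-- On the arc `‖w - R²/c‖ = (R/‖c‖) ‖w - c̄‖`; taking `c = ā` and `c = a`, the two scale factors
cancel. -/
lemma log_norm_sub_of_norm_eq {w a : ℂ} (hR : 0 < R) (hw : ‖w‖ = R) (ha : ‖a‖ < R) (ha0 : a ≠ 0) :
    Real.log ‖w - a‖ = Real.log ‖w - (starRingEnd ℂ) a‖ +
        Real.log ‖w - R ^ 2 / (starRingEnd ℂ) a‖ - Real.log ‖w - R ^ 2 / a‖ := by
  have hca0 : (starRingEnd ℂ) a ≠ 0 := (map_ne_zero _).2 ha0
  have k1 := norm_sub_sq_div hw hca0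
  have k2 := norm_sub_sq_div hw ha0
  rw [Complex.conj_conj, Complex.norm_conj] at k1
  have hq : R / ‖a‖ ≠ 0 := (div_pos hR (norm_pos_iff.2 ha0)).ne'
  have hne : ∀ c : ℂ, ‖c‖ = ‖a‖ → ‖w - c‖ ≠ 0 := by
    intro c hc h
    rw [norm_eq_zero, sub_eq_zero] at h
    rw [← h, hw] at hc
    linarith
  rw [k1, k2, Real.log_mul hq (hne a rfl), Real.log_mul hq (hne _ (by simp))]
  ring

lemma log_norm_sub_of_real {a : ℂ} (t : ℝ) :
    Real.log ‖(t : ℂ) - a‖ = Real.log ‖(t : ℂ) - (starRingEnd ℂ) a‖ +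
        Real.log ‖(t : ℂ) - R ^ 2 / (starRingEnd ℂ) a‖ -
        Real.log ‖(t : ℂ) - R ^ 2 / a‖ := by
  have c1 : ‖(t : ℂ) - (starRingEnd ℂ) a‖ = ‖(t : ℂ) - a‖ := by
    rw [← Complex.norm_conj]; simp
  have c2 : ‖(t : ℂ) - R ^ 2 / (starRingEnd ℂ) a‖ = ‖(t : ℂ) - R ^ 2 / a‖ := by
    rw [← Complex.norm_conj]; simp
  rw [c1, c2]; ring

/-- The method of images: on the boundary `log ‖w - a‖` agrees with a combination of logarithms
centred at `ā`, `R²/ā`, `R²/a`. These points are outside the half-disc, so the Poisson integral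
reproduces the combination at `z`, and its excess over `log ‖z - a‖` is Green's function. -/
lemma halfDiscPoisson_log_norm_sub_of_interior (hz : 0 < z.im) (hzR : ‖z‖ < R) {a : ℂ}
    (him : 0 < a.im) (hn : ‖a‖ < R) :
    halfDiscPoisson R z (fun w => Real.log ‖w - a‖) = Real.log ‖z - a‖ + halfDiscGreen R z a := by
  have hR : 0 < R := (norm_nonneg z).trans_lt hzR
  have ha0 : a ≠ 0 := fun h => by simp [h] at him
  have hnpos : 0 < ‖a‖ := norm_pos_iff.2 ha0
  have hbig : ∀ c : ℂ, ‖c‖ = ‖a‖ → (R : ℂ) ^ 2 / c ∉ closedHalfDisc R := by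
    intro c hc h
    have := h.2
    rw [norm_div, norm_pow, Complex.norm_real, Real.norm_of_nonneg hR.le, hc,
      div_le_iff₀ hnpos] at this
    nlinarith
  have o1 : (starRingEnd ℂ) a ∉ closedHalfDisc R := fun h => by
    have := h.1
    rw [Complex.conj_im] at this
    linarith
  have o2 := hbig ((starRingEnd ℂ) a) (by simp)
  have o3 := hbig a rfl
  have I1 : ∀ c : ℂ, IntervalIntegrable (fun t : ℝ => Real.log ‖(t : ℂ) - c‖) volume (-R) R :=
    fun c => segment_intervalIntegrable_log_norm (analyticOnNhd_sub_const c) _ _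
  have I2 : ∀ c : ℂ, IntervalIntegrable (fun θ => Real.log ‖circleMap 0 R θ - c‖) volume 0 Real.pi :=
    fun c => halfCircle_intervalIntegrable_log_norm hR (analyticOnNhd_sub_const c)
  have E := halfDiscPoisson_congr (z := z) (u := fun w => Real.log ‖w - a‖)
    (v := fun w => Real.log ‖w - (starRingEnd ℂ) a‖ +
        Real.log ‖w - R ^ 2 / (starRingEnd ℂ) a‖ - Real.log ‖w - R ^ 2 / a‖) hR.le
    (fun t _ => log_norm_sub_of_real t)
    (fun θ _ => log_norm_sub_of_norm_eq hR (by rw [norm_circleMap_zero, abs_of_pos hR]) hn ha0)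
  have F := halfDiscPoisson_add_sub (u := fun w => Real.log ‖w - (starRingEnd ℂ) a‖)
      (v := fun w => Real.log ‖w - R ^ 2 / (starRingEnd ℂ) a‖)
      (w := fun w => Real.log ‖w - R ^ 2 / a‖) hR hz hzR
      (I1 ((starRingEnd ℂ) a)) (I1 (R ^ 2 / (starRingEnd ℂ) a)) (I1 (R ^ 2 / a))
      (I2 ((starRingEnd ℂ) a)) (I2 (R ^ 2 / (starRingEnd ℂ) a)) (I2 (R ^ 2 / a))
  refine (E.trans F).trans ?_
  rw [halfDiscPoisson_log_norm_sub_of_notMem hz hzR o1,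
    halfDiscPoisson_log_norm_sub_of_notMem hz hzR o2,
    halfDiscPoisson_log_norm_sub_of_notMem hz hzR o3, halfDiscGreen]
  ring

/-- The Poisson integral of `log ‖· - a‖` for an arbitrary point `a ≠ 0` of the half-disc. -/
lemma halfDiscPoisson_log_norm_sub (hz : 0 < z.im) (hzR : ‖z‖ < R) {a : ℂ}
    (ha : a ∈ closedHalfDisc R) (ha0 : a ≠ 0) :
    halfDiscPoisson R z (fun w => Real.log ‖w - a‖) = Real.log ‖z - a‖ + halfDiscGreen R z a := by
  have hca0 : (starRingEnd ℂ) a ≠ 0 := (map_ne_zero _).2 ha0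
  rcases ha.1.eq_or_lt with him | him
  -- For `a` on the boundary, here and in the case `‖a‖ = R`, the four logarithms in Green's
  -- function cancel in pairs.
  · have hconj : (starRingEnd ℂ) a = a := Complex.conj_eq_iff_im.2 him.symm
    rw [halfDiscPoisson_log_norm_sub_of_real hz hzR him.symm ha.2, halfDiscGreen, hconj]
    ring
  rcases ha.2.eq_or_lt with hn | hn
  · have h1 := sq_div_conj_eq_of_norm_eq ha0 hn
    have h2 := sq_div_conj_eq_of_norm_eq hca0 (by simpa using hn)
    rw [Complex.conj_conj] at h2
    rw [halfDiscPoisson_log_norm_sub_of_norm_eq hz hzR hn, halfDiscGreen, h1, h2]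
    ring
  exact halfDiscPoisson_log_norm_sub_of_interior hz hzR him hn
end

/-! ### Bounds for Green's function and the Poisson-Jensen formula. -/

noncomputable section

variable {R : ℝ} {z : ℂ}

/-- Green's function of the upper half-plane. -/
def halfPlaneGreen (z a : ℂ) : ℝ := Real.log ‖z - (starRingEnd ℂ) a‖ - Real.log ‖z - a‖

lemma log_norm_eq_half_log_normSq (w : ℂ) : Real.log ‖w‖ = 1 / 2 * Real.log (Complex.normSq w) := by
  rw [Complex.normSq_eq_norm_sq, Real.log_pow]; push_cast; ring

lemma sub_conj_ne_zero {a : ℂ} (hz : 0 < z.im) (ha : 0 ≤ a.im) : z - (starRingEnd ℂ) a ≠ 0 := by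
  intro h
  have := congrArg Complex.im h
  simp at this
  linarith

lemma sq_sub_mul_ne_zero (hzR : ‖z‖ < R) {c : ℂ} (hc : ‖c‖ ≤ R) : (R : ℂ) ^ 2 - z * c ≠ 0 := by
  intro h
  have hR : 0 < R := (norm_nonneg z).trans_lt hzR
  have h1 : ‖z * c‖ = R ^ 2 := by
    rw [← sub_eq_zero.1 h, norm_pow, Complex.norm_real, Real.norm_of_nonneg hR.le]
  rw [norm_mul] at h1
  have h2 : ‖z‖ * ‖c‖ ≤ ‖z‖ * R := mul_le_mul_of_nonneg_left hc (norm_nonneg z)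
  nlinarith

lemma halfDiscGreen_eq_log_sub_log (hzR : ‖z‖ < R) {a : ℂ}
    (haR : ‖a‖ ≤ R) (ha0 : a ≠ 0) :
    halfDiscGreen R z a = halfPlaneGreen z a + (Real.log ‖(R : ℂ) ^ 2 - z * (starRingEnd ℂ) a‖ -
      Real.log ‖(R : ℂ) ^ 2 - z * a‖) := by
  have key : ∀ c : ℂ, c ≠ 0 → ‖c‖ ≤ R →
      Real.log ‖z - R ^ 2 / c‖ = Real.log ‖(R : ℂ) ^ 2 - z * c‖ - Real.log ‖c‖ := by
    intro c hc hcR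
    rw [← Real.log_div (norm_ne_zero_iff.2 (sq_sub_mul_ne_zero hzR hcR)) (norm_ne_zero_iff.2 hc),
      ← norm_div, ← norm_neg]
    congr 2
    field_simp
    ring
  rw [halfDiscGreen, halfPlaneGreen, key a ha0 haR, key _ ((map_ne_zero _).2 ha0) (by simpa using haR),
    Complex.norm_conj]
  ring

lemma normSq_sub_conj (z a : ℂ) :
    Complex.normSq (z - (starRingEnd ℂ) a) = Complex.normSq (z - a) + 4 * (z.im * a.im) := by
  simp only [Complex.normSq_apply, Complex.sub_re, Complex.sub_im, Complex.conj_re, Complex.conj_im]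
  ring

lemma normSq_sq_sub_mul_conj (R : ℝ) (z a : ℂ) :
    Complex.normSq ((R : ℂ) ^ 2 - z * a) =
      Complex.normSq ((R : ℂ) ^ 2 - z * (starRingEnd ℂ) a) + 4 * R ^ 2 * (z.im * a.im) := by
  simp only [Complex.normSq_apply, Complex.sub_re, Complex.sub_im, Complex.mul_re, Complex.mul_im,
    Complex.conj_re, Complex.conj_im, ← Complex.ofReal_pow, Complex.ofReal_re, Complex.ofReal_im]
  ring

lemma normSq_sq_sub_mul_conj' (R : ℝ) (z a : ℂ) :
    Complex.normSq ((R : ℂ) ^ 2 - z * (starRingEnd ℂ) a) =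
      R ^ 2 * Complex.normSq (z - a) + (R ^ 2 - Complex.normSq z) * (R ^ 2 - Complex.normSq a) := by
  simp only [Complex.normSq_apply, Complex.sub_re, Complex.sub_im, Complex.mul_re, Complex.mul_im,
    Complex.conj_re, Complex.conj_im, ← Complex.ofReal_pow, Complex.ofReal_re, Complex.ofReal_im]
  ring

/-- The correction to the half-plane Green's function is `log ‖R² - zā‖ - log ‖R² - za‖`, which is
at most zero because the squares of the two moduli differ by `4 R² Im z Im a`. -/
lemma halfDiscGreen_le (hz : 0 < z.im) (hzR : ‖z‖ < R) {a : ℂ} (ha : 0 ≤ a.im)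
    (haR : ‖a‖ ≤ R) (ha0 : a ≠ 0) : halfDiscGreen R z a ≤ halfPlaneGreen z a := by
  rw [halfDiscGreen_eq_log_sub_log hzR haR ha0]
  have h1 : Real.log ‖(R : ℂ) ^ 2 - z * (starRingEnd ℂ) a‖ ≤ Real.log ‖(R : ℂ) ^ 2 - z * a‖ := by
    refine Real.log_le_log (norm_pos_iff.2 (sq_sub_mul_ne_zero hzR (by simpa using haR))) ?_
    rw [Complex.norm_def, Complex.norm_def]
    refine Real.sqrt_le_sqrt ?_
    rw [normSq_sq_sub_mul_conj R z a]
    have : 0 ≤ 4 * R ^ 2 * (z.im * a.im) := by positivity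
    linarith
  linarith

lemma half_log_div_ge {x y : ℝ} (hx : 0 < x) (hy : 0 < y) :
    (x - y) / x ≤ Real.log x - Real.log y := by
  rw [← Real.log_div hx.ne' hy.ne']
  have := Real.one_sub_inv_le_log_of_pos (div_pos hx hy)
  rw [inv_div] at this
  rwa [sub_div, div_self hx.ne']

/-- Green's function is half of `log (x/y)` for two products of squared moduli. The bound is `log
(x/y) ≥ (x - y)/x`, and `x - y` is exactly `4 Im z Im a (R² - |z|²)(R² - |a|²)`. -/
lemma halfDiscGreen_ge (hz : 0 < z.im) (hzR : ‖z‖ < R) {a : ℂ} (ha : 0 ≤ a.im)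
    (haR : ‖a‖ ≤ R) (ha0 : a ≠ 0) (hza : z ≠ a) :
    2 * (z.im * a.im) * ((R ^ 2 - Complex.normSq z) * (R ^ 2 - Complex.normSq a)) /
      (Complex.normSq (z - (starRingEnd ℂ) a) * Complex.normSq ((R : ℂ) ^ 2 - z * (starRingEnd ℂ) a))
      ≤ halfDiscGreen R z a := by
  have p1 := Complex.normSq_pos.2 (sub_conj_ne_zero hz ha)
  have p2 := Complex.normSq_pos.2 (sq_sub_mul_ne_zero hzR (c := (starRingEnd ℂ) a) (by simpa using haR))
  have p3 := Complex.normSq_pos.2 (sub_ne_zero.2 hza)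
  have p4 := Complex.normSq_pos.2 (sq_sub_mul_ne_zero hzR haR)
  have h := half_log_div_ge (mul_pos p1 p2) (mul_pos p3 p4)
  rw [Real.log_mul p1.ne' p2.ne', Real.log_mul p3.ne' p4.ne'] at h
  rw [halfDiscGreen_eq_log_sub_log hzR haR ha0, halfPlaneGreen]
  simp only [log_norm_eq_half_log_normSq]
  have e : Complex.normSq (z - (starRingEnd ℂ) a) * Complex.normSq ((R : ℂ) ^ 2 - z * (starRingEnd ℂ) a)
      - Complex.normSq (z - a) * Complex.normSq ((R : ℂ) ^ 2 - z * a) =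
      4 * (z.im * a.im) * ((R ^ 2 - Complex.normSq z) * (R ^ 2 - Complex.normSq a)) := by
    rw [normSq_sq_sub_mul_conj R z a, normSq_sub_conj z a, normSq_sq_sub_mul_conj' R z a]
    ring
  rw [e] at h
  have e2 : 2 * (z.im * a.im) * ((R ^ 2 - Complex.normSq z) * (R ^ 2 - Complex.normSq a)) /
      (Complex.normSq (z - (starRingEnd ℂ) a) * Complex.normSq ((R : ℂ) ^ 2 - z * (starRingEnd ℂ) a)) =
      1 / 2 * (4 * (z.im * a.im) * ((R ^ 2 - Complex.normSq z) * (R ^ 2 - Complex.normSq a)) /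
      (Complex.normSq (z - (starRingEnd ℂ) a) * Complex.normSq ((R : ℂ) ^ 2 - z * (starRingEnd ℂ) a))) := by
    ring
  rw [e2]
  linarith

lemma halfDiscGreen_nonneg (hz : 0 < z.im) (hzR : ‖z‖ < R) {a : ℂ} (ha : 0 ≤ a.im)
    (haR : ‖a‖ ≤ R) (ha0 : a ≠ 0) (hza : z ≠ a) : 0 ≤ halfDiscGreen R z a := by
  refine le_trans ?_ (halfDiscGreen_ge hz hzR ha haR ha0 hza)
  have h1 : 0 ≤ R ^ 2 - Complex.normSq z := by
    rw [Complex.normSq_eq_norm_sq]; nlinarith [norm_nonneg z]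
  have h2 : 0 ≤ R ^ 2 - Complex.normSq a := by
    rw [Complex.normSq_eq_norm_sq]; nlinarith [norm_nonneg a]
  have := Complex.normSq_nonneg (z - (starRingEnd ℂ) a)
  have := Complex.normSq_nonneg ((R : ℂ) ^ 2 - z * (starRingEnd ℂ) a)
  positivity

/-- A lower bound for Green's function away from the arc, uniform in the radius. -/
lemma halfDiscGreen_ge_of_le_half (hz : 0 < z.im) (hzR : 2 * ‖z‖ ≤ R) {a : ℂ} (ha : 0 ≤ a.im)
    (haR : 2 * ‖a‖ ≤ R) (ha0 : a ≠ 0) (hza : z ≠ a) :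
    z.im * a.im / (2 * (‖z‖ + ‖a‖) ^ 2) ≤ halfDiscGreen R z a := by
  have hz0 : 0 < ‖z‖ := norm_pos_iff.2 fun h => by simp [h] at hz
  have hR : 0 < R := by linarith
  refine le_trans ?_ (halfDiscGreen_ge hz (by linarith) ha (by linarith [norm_nonneg a]) ha0 hza)
  have b1 : Complex.normSq (z - (starRingEnd ℂ) a) ≤ (‖z‖ + ‖a‖) ^ 2 := by
    rw [Complex.normSq_eq_norm_sq]
    refine pow_le_pow_left₀ (norm_nonneg _) ?_ 2
    refine (norm_sub_le _ _).trans ?_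
    rw [Complex.norm_conj]
  have b2 : Complex.normSq ((R : ℂ) ^ 2 - z * (starRingEnd ℂ) a) ≤ (5 / 4 * R ^ 2) ^ 2 := by
    rw [Complex.normSq_eq_norm_sq]
    refine pow_le_pow_left₀ (norm_nonneg _) ?_ 2
    refine (norm_sub_le _ _).trans ?_
    rw [norm_mul, norm_pow, Complex.norm_conj, Complex.norm_real, Real.norm_of_nonneg hR.le]
    nlinarith [mul_le_mul hzR haR (by positivity) hR.le]
  have b3 : 3 / 4 * R ^ 2 ≤ R ^ 2 - Complex.normSq z := by
    rw [Complex.normSq_eq_norm_sq]; nlinarith [norm_nonneg z]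
  have b4 : 3 / 4 * R ^ 2 ≤ R ^ 2 - Complex.normSq a := by
    rw [Complex.normSq_eq_norm_sq]; nlinarith [norm_nonneg a]
  have p1 := Complex.normSq_pos.2 (sub_conj_ne_zero hz ha)
  have p2 := Complex.normSq_pos.2 (sq_sub_mul_ne_zero (z := z) (R := R) (by linarith)
    (c := (starRingEnd ℂ) a) (by simpa using (by linarith [norm_nonneg a] : ‖a‖ ≤ R)))
  -- The numerical factor left is `2 (3/4)² / (5/4)² = 18/25`, which exceeds the required `1/2`.
  have c1 : 2 * (z.im * a.im) * ((3 / 4 * R ^ 2) * (3 / 4 * R ^ 2)) /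
      ((‖z‖ + ‖a‖) ^ 2 * (5 / 4 * R ^ 2) ^ 2) ≤
      2 * (z.im * a.im) * ((R ^ 2 - Complex.normSq z) * (R ^ 2 - Complex.normSq a)) /
      (Complex.normSq (z - (starRingEnd ℂ) a) *
        Complex.normSq ((R : ℂ) ^ 2 - z * (starRingEnd ℂ) a)) := by
    have hR2 : 0 ≤ R ^ 2 - Complex.normSq z := by nlinarith
    have hR3 : 0 ≤ R ^ 2 - Complex.normSq a := by nlinarith
    gcongr
  refine le_trans ?_ c1
  have hn : 0 < ‖z‖ + ‖a‖ := by positivity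
  rw [div_le_div_iff₀ (by positivity) (by positivity)]
  have : 0 ≤ z.im * a.im * (‖z‖ + ‖a‖) ^ 2 * R ^ 4 := by positivity
  nlinarith

variable {f : ℂ → ℂ}

/-- The Poisson-Jensen formula for the upper half-disc. -/
theorem halfDisc_poissonJensen (hf : AnalyticOnNhd ℂ f {z : ℂ | 0 ≤ z.im}) (hf0 : f 0 ≠ 0)
    (hz : 0 < z.im) (hzR : ‖z‖ < R) (hfz : f z ≠ 0) :
    Real.log ‖f z‖ = halfDiscPoisson R z (fun w => Real.log ‖f w‖) -
      ∑ a ∈ halfDiscZeros f R, (analyticOrderNatAt f a : ℝ) * halfDiscGreen R z a := by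
  have hR : 0 < R := (norm_nonneg z).trans_lt hzR
  have hpi := Real.pi_pos
  obtain ⟨U, G, hU, -, hRU, hG, hfU⟩ := exists_factorization hf hf0 R
  set s := halfDiscZeros f R with hs
  have hsz : ∀ a ∈ s, a ∈ closedHalfDisc R ∧ f a = 0 ∧ a ≠ 0 := fun a ha => by
    have := (mem_halfDiscZeros hf hf0).1 ha
    exact ⟨this.1, this.2, fun h => hf0 (h ▸ this.2)⟩
  have hlog : ∀ w ∈ closedHalfDisc R, w ∉ s → Real.log ‖f w‖ =
      (∑ a ∈ s, (analyticOrderNatAt f a : ℝ) * Real.log ‖w - a‖) + (G w).re := by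
    intro w hw hws
    have hne : ∀ a ∈ s, ‖w - a‖ ^ analyticOrderNatAt f a ≠ 0 := fun a ha =>
      pow_ne_zero _ (norm_ne_zero_iff.2 (sub_ne_zero.2 fun h => hws (h ▸ ha)))
    rw [hfU w (hRU hw), norm_mul, norm_prod, Complex.norm_exp]
    simp only [norm_pow]
    rw [Real.log_mul (Finset.prod_ne_zero_iff.2 hne) (Real.exp_ne_zero _), Real.log_exp,
      Real.log_prod hne]
    simp only [Real.log_pow]
  have k1 := (continuous_segKer hR hz.ne').continuousOn (s := Set.uIcc (-R) R)
  have k2 := (continuous_arcKer hzR).continuousOn (s := Set.uIcc 0 Real.pi)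
  have m1 : ∀ t ∈ Set.Icc (-R) R, ((t : ℝ) : ℂ) ∈ closedHalfDisc R := fun t ht =>
    ofReal_mem_closedHalfDisc (abs_le.2 ht)
  have m2 : ∀ θ ∈ Set.Icc 0 Real.pi, circleMap 0 R θ ∈ closedHalfDisc R := fun θ hθ =>
    circleMap_mem_closedHalfDisc hR.le le_rfl hθ
  have hle : -R ≤ R := by linarith
  have I1 : ∀ a : ℂ, IntervalIntegrable (fun t : ℝ => (analyticOrderNatAt f a : ℝ) *
      (Real.log ‖(t : ℂ) - a‖ * segKer R z t)) volume (-R) R := fun a =>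
    ((segment_intervalIntegrable_log_norm (analyticOnNhd_sub_const a) _ _).mul_continuousOn
      k1).const_mul _
  have I2 : ∀ a : ℂ, IntervalIntegrable (fun θ : ℝ => (analyticOrderNatAt f a : ℝ) *
      (Real.log ‖circleMap 0 R θ - a‖ * arcKer R z θ)) volume 0 Real.pi := fun a =>
    ((halfCircle_intervalIntegrable_log_norm hR (analyticOnNhd_sub_const a)).mul_continuousOn
      k2).const_mul _
  have G1 : IntervalIntegrable (fun t : ℝ => (G t).re * segKer R z t) volume (-R) R := by
    refine IntervalIntegrable.mul_continuousOn (ContinuousOn.intervalIntegrable ?_) k1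
    rw [Set.uIcc_of_le hle]
    exact Complex.continuous_re.comp_continuousOn
      ((hG.continuousOn.mono hRU).comp Complex.continuous_ofReal.continuousOn m1)
  have G2 : IntervalIntegrable (fun θ : ℝ => (G (circleMap 0 R θ)).re * arcKer R z θ)
      volume 0 Real.pi := by
    refine IntervalIntegrable.mul_continuousOn (ContinuousOn.intervalIntegrable ?_) k2
    rw [Set.uIcc_of_le hpi.le]
    exact Complex.continuous_re.comp_continuousOn
      ((hG.continuousOn.mono hRU).comp (by fun_prop) m2)
  have e1 : ∫ t in (-R)..R, Real.log ‖f t‖ * segKer R z t =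
      (∑ a ∈ s, (analyticOrderNatAt f a : ℝ) * ∫ t in (-R)..R, Real.log ‖(t : ℂ) - a‖ *
        segKer R z t) + ∫ t in (-R)..R, (G t).re * segKer R z t := by
    rw [intervalIntegral.integral_congr_ae (g := fun t : ℝ => (∑ a ∈ s,
      (analyticOrderNatAt f a : ℝ) * (Real.log ‖(t : ℂ) - a‖ * segKer R z t)) +
      (G t).re * segKer R z t), intervalIntegral.integral_add
      (intervalIntegrable_sum_fun fun a _ => I1 a) G1,
      intervalIntegral.integral_finsetSum fun a _ => I1 a]
    · simp only [intervalIntegral.integral_const_mul]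
    · have hfin : ((fun x : ℝ => (x : ℂ)) ⁻¹' (s : Set ℂ)).Finite :=
        (Finset.finite_toSet _).preimage Complex.ofReal_injective.injOn
      filter_upwards [compl_mem_ae_iff.2 (hfin.measure_zero volume)] with x hx hxt
      rw [Set.uIoc_of_le hle] at hxt
      rw [hlog _ (m1 x (Set.Ioc_subset_Icc_self hxt)) (by simpa using hx), add_mul, Finset.sum_mul]
      simp only [mul_assoc]
  have e2 : ∫ θ in (0 : ℝ)..Real.pi, Real.log ‖f (circleMap 0 R θ)‖ * arcKer R z θ =
      (∑ a ∈ s, (analyticOrderNatAt f a : ℝ) * ∫ θ in (0 : ℝ)..Real.pi,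
        Real.log ‖circleMap 0 R θ - a‖ * arcKer R z θ) +
      ∫ θ in (0 : ℝ)..Real.pi, (G (circleMap 0 R θ)).re * arcKer R z θ := by
    rw [intervalIntegral.integral_congr_ae (g := fun θ : ℝ => (∑ a ∈ s,
      (analyticOrderNatAt f a : ℝ) * (Real.log ‖circleMap 0 R θ - a‖ * arcKer R z θ)) +
      (G (circleMap 0 R θ)).re * arcKer R z θ), intervalIntegral.integral_add
      (intervalIntegrable_sum_fun fun a _ => I2 a) G2,
      intervalIntegral.integral_finsetSum fun a _ => I2 a]
    · simp only [intervalIntegral.integral_const_mul]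
    · have hcount : ((fun θ : ℝ => circleMap 0 R θ) ⁻¹' (s : Set ℂ)).Countable :=
        s.countable_toSet.preimage_circleMap 0 hR.ne'
      filter_upwards [compl_mem_ae_iff.2 (hcount.measure_zero volume)] with θ hθ hθ2
      rw [Set.uIoc_of_le hpi.le] at hθ2
      rw [hlog _ (m2 θ (Set.Ioc_subset_Icc_self hθ2)) (by simpa using hθ), add_mul, Finset.sum_mul]
      simp only [mul_assoc]
  have e3 := halfDiscPoisson_re hz hzR (hG.mono hRU)
  have e4 : halfDiscPoisson R z (fun w => Real.log ‖f w‖) =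
      (∑ a ∈ s, (analyticOrderNatAt f a : ℝ) * halfDiscPoisson R z (fun w => Real.log ‖w - a‖)) +
      (G z).re := by
    rw [← e3]
    simp only [halfDiscPoisson, mul_add, Finset.sum_add_distrib]
    rw [e1, e2]
    ring
  have e5 : ∑ a ∈ s, (analyticOrderNatAt f a : ℝ) * halfDiscPoisson R z (fun w => Real.log ‖w - a‖) =
      (∑ a ∈ s, (analyticOrderNatAt f a : ℝ) * Real.log ‖z - a‖) +
      ∑ a ∈ s, (analyticOrderNatAt f a : ℝ) * halfDiscGreen R z a := by
    rw [← Finset.sum_add_distrib]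
    refine Finset.sum_congr rfl fun a ha => ?_
    rw [halfDiscPoisson_log_norm_sub hz hzR (hsz a ha).1 (hsz a ha).2.2, mul_add]
  rw [e4, e5, hlog z ⟨hz.le, hzR.le⟩ (fun h => hfz (hsz z h).2.1)]
  ring
end

/-! ### The half-disc kernels as the radius tends to infinity. -/

noncomputable section

/-- The Poisson integral over the real line of `log ‖f‖`. -/
def linePoisson (f : ℂ → ℂ) (z : ℂ) : ℝ :=
  ∫ t : ℝ, Real.log ‖f t‖ * (z.im / Real.pi * (1 / Complex.normSq (t - z)))

/-- The Poisson integral over the real line of `|log ‖f‖|`, as an extended nonnegative number. -/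
def lineMajorant (f : ℂ → ℂ) (z : ℂ) : ENNReal :=
  ∫⁻ t : ℝ, ‖Real.log ‖f t‖‖ₑ * ENNReal.ofReal (z.im / Real.pi * (1 / Complex.normSq (t - z)))

/-- The zeros of `f` in the open upper half-plane. -/
def upperZeros (f : ℂ → ℂ) : Set ℂ := {a : ℂ | 0 < a.im ∧ f a = 0}

/-- The Green potential of the zeros of `f` in the open upper half-plane. -/
def greenPotential (f : ℂ → ℂ) (z : ℂ) : ENNReal :=
  ∑' a : upperZeros f, ENNReal.ofReal ((analyticOrderNatAt f a : ℝ) * halfPlaneGreen z a)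

variable {R : ℝ} {z : ℂ} {f : ℂ → ℂ}

/-- For fixed `z` this exchanges the weight `1/(1 + t²)` of hypothesis (ii) for the Poisson weight
`1/|t - z|²`. -/
lemma one_add_sq_le_normSq (hz : 0 < z.im) (t : ℝ) :
    1 + t ^ 2 ≤ (2 + (1 + 2 * z.re ^ 2) / z.im ^ 2) * Complex.normSq (t - z) := by
  have h : Complex.normSq (t - z) = (t - z.re) ^ 2 + z.im ^ 2 := by
    simp [Complex.normSq_apply]; ring
  rw [h]
  have e : (2 + (1 + 2 * z.re ^ 2) / z.im ^ 2) * ((t - z.re) ^ 2 + z.im ^ 2) =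
      2 * (t - z.re) ^ 2 + 2 * z.im ^ 2 + (1 + 2 * z.re ^ 2) / z.im ^ 2 * (t - z.re) ^ 2 +
        (1 + 2 * z.re ^ 2) := by
    field_simp; ring
  rw [e]
  have : 0 ≤ (1 + 2 * z.re ^ 2) / z.im ^ 2 * (t - z.re) ^ 2 := by positivity
  nlinarith [sq_nonneg (t - 2 * z.re), sq_nonneg z.im]

lemma normSq_ofReal_sub_pos (hz : 0 < z.im) (t : ℝ) : 0 < Complex.normSq (t - z) :=
  Complex.normSq_pos.2 (ofReal_sub_ne_zero hz.ne' t)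

lemma continuous_one_div_normSq (hz : 0 < z.im) :
    Continuous fun t : ℝ => 1 / Complex.normSq (t - z) :=
  continuous_const.div (Complex.continuous_normSq.comp (by fun_prop))
      fun t => (normSq_ofReal_sub_pos hz t).ne'

lemma measurable_log_norm_ofReal (hf : AnalyticOnNhd ℂ f {z : ℂ | 0 ≤ z.im}) :
    Measurable fun t : ℝ => Real.log ‖f t‖ := by
  have : Continuous fun t : ℝ => f t :=
    hf.continuousOn.comp_continuous Complex.continuous_ofReal (by simp)
  exact Real.measurable_log.comp this.norm.measurable

lemma integrable_log_mul_one_div_normSq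
    (hlog : Integrable (fun t : ℝ => Real.log ‖f (t : ℂ)‖ / (1 + t ^ 2))) (hz : 0 < z.im) :
    Integrable fun t : ℝ => Real.log ‖f t‖ * (1 / Complex.normSq (t - z)) := by
  have hc : Continuous fun t : ℝ => (1 + t ^ 2) * (1 / Complex.normSq (t - z)) :=
    (by fun_prop : Continuous fun t : ℝ => 1 + t ^ 2).mul (continuous_one_div_normSq hz)
  have h := hlog.mul_bdd (g := fun t : ℝ => (1 + t ^ 2) * (1 / Complex.normSq (t - z)))
    (c := 2 + (1 + 2 * z.re ^ 2) / z.im ^ 2) hc.aestronglyMeasurable (by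
      filter_upwards with t
      have := normSq_ofReal_sub_pos hz t
      rw [Real.norm_of_nonneg (by positivity), mul_one_div, div_le_iff₀ this]
      exact one_add_sq_le_normSq hz t)
  refine h.congr ?_
  filter_upwards with t
  have : 1 + t ^ 2 ≠ 0 := by positivity
  field_simp

/-- The identity `|R² - tz|² = R² |t - z|² + (R² - |z|²)(R² - t²)` makes the subtracted term the
smaller one. -/
lemma segKer_nonneg (hz : 0 < z.im) (hzR : ‖z‖ < R) {t : ℝ} (ht : |t| ≤ R) : 0 ≤ segKer R z t := by
  have hR : 0 < R := (norm_nonneg z).trans_lt hzR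
  have h1 := normSq_sq_sub_mul_conj' R z t
  rw [Complex.conj_ofReal, mul_comm z, ← Complex.normSq_neg (z - t), neg_sub] at h1
  have h2 : 0 ≤ (R ^ 2 - Complex.normSq z) * (R ^ 2 - Complex.normSq (t : ℂ)) := by
    refine mul_nonneg ?_ ?_
    · rw [Complex.normSq_eq_norm_sq]; nlinarith [norm_nonneg z]
    · rw [Complex.normSq_ofReal, ← abs_mul_abs_self]; nlinarith [abs_nonneg t]
  have p1 := normSq_ofReal_sub_pos hz t
  have p2 := Complex.normSq_pos.2 (ofReal_sq_sub_mul_ne_zero hR hz.ne' t)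
  rw [segKer]
  refine mul_nonneg (by have := Real.pi_pos; positivity) (sub_nonneg.2 ?_)
  rw [div_le_div_iff₀ p2 p1]
  linarith

lemma segKer_le (hz : 0 < z.im) (R t : ℝ) :
    segKer R z t ≤ z.im / Real.pi * (1 / Complex.normSq (t - z)) := by
  rw [segKer]
  have := Real.pi_pos
  refine mul_le_mul_of_nonneg_left ?_ (by positivity)
  have := Complex.normSq_nonneg ((R : ℂ) ^ 2 - t * z)
  have : 0 ≤ R ^ 2 / Complex.normSq ((R : ℂ) ^ 2 - t * z) := by positivity
  linarith

lemma tendsto_segKer (z : ℂ) (t : ℝ) : Tendsto (fun R : ℝ => segKer R z t) atTop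
    (𝓝 (z.im / Real.pi * (1 / Complex.normSq (t - z)))) := by
  have h : Tendsto (fun R : ℝ => R ^ 2 / Complex.normSq ((R : ℂ) ^ 2 - t * z)) atTop (𝓝 0) := by
    have h4 : Tendsto (fun R : ℝ => 4 / R ^ 2) atTop (𝓝 0) :=
      tendsto_const_nhds.div_atTop (tendsto_pow_atTop two_ne_zero)
    refine squeeze_zero' ?_ ?_ h4
    · filter_upwards with R
      have := Complex.normSq_nonneg ((R : ℂ) ^ 2 - t * z)
      positivity
    · filter_upwards [eventually_ge_atTop (1 + 2 * (|t| * ‖z‖))] with R hR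
      have h0 : 0 ≤ |t| * ‖z‖ := by positivity
      have hR1 : 1 ≤ R := by linarith
      have h1 : R ^ 2 / 2 ≤ ‖(R : ℂ) ^ 2 - t * z‖ := by
        have := norm_sub_norm_le ((R : ℂ) ^ 2) (t * z)
        rw [norm_pow, norm_mul, Complex.norm_real, Complex.norm_real,
          Real.norm_of_nonneg (by linarith : 0 ≤ R), Real.norm_eq_abs] at this
        nlinarith
      have h2 : (R ^ 2 / 2) ^ 2 ≤ Complex.normSq ((R : ℂ) ^ 2 - t * z) := by
        rw [Complex.normSq_eq_norm_sq]
        exact pow_le_pow_left₀ (by positivity) h1 2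
      calc R ^ 2 / Complex.normSq ((R : ℂ) ^ 2 - t * z) ≤ R ^ 2 / (R ^ 2 / 2) ^ 2 := by gcongr
        _ = 4 / R ^ 2 := by field_simp; norm_num
  have := (tendsto_const_nhds (x := 1 / Complex.normSq (t - z))).sub h
  rw [sub_zero] at this
  exact this.const_mul _

/-- Dominated convergence: the diameter kernel lies between zero and the half-plane Poisson kernel,
against which `|log ‖f‖|` is integrable by hypothesis (ii). -/
lemma tendsto_integral_segKer (hf : AnalyticOnNhd ℂ f {z : ℂ | 0 ≤ z.im})
    (hlog : Integrable (fun t : ℝ => Real.log ‖f (t : ℂ)‖ / (1 + t ^ 2))) (hz : 0 < z.im) :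
    Tendsto (fun n : ℕ => ∫ t in (-(n : ℝ))..n, Real.log ‖f t‖ * segKer n z t) atTop
      (𝓝 (linePoisson f z)) := by
  have hmeas := measurable_log_norm_ofReal hf
  have hpi := Real.pi_pos
  have key : Tendsto (fun n : ℕ => ∫ t : ℝ, (Set.Ioc (-(n : ℝ)) n).indicator
      (fun t => Real.log ‖f t‖ * segKer n z t) t) atTop (𝓝 (linePoisson f z)) := by
    refine tendsto_integral_filter_of_dominated_convergence
      (fun t => z.im / Real.pi * |Real.log ‖f t‖ * (1 / Complex.normSq (t - z))|) ?_ ?_ ?_ ?_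
    · filter_upwards [eventually_gt_atTop 0] with n hn
      have hn' : (0 : ℝ) < n := by exact_mod_cast hn
      exact ((hmeas.mul (continuous_segKer hn' hz.ne').measurable).indicator
        measurableSet_Ioc).aestronglyMeasurable
    · filter_upwards [eventually_gt_atTop ⌈‖z‖⌉₊] with n hn
      have hn' : ‖z‖ < n := Nat.lt_of_ceil_lt hn
      filter_upwards with t
      have hp := normSq_ofReal_sub_pos hz t
      by_cases ht : t ∈ Set.Ioc (-(n : ℝ)) n
      · rw [Set.indicator_of_mem ht, norm_mul, Real.norm_eq_abs,
          Real.norm_of_nonneg (segKer_nonneg hz hn' (abs_le.2 ⟨ht.1.le, ht.2⟩)), abs_mul,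
          abs_of_nonneg (by positivity : 0 ≤ 1 / Complex.normSq (t - z))]
        have := mul_le_mul_of_nonneg_left (segKer_le hz n t) (abs_nonneg (Real.log ‖f t‖))
        linarith
      · rw [Set.indicator_of_notMem ht, norm_zero]
        positivity
    · exact (integrable_log_mul_one_div_normSq hlog hz).abs.const_mul _
    · filter_upwards with t
      have h1 := ((tendsto_segKer z t).comp tendsto_natCast_atTop_atTop).const_mul
        (Real.log ‖f t‖)
      refine h1.congr' ?_
      filter_upwards [eventually_gt_atTop ⌈|t|⌉₊] with n hn
      have hn' : |t| < n := Nat.lt_of_ceil_lt hn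
      rw [Set.indicator_of_mem]
      · rfl
      · exact ⟨(abs_lt.1 hn').1, (abs_lt.1 hn').2.le⟩
  refine key.congr fun n => ?_
  rw [integral_indicator measurableSet_Ioc, intervalIntegral.integral_of_le
    (by linarith [n.cast_nonneg (α := ℝ)])]

/-- The leading term of `arcKer R z / Im z`. -/
def sinKer (R θ : ℝ) : ℝ := 2 / (Real.pi * R) * Real.sin θ

/-- The two squared distances differ by `4 R sin θ Im z`. This extracts `Im z` and a weight free of
`z`; the remaining factor tends to `1` as `R` grows. -/
lemma arcKer_eq (hzR : ‖z‖ < R) (θ : ℝ) : arcKer R z θ = z.im * sinKer R θ *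
    ((R ^ 2 - ‖z‖ ^ 2) * R ^ 2 / (Complex.normSq (circleMap 0 R θ - z) *
      Complex.normSq (circleMap 0 R θ - (starRingEnd ℂ) z))) := by
  have hR : 0 < R := (norm_nonneg z).trans_lt hzR
  have hpi := Real.pi_pos
  have p1 := Complex.normSq_pos.2 (halfDisc_sub_ne_zero hzR θ)
  have p2 := Complex.normSq_pos.2 (halfDisc_sub_ne_zero (z := (starRingEnd ℂ) z) (by simpa using hzR) θ)
  have h := normSq_sub_conj (circleMap 0 R θ) z
  rw [circleMap_zero_im] at h
  rw [arcKer, sinKer, div_sub_div _ _ p1.ne' p2.ne', one_mul, mul_one]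
  nth_rw 1 [h]
  field_simp
  ring

/-- The relative deviation between `arcKer R z` and its leading term. -/
def arcErr (R r : ℝ) : ℝ :=
  |(R ^ 2 - r ^ 2) * R ^ 2 / (R + r) ^ 4 - 1| + |(R ^ 2 - r ^ 2) * R ^ 2 / (R - r) ^ 4 - 1|

lemma abs_arcKer_sub_le (hz : 0 < z.im) (hzR : ‖z‖ < R) {θ : ℝ} (hθ : θ ∈ Set.Icc 0 Real.pi) :
    |arcKer R z θ - z.im * sinKer R θ| ≤ z.im * arcErr R ‖z‖ * sinKer R θ := by
  have hR : 0 < R := (norm_nonneg z).trans_lt hzR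
  have hpi := Real.pi_pos
  have hs : 0 ≤ sinKer R θ := mul_nonneg (by positivity) (Real.sin_nonneg_of_mem_Icc hθ)
  have hb : ∀ c : ℂ, ‖c‖ = ‖z‖ → (R - ‖z‖) ^ 2 ≤ Complex.normSq (circleMap 0 R θ - c) ∧
      Complex.normSq (circleMap 0 R θ - c) ≤ (R + ‖z‖) ^ 2 := by
    intro c hc
    have hn : ‖circleMap 0 R θ‖ = R := by rw [norm_circleMap_zero, abs_of_pos hR]
    rw [Complex.normSq_eq_norm_sq]
    constructor
    · refine pow_le_pow_left₀ (by linarith) ?_ 2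
      have := norm_sub_norm_le (circleMap 0 R θ) c
      rwa [hn, hc] at this
    · refine pow_le_pow_left₀ (norm_nonneg _) ?_ 2
      have := norm_sub_le (circleMap 0 R θ) c
      rwa [hn, hc] at this
  obtain ⟨l1, u1⟩ := hb z rfl
  obtain ⟨l2, u2⟩ := hb ((starRingEnd ℂ) z) (by simp)
  have hd : 0 < R - ‖z‖ := by linarith
  have hRz : 0 ≤ (R ^ 2 - ‖z‖ ^ 2) * R ^ 2 := by
    have : 0 ≤ R ^ 2 - ‖z‖ ^ 2 := by nlinarith [norm_nonneg z]
    positivity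
  set q := (R ^ 2 - ‖z‖ ^ 2) * R ^ 2 / (Complex.normSq (circleMap 0 R θ - z) *
      Complex.normSq (circleMap 0 R θ - (starRingEnd ℂ) z)) with hq
  have p1 := Complex.normSq_pos.2 (halfDisc_sub_ne_zero hzR θ)
  have p2 := Complex.normSq_pos.2 (halfDisc_sub_ne_zero (z := (starRingEnd ℂ) z) (by simpa using hzR) θ)
  have q1 : (R ^ 2 - ‖z‖ ^ 2) * R ^ 2 / (R + ‖z‖) ^ 4 ≤ q := by
    refine div_le_div_of_nonneg_left hRz (by positivity) ?_
    calc _ ≤ (R + ‖z‖) ^ 2 * (R + ‖z‖) ^ 2 := mul_le_mul u1 u2 p2.le (by positivity)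
      _ = _ := by ring
  have q2 : q ≤ (R ^ 2 - ‖z‖ ^ 2) * R ^ 2 / (R - ‖z‖) ^ 4 := by
    refine div_le_div_of_nonneg_left hRz (by positivity) ?_
    calc _ = (R - ‖z‖) ^ 2 * (R - ‖z‖) ^ 2 := by ring
      _ ≤ _ := mul_le_mul l1 l2 (by positivity) p1.le
  have q3 : |q - 1| ≤ arcErr R ‖z‖ := by
    rw [arcErr, abs_le]
    constructor
    · linarith [neg_abs_le ((R ^ 2 - ‖z‖ ^ 2) * R ^ 2 / (R + ‖z‖) ^ 4 - 1),
        abs_nonneg ((R ^ 2 - ‖z‖ ^ 2) * R ^ 2 / (R - ‖z‖) ^ 4 - 1)]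
    · linarith [le_abs_self ((R ^ 2 - ‖z‖ ^ 2) * R ^ 2 / (R - ‖z‖) ^ 4 - 1),
        abs_nonneg ((R ^ 2 - ‖z‖ ^ 2) * R ^ 2 / (R + ‖z‖) ^ 4 - 1)]
  rw [arcKer_eq hzR, show z.im * sinKer R θ * q - z.im * sinKer R θ =
    z.im * sinKer R θ * (q - 1) by ring, abs_mul, abs_of_nonneg (by positivity)]
  calc z.im * sinKer R θ * |q - 1| ≤ z.im * sinKer R θ * arcErr R ‖z‖ :=
        mul_le_mul_of_nonneg_left q3 (by positivity)
    _ = _ := by ring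

lemma tendsto_arcErr (r : ℝ) : Tendsto (fun R => arcErr R r) atTop (𝓝 0) := by
  have h0 : Tendsto (fun R : ℝ => r / R) atTop (𝓝 0) := tendsto_const_nhds.div_atTop tendsto_id
  have hF : ContinuousAt (fun q : ℝ => |(1 - q ^ 2) / (1 + q) ^ 4 - 1| +
      |(1 - q ^ 2) / (1 - q) ^ 4 - 1|) 0 := by
    refine ContinuousAt.add ?_ ?_ <;>
    · refine ((ContinuousAt.div (by fun_prop) (by fun_prop) (by norm_num)).sub
        continuousAt_const).abs
  have h1 := hF.tendsto.comp h0
  simp only [ne_eq, OfNat.ofNat_ne_zero, not_false_eq_true, zero_pow, sub_zero, add_zero, one_pow,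
    div_one, sub_self, abs_zero] at h1
  refine h1.congr' ?_
  filter_upwards [eventually_gt_atTop (|r|)] with R hR
  have hR0 : 0 < R := (abs_nonneg r).trans_lt hR
  have h2 : R - r ≠ 0 := by have := le_abs_self r; intro h; linarith
  have h3 : R + r ≠ 0 := by have := neg_abs_le r; intro h; linarith
  simp only [Function.comp, arcErr]
  congr 3
  · rw [show 1 + r / R = (R + r) / R by field_simp]
    field_simp
  · rw [show 1 - r / R = (R - r) / R by field_simp]
    field_simp
end

/-! ### The constant `k` and the representation in the half-plane. -/

noncomputable section

variable {R : ℝ} {z : ℂ} {f : ℂ → ℂ}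

/-- The condition `f 0 = 1` forces `C ≥ 1`, so `log C` is nonnegative and is absorbed into the
linear term once `‖z‖ ≥ 1`. -/
lemma exists_log_norm_le_mul
    (hgrowth : ∃ C : ℝ, ∀ z : ℂ, 0 ≤ z.im → ‖f z‖ ≤ C * Real.exp (C * ‖z‖)) (hf0 : f 0 = 1) :
    ∃ B : ℝ, 0 ≤ B ∧ ∀ z : ℂ, 0 ≤ z.im → 1 ≤ ‖z‖ → Real.log ‖f z‖ ≤ B * ‖z‖ := by
  obtain ⟨C, hC⟩ := hgrowth
  have hC1 : 1 ≤ C := by simpa [hf0] using hC 0 (by simp)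
  have hl : 0 ≤ Real.log C := Real.log_nonneg hC1
  refine ⟨Real.log C + C, by linarith, fun z hz hz1 => ?_⟩
  rcases eq_or_ne (f z) 0 with h0 | h0
  · rw [h0, norm_zero, Real.log_zero]
    have := norm_nonneg z
    positivity
  · have h := Real.log_le_log (norm_pos_iff.2 h0) (hC z hz)
    rw [Real.log_mul (by linarith) (Real.exp_ne_zero _), Real.log_exp] at h
    nlinarith

lemma continuous_sinKer (R : ℝ) : Continuous (sinKer R) := by
  unfold sinKer; fun_prop

lemma sinKer_nonneg (hR : 0 < R) {θ : ℝ} (hθ : θ ∈ Set.Icc 0 Real.pi) : 0 ≤ sinKer R θ := by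
  have := Real.pi_pos
  exact mul_nonneg (by positivity) (Real.sin_nonneg_of_mem_Icc hθ)

lemma integral_sinKer (R : ℝ) : ∫ θ in (0 : ℝ)..Real.pi, sinKer R θ = 4 / (Real.pi * R) := by
  simp only [sinKer]
  rw [intervalIntegral.integral_const_mul, integral_sin]
  simp only [Real.cos_zero, Real.cos_pi]
  ring

/-- The leading coefficient of the contribution of the half-circle of radius `R` to the Poisson
integral of `log ‖f‖` in the half-disc. -/
def arcMean (f : ℂ → ℂ) (R : ℝ) : ℝ :=
  ∫ θ in (0 : ℝ)..Real.pi, Real.log ‖f (circleMap 0 R θ)‖ * sinKer R θ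

lemma intervalIntegrable_log_mul (hf : AnalyticOnNhd ℂ f {z : ℂ | 0 ≤ z.im}) (hR : 0 < R) {k : ℝ → ℝ}
    (hk : Continuous k) : IntervalIntegrable
      (fun θ => Real.log ‖f (circleMap 0 R θ)‖ * k θ) volume 0 Real.pi :=
  (halfCircle_intervalIntegrable_log_norm hR hf).mul_continuousOn hk.continuousOn

lemma circleMap_im_nonneg (hR : 0 < R) {θ : ℝ} (hθ : θ ∈ Set.Icc 0 Real.pi) :
    0 ≤ (circleMap 0 R θ).im := by
  rw [circleMap_zero_im]
  exact mul_nonneg hR.le (Real.sin_nonneg_of_mem_Icc hθ)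

lemma arcMean_le (hf : AnalyticOnNhd ℂ f {z : ℂ | 0 ≤ z.im}) {B : ℝ}
    (hB : ∀ z : ℂ, 0 ≤ z.im → 1 ≤ ‖z‖ → Real.log ‖f z‖ ≤ B * ‖z‖) (hR : 1 ≤ R) :
    arcMean f R ≤ 4 * B / Real.pi := by
  have hR0 : 0 < R := by linarith
  have h : arcMean f R ≤ ∫ θ in (0 : ℝ)..Real.pi, B * R * sinKer R θ := by
    refine intervalIntegral.integral_mono_on Real.pi_pos.le
      (intervalIntegrable_log_mul hf hR0 (continuous_sinKer R))
      ((continuous_const.mul (continuous_sinKer R)).intervalIntegrable _ _) fun θ hθ => ?_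
    refine mul_le_mul_of_nonneg_right ?_ (sinKer_nonneg hR0 hθ)
    have hn : ‖circleMap 0 R θ‖ = R := by rw [norm_circleMap_zero, abs_of_pos hR0]
    have := hB (circleMap 0 R θ) (circleMap_im_nonneg hR0 hθ) (by rw [hn]; exact hR)
    rwa [hn] at this
  rw [intervalIntegral.integral_const_mul, integral_sinKer] at h
  refine h.trans_eq ?_
  have := Real.pi_pos
  field_simp

lemma abs_integral_arcKer_sub_le (hf : AnalyticOnNhd ℂ f {z : ℂ | 0 ≤ z.im}) {B : ℝ} (hB0 : 0 ≤ B)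
    (hB : ∀ z : ℂ, 0 ≤ z.im → 1 ≤ ‖z‖ → Real.log ‖f z‖ ≤ B * ‖z‖) (hR : 1 ≤ R)
    (hz : 0 < z.im) (hzR : ‖z‖ < R) :
    |(∫ θ in (0 : ℝ)..Real.pi, Real.log ‖f (circleMap 0 R θ)‖ * arcKer R z θ) -
        z.im * arcMean f R| ≤ z.im * arcErr R ‖z‖ * (8 * B / Real.pi - arcMean f R) := by
  have hR0 : 0 < R := by linarith
  have hpi := Real.pi_pos
  have hE : 0 ≤ arcErr R ‖z‖ := by unfold arcErr; positivity
  have i1 := intervalIntegrable_log_mul hf hR0 (continuous_sinKer R)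
  have i2 := intervalIntegrable_log_mul hf hR0 (continuous_arcKer hzR)
  have i3 : IntervalIntegrable (fun θ => B * R * sinKer R θ) volume 0 Real.pi :=
    (continuous_const.mul (continuous_sinKer R)).intervalIntegrable _ _
  have e1 : (∫ θ in (0 : ℝ)..Real.pi, Real.log ‖f (circleMap 0 R θ)‖ * arcKer R z θ) -
        z.im * arcMean f R = ∫ θ in (0 : ℝ)..Real.pi,
          (Real.log ‖f (circleMap 0 R θ)‖ * arcKer R z θ -
            z.im * (Real.log ‖f (circleMap 0 R θ)‖ * sinKer R θ)) := by
    rw [intervalIntegral.integral_sub i2 (i1.const_mul _), intervalIntegral.integral_const_mul]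
    rfl
  have e2 : z.im * arcErr R ‖z‖ * (8 * B / Real.pi - arcMean f R) = ∫ θ in (0 : ℝ)..Real.pi,
      z.im * arcErr R ‖z‖ * (2 * (B * R * sinKer R θ) -
        Real.log ‖f (circleMap 0 R θ)‖ * sinKer R θ) := by
    rw [intervalIntegral.integral_const_mul, intervalIntegral.integral_sub (i3.const_mul _) i1,
      intervalIntegral.integral_const_mul, intervalIntegral.integral_const_mul, integral_sinKer,
      arcMean]
    congr 2
    field_simp
    ring
  rw [e1, e2]
  refine (intervalIntegral.abs_integral_le_integral_abs hpi.le).trans ?_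
  refine intervalIntegral.integral_mono_on hpi.le (i2.sub (i1.const_mul _)).abs
    (((i3.const_mul _).sub i1).const_mul _) fun θ hθ => ?_
  have hs := sinKer_nonneg hR0 hθ
  have hn : ‖circleMap 0 R θ‖ = R := by rw [norm_circleMap_zero, abs_of_pos hR0]
  have hu := hB (circleMap 0 R θ) (circleMap_im_nonneg hR0 hθ) (by rw [hn]; exact hR)
  rw [hn] at hu
  set v := Real.log ‖f (circleMap 0 R θ)‖
  -- Growth bounds `log ‖f‖` only from above. This inequality turns that into control of the
  -- absolute value; the integral of its right side against `sinKer` is `8B/π - arcMean f R`.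
  have hv : |v| ≤ 2 * (B * R) - v := by
    have : 0 ≤ B * R := by positivity
    rw [abs_le]; constructor <;> linarith
  calc |v * arcKer R z θ - z.im * (v * sinKer R θ)|
      = |v| * |arcKer R z θ - z.im * sinKer R θ| := by rw [← abs_mul]; congr 1; ring
    _ ≤ (2 * (B * R) - v) * (z.im * arcErr R ‖z‖ * sinKer R θ) := by
        refine mul_le_mul hv (abs_arcKer_sub_le hz hzR hθ) (abs_nonneg _) ?_
        exact (abs_nonneg v).trans hv
    _ = _ := by ring

/-- The contribution of the zeros to the Poisson–Jensen formula in the half-disc. -/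
def zeroSum (f : ℂ → ℂ) (R : ℝ) (z : ℂ) : ℝ :=
  ∑ a ∈ halfDiscZeros f R, (analyticOrderNatAt f a : ℝ) * halfDiscGreen R z a

lemma zeroSum_nonneg (hf : AnalyticOnNhd ℂ f {z : ℂ | 0 ≤ z.im}) (hf0 : f 0 ≠ 0)
    (hz : 0 < z.im) (hzR : ‖z‖ < R) (hfz : f z ≠ 0) : 0 ≤ zeroSum f R z := by
  refine Finset.sum_nonneg fun a ha => ?_
  obtain ⟨⟨h1, h2⟩, h3⟩ := (mem_halfDiscZeros hf hf0).1 ha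
  refine mul_nonneg (Nat.cast_nonneg _) (halfDiscGreen_nonneg hz hzR h1 h2 ?_ ?_)
  · rintro rfl; exact hf0 h3
  · rintro rfl; exact hfz h3

lemma ofReal_zeroSum_le (hf : AnalyticOnNhd ℂ f {z : ℂ | 0 ≤ z.im}) (hf0 : f 0 ≠ 0)
    (hz : 0 < z.im) (hzR : ‖z‖ < R) :
    ENNReal.ofReal (zeroSum f R z) ≤ greenPotential f z := by
  classical
  have hle : ∀ a ∈ halfDiscZeros f R, (analyticOrderNatAt f a : ℝ) * halfDiscGreen R z a ≤
      (analyticOrderNatAt f a : ℝ) * halfPlaneGreen z a := fun a ha => by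
    obtain ⟨⟨h1, h2⟩, h3⟩ := (mem_halfDiscZeros hf hf0).1 ha
    refine mul_le_mul_of_nonneg_left (halfDiscGreen_le hz hzR h1 h2 ?_) (Nat.cast_nonneg _)
    rintro rfl; exact hf0 h3
  have h0 : ∀ a ∈ halfDiscZeros f R, a ∉ upperZeros f →
      (analyticOrderNatAt f a : ℝ) * halfPlaneGreen z a = 0 := fun a ha hna => by
    obtain ⟨⟨h1, h2⟩, h3⟩ := (mem_halfDiscZeros hf hf0).1 ha
    have : a.im = 0 := by
      by_contra h
      exact hna ⟨lt_of_le_of_ne h1 (Ne.symm h), h3⟩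
    rw [halfPlaneGreen, Complex.conj_eq_iff_im.2 this, sub_self, mul_zero]
  calc ENNReal.ofReal (zeroSum f R z)
      ≤ ENNReal.ofReal (∑ a ∈ halfDiscZeros f R, (analyticOrderNatAt f a : ℝ) * halfPlaneGreen z a) :=
        ENNReal.ofReal_le_ofReal (Finset.sum_le_sum hle)
    _ = ENNReal.ofReal (∑ a ∈ halfDiscZeros f R with a ∈ upperZeros f,
          (analyticOrderNatAt f a : ℝ) * halfPlaneGreen z a) := by
        rw [Finset.sum_filter_of_ne fun a ha hne => ?_]
        by_contra hna
        exact hne (h0 a ha hna)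
    _ ≤ ∑ a ∈ halfDiscZeros f R with a ∈ upperZeros f,
          ENNReal.ofReal ((analyticOrderNatAt f a : ℝ) * halfPlaneGreen z a) := by
        refine Finset.le_sum_of_subadditive _ ENNReal.ofReal_zero.le
          (fun _ _ => ENNReal.ofReal_add_le) _ _
    _ = ∑ a ∈ (halfDiscZeros f R).subtype (· ∈ upperZeros f),
          ENNReal.ofReal ((analyticOrderNatAt f a : ℝ) * halfPlaneGreen z a) :=
        (Finset.sum_subtype_eq_sum_filter fun a : ℂ =>
          ENNReal.ofReal ((analyticOrderNatAt f a : ℝ) * halfPlaneGreen z a)).symm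
    _ ≤ greenPotential f z := ENNReal.sum_le_tsum _

lemma enorm_linePoisson_le (hz : 0 < z.im) : ‖linePoisson f z‖ₑ ≤ lineMajorant f z := by
  refine (enorm_integral_le_lintegral_enorm _).trans_eq ?_
  refine lintegral_congr fun t => ?_
  have := Complex.normSq_nonneg (t - z)
  have hpi := Real.pi_pos
  rw [enorm_mul, Real.enorm_of_nonneg (r := z.im / Real.pi * (1 / Complex.normSq (t - z)))
    (by positivity)]

lemma exists_ne_zero_of_zero (hf : AnalyticOnNhd ℂ f {z : ℂ | 0 ≤ z.im}) (hf0 : f 0 ≠ 0) :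
    ∃ w : ℂ, 0 < w.im ∧ f w ≠ 0 := by
  have hc : ContinuousAt (fun t : ℝ => f (t * Complex.I)) 0 := by
    refine ContinuousAt.comp (f := fun t : ℝ => (t : ℂ) * Complex.I) (g := f) ?_ (by fun_prop)
    simpa using (hf 0 (by simp)).continuousAt
  have h1 : ∀ᶠ t : ℝ in 𝓝 0, f (t * Complex.I) ≠ 0 :=
    hc.eventually_ne (by simpa using hf0)
  obtain ⟨t, ht1, ht2⟩ := ((h1.filter_mono nhdsWithin_le_nhds).and
    (self_mem_nhdsWithin : Set.Ioi (0 : ℝ) ∈ 𝓝[>] 0)).exists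
  exact ⟨t * Complex.I, by simpa using ht2, ht1⟩

/-- In Poisson-Jensen with `R = n`, the numbers `arcMean f n` are bounded above by growth. They are
bounded below by the formula at a single point `w` with `f w ≠ 0`, because the Green sum there is
nonnegative. They do not depend on `z`, so one convergent subsequence serves all `z` at once, and
the Green sums then converge to what is left. -/
lemma exists_tendsto_arcMean (hf : AnalyticOnNhd ℂ f {z : ℂ | 0 ≤ z.im})
    (hgrowth : ∃ C : ℝ, ∀ z : ℂ, 0 ≤ z.im → ‖f z‖ ≤ C * Real.exp (C * ‖z‖))
    (hf0 : f 0 = 1)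
    (hlog : Integrable (fun t : ℝ => Real.log ‖f (t : ℂ)‖ / (1 + t ^ 2))) :
    ∃ (k : ℝ) (φ : ℕ → ℕ), StrictMono φ ∧ ∀ z : ℂ, 0 < z.im → f z ≠ 0 →
      Tendsto (fun n => zeroSum f (φ n) z) atTop
        (𝓝 (linePoisson f z + k * z.im - Real.log ‖f z‖)) := by
  have hpi := Real.pi_pos
  have hne : f 0 ≠ 0 := by simp [hf0]
  obtain ⟨B, hB0, hB⟩ := exists_log_norm_le_mul hgrowth hf0
  obtain ⟨w, hw, hfw⟩ := exists_ne_zero_of_zero hf hne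
  have pj : ∀ z : ℂ, 0 < z.im → f z ≠ 0 → ∀ n : ℕ, ‖z‖ < n →
      Real.log ‖f z‖ = (∫ t in (-(n : ℝ))..n, Real.log ‖f t‖ * segKer n z t) +
        (∫ θ in (0 : ℝ)..Real.pi, Real.log ‖f (circleMap 0 n θ)‖ * arcKer n z θ) -
          zeroSum f n z := fun z hz hfz n hn => halfDisc_poissonJensen hf hne hz hn hfz
  have hbig : ∀ r : ℝ, ∀ᶠ n : ℕ in atTop, r < n := fun r => by
    filter_upwards [eventually_gt_atTop ⌈r⌉₊] with n hn using Nat.lt_of_ceil_lt hn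
  have hlow : ∀ᶠ n : ℕ in atTop, arcMean f n ∈ Set.Icc
      (2 * (Real.log ‖f w‖ - linePoisson f w - 1) / w.im - 8 * B / Real.pi) (4 * B / Real.pi) := by
    have e1 := (tendsto_integral_segKer hf hlog hw).eventually_lt_const
      (lt_add_one (linePoisson f w))
    -- With relative error at most `1/2`, the error term can absorb only half of `arcMean`, so a
    -- lower bound for the latter remains.
    have e2 := ((tendsto_arcErr ‖w‖).comp tendsto_natCast_atTop_atTop).eventually_le_const
      (by norm_num : (0 : ℝ) < 1 / 2)
    filter_upwards [e1, e2, hbig ‖w‖, hbig 1] with n h1 h2 h3 h4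
    have hup := arcMean_le hf hB h4.le
    refine ⟨?_, hup⟩
    have h5 := abs_integral_arcKer_sub_le hf hB0 hB h4.le hw h3
    have h6 := zeroSum_nonneg hf hne hw h3 hfw
    have h7 := pj w hw hfw n h3
    have hD : 0 ≤ 8 * B / Real.pi - arcMean f n := by
      have : 4 * B / Real.pi ≤ 8 * B / Real.pi := by gcongr; norm_num
      linarith
    have h8 : w.im * arcErr n ‖w‖ * (8 * B / Real.pi - arcMean f n) ≤
        w.im * (1 / 2) * (8 * B / Real.pi - arcMean f n) := by
      gcongr; exact h2
    have h9 := (abs_le.1 (h5.trans h8)).2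
    rw [sub_le_iff_le_add, div_le_iff₀ hw]
    linarith
  obtain ⟨k, -, φ, hφ, hk⟩ := tendsto_subseq_of_frequently_bounded
    (Metric.isBounded_Icc _ _) hlow.frequently
  refine ⟨k, φ, hφ, fun z hz hfz => ?_⟩
  have hφt := hφ.tendsto_atTop
  have s1 := (tendsto_integral_segKer hf hlog hz).comp hφt
  have s2 : Tendsto (fun n => ∫ θ in (0 : ℝ)..Real.pi,
      Real.log ‖f (circleMap 0 (φ n) θ)‖ * arcKer (φ n) z θ) atTop (𝓝 (k * z.im)) := by
    have hz0 : Tendsto (fun n => (∫ θ in (0 : ℝ)..Real.pi,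
        Real.log ‖f (circleMap 0 (φ n) θ)‖ * arcKer (φ n) z θ) - z.im * arcMean f (φ n))
        atTop (𝓝 0) := by
      refine squeeze_zero_norm' (a := fun n => z.im * arcErr (φ n) ‖z‖ *
        (8 * B / Real.pi - arcMean f (φ n))) ?_ ?_
      · filter_upwards [hφt.eventually (hbig ‖z‖), hφt.eventually (hbig 1)] with n h3 h4
        exact abs_integral_arcKer_sub_le hf hB0 hB h4.le hz h3
      · have t1 := (((tendsto_arcErr ‖z‖).comp
          (tendsto_natCast_atTop_atTop.comp hφt)).const_mul z.im).mul (hk.const_sub (8 * B / Real.pi))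
        rw [mul_zero, zero_mul] at t1
        exact t1
    have := hz0.add (hk.const_mul z.im)
    rw [zero_add, mul_comm] at this
    refine this.congr fun n => ?_
    simp only [Function.comp]
    ring
  refine ((s1.add s2).sub_const (Real.log ‖f z‖)).congr' ?_
  filter_upwards [hφt.eventually (hbig ‖z‖)] with n hn
  rw [pj z hz hfz _ hn]
  simp only [Function.comp]
  ring

/-- Representation of a function of exponential type in the upper half-plane up to an error
controlled by the Poisson integral over the line and the Green potential of the zeros. -/
theorem exists_halfPlane_representation (hf : AnalyticOnNhd ℂ f {z : ℂ | 0 ≤ z.im})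
    (hgrowth : ∃ C : ℝ, ∀ z : ℂ, 0 ≤ z.im → ‖f z‖ ≤ C * Real.exp (C * ‖z‖))
    (hf0 : f 0 = 1)
    (hlog : Integrable (fun t : ℝ => Real.log ‖f (t : ℂ)‖ / (1 + t ^ 2))) :
    ∃ k : ℝ, Summable (fun a : upperZeros f =>
        (analyticOrderNatAt f a : ℝ) * ((a : ℂ).im / (1 + ‖(a : ℂ)‖ ^ 2))) ∧
      ∀ z : ℂ, 0 < z.im → f z ≠ 0 → Real.log ‖f z‖ ≤ linePoisson f z + k * z.im ∧
        ‖Real.log ‖f z‖ - k * z.im‖ₑ ≤ lineMajorant f z + greenPotential f z := by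
  have hne : f 0 ≠ 0 := by simp [hf0]
  obtain ⟨k, φ, hφ, hk⟩ := exists_tendsto_arcMean hf hgrowth hf0 hlog
  have hbig : ∀ r : ℝ, ∀ᶠ n : ℕ in atTop, r < (φ n : ℝ) := fun r =>
    (tendsto_natCast_atTop_atTop.comp hφ.tendsto_atTop).eventually_gt_atTop r
  refine ⟨k, ?_, fun z hz hfz => ?_⟩
  · obtain ⟨w, hw, hfw⟩ := exists_ne_zero_of_zero hf hne
    -- The Blaschke condition comes from the finite limit of the Green sums at `w`. The constant
    -- combines `halfDiscGreen_ge_of_le_half` with `(‖w‖ + ‖a‖)² ≤ 2 (1 + ‖w‖²)(1 + ‖a‖²)`.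
    refine summable_of_sum_le (c := 4 * (1 + ‖w‖ ^ 2) / w.im *
      (linePoisson f w + k * w.im - Real.log ‖f w‖)) (fun a => ?_) fun s => ?_
    · have := a.2.1
      positivity
    refine ge_of_tendsto ((hk w hw hfw).const_mul _) ?_
    have hs : ∀ᶠ n : ℕ in atTop, ∀ a ∈ s, 2 * ‖(a : ℂ)‖ ≤ φ n :=
      (Filter.eventually_all_finset s).2 fun a _ => (hbig _).mono fun n hn => hn.le
    filter_upwards [hs, hbig (2 * ‖w‖), hbig ‖w‖] with n h1 h2 h3
    rw [zeroSum, Finset.mul_sum]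
    calc ∑ a ∈ s, (analyticOrderNatAt f a : ℝ) * ((a : ℂ).im / (1 + ‖(a : ℂ)‖ ^ 2))
        ≤ ∑ a ∈ s, 4 * (1 + ‖w‖ ^ 2) / w.im *
            ((analyticOrderNatAt f a : ℝ) * halfDiscGreen (φ n) w a) := by
          refine Finset.sum_le_sum fun a ha => ?_
          have hb := a.2.1
          have ha0 : (a : ℂ) ≠ 0 := by intro h; rw [h] at hb; simp at hb
          have hwa : w ≠ a := by intro h; rw [h] at hfw; exact hfw a.2.2
          have hg := halfDiscGreen_ge_of_le_half hw h2.le hb.le (h1 a ha) ha0 hwa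
          have hsq : (‖w‖ + ‖(a : ℂ)‖) ^ 2 ≤ 2 * ((1 + ‖w‖ ^ 2) * (1 + ‖(a : ℂ)‖ ^ 2)) := by
            nlinarith [sq_nonneg (‖w‖ - ‖(a : ℂ)‖), sq_nonneg (‖w‖ * ‖(a : ℂ)‖)]
          have hwa0 : 0 < ‖w‖ + ‖(a : ℂ)‖ := by
            have := norm_pos_iff.2 ha0; positivity
          have hq : (a : ℂ).im / (1 + ‖(a : ℂ)‖ ^ 2) ≤
              4 * (1 + ‖w‖ ^ 2) / w.im * (w.im * (a : ℂ).im / (2 * (‖w‖ + ‖(a : ℂ)‖) ^ 2)) := by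
            rw [show 4 * (1 + ‖w‖ ^ 2) / w.im *
              (w.im * (a : ℂ).im / (2 * (‖w‖ + ‖(a : ℂ)‖) ^ 2)) =
                (a : ℂ).im * (2 * (1 + ‖w‖ ^ 2)) / (‖w‖ + ‖(a : ℂ)‖) ^ 2 by field_simp; ring,
              div_le_div_iff₀ (by positivity) (by positivity)]
            nlinarith
          have hm : (0 : ℝ) ≤ analyticOrderNatAt f a := Nat.cast_nonneg _
          calc _ ≤ (analyticOrderNatAt f a : ℝ) * (4 * (1 + ‖w‖ ^ 2) / w.im *
                halfDiscGreen (φ n) w a) := by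
                refine mul_le_mul_of_nonneg_left (hq.trans ?_) hm
                gcongr
            _ = _ := by ring
      _ = ∑ a ∈ s.map (Function.Embedding.subtype _), 4 * (1 + ‖w‖ ^ 2) / w.im *
            ((analyticOrderNatAt f a : ℝ) * halfDiscGreen (φ n) w a) := by
          rw [Finset.sum_map]; rfl
      _ ≤ _ := by
          refine Finset.sum_le_sum_of_subset_of_nonneg (fun a ha => ?_) fun a ha _ => ?_
          · obtain ⟨b, hb, rfl⟩ := Finset.mem_map.1 ha
            refine (mem_halfDiscZeros hf hne).2 ⟨⟨b.2.1.le, ?_⟩, b.2.2⟩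
            have := h1 b hb
            have h0 := norm_nonneg (b : ℂ)
            exact (show ‖(b : ℂ)‖ ≤ φ n by linarith)
          · obtain ⟨⟨g1, g2⟩, g3⟩ := (mem_halfDiscZeros hf hne).1 ha
            refine mul_nonneg (by positivity) (mul_nonneg (Nat.cast_nonneg _)
              (halfDiscGreen_nonneg hw h3 g1 g2 ?_ ?_))
            · rintro rfl; exact hne g3
            · rintro rfl; exact hfw g3
  · have h1 := hk z hz hfz
    have h2 : 0 ≤ linePoisson f z + k * z.im - Real.log ‖f z‖ := by
      refine ge_of_tendsto h1 ?_
      filter_upwards [hbig ‖z‖] with n hn using zeroSum_nonneg hf hne hz hn hfz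
    have h3 : ENNReal.ofReal (linePoisson f z + k * z.im - Real.log ‖f z‖) ≤
        greenPotential f z := by
      refine le_of_tendsto (ENNReal.tendsto_ofReal h1) ?_
      filter_upwards [hbig ‖z‖] with n hn using ofReal_zeroSum_le hf hne hz hn
    refine ⟨by linarith, ?_⟩
    calc ‖Real.log ‖f z‖ - k * z.im‖ₑ
        = ‖linePoisson f z - (linePoisson f z + k * z.im - Real.log ‖f z‖)‖ₑ := by congr 1; ring
      _ ≤ ‖linePoisson f z‖ₑ + ‖linePoisson f z + k * z.im - Real.log ‖f z‖‖ₑ := enorm_sub_le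
      _ ≤ _ := by
        refine add_le_add (enorm_linePoisson_le hz) ?_
        rwa [Real.enorm_of_nonneg h2]
end

/-! ### The radial kernel and its averages. -/

noncomputable section

lemma lintegral_inv_sqrt_abs_Ioo {L : ℝ} (hL : 0 ≤ L) :
    ∫⁻ x in Set.Ioo 0 L, (ENNReal.ofReal √|x|)⁻¹ = ENNReal.ofReal (2 * √L) := by
  have h1 : ∫⁻ x in Set.Ioo 0 L, (ENNReal.ofReal √|x|)⁻¹ =
      ∫⁻ x in Set.Ioc 0 L, ENNReal.ofReal (x ^ (-(1 / 2) : ℝ)) := by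
    rw [restrict_Ioo_eq_restrict_Ioc]
    refine setLIntegral_congr_fun measurableSet_Ioc fun x hx => ?_
    rw [abs_of_pos hx.1, ← ENNReal.ofReal_inv_of_pos (Real.sqrt_pos.2 hx.1), Real.sqrt_eq_rpow,
      ← Real.rpow_neg hx.1.le]
  have h2 : IntervalIntegrable (fun x : ℝ => x ^ (-(1 / 2) : ℝ)) volume 0 L :=
    intervalIntegral.intervalIntegrable_rpow' (by norm_num)
  rw [h1, ← ofReal_integral_eq_lintegral_ofReal
    ((intervalIntegrable_iff_integrableOn_Ioc_of_le hL).1 h2),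
    ← intervalIntegral.integral_of_le hL, integral_rpow (Or.inl (by norm_num)),
    Real.sqrt_eq_rpow]
  · congr 1
    norm_num
    ring
  · filter_upwards [ae_restrict_mem measurableSet_Ioc] with x hx
    exact Real.rpow_nonneg hx.1.le _

lemma lintegral_inv_sqrt_abs_le {L : ℝ} (hL : 0 ≤ L) :
    ∫⁻ x in Set.Ioo (-L) L, (ENNReal.ofReal √|x|)⁻¹ ≤ ENNReal.ofReal (4 * √L) := by
  have h1 : ∫⁻ x in Set.Ioo (-L) 0, (ENNReal.ofReal √|x|)⁻¹ = ENNReal.ofReal (2 * √L) := by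
    rw [← lintegral_inv_sqrt_abs_Ioo hL]
    have := (Measure.measurePreserving_neg (volume : Measure ℝ)).setLIntegral_comp_preimage
      (s := Set.Ioo 0 L) measurableSet_Ioo (f := fun x => (ENNReal.ofReal √|x|)⁻¹) (by fun_prop)
    rw [← this]
    simp
  have h2 : Set.Ioo (-L) L ⊆ (Set.Ioo (-L) 0 ∪ Set.Ioo 0 L) ∪ {0} := fun x hx => by
    rcases lt_trichotomy x 0 with h | h | h
    · exact Or.inl (Or.inl ⟨hx.1, h⟩)
    · exact Or.inr h
    · exact Or.inl (Or.inr ⟨h, hx.2⟩)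
  refine (lintegral_mono_set h2).trans ((lintegral_union_le _ _ _).trans ?_)
  have h3 := lintegral_union_le (μ := volume) (fun x : ℝ => (ENNReal.ofReal √|x|)⁻¹)
    (Set.Ioo (-L) 0) (Set.Ioo 0 L)
  rw [h1, lintegral_inv_sqrt_abs_Ioo hL, ← ENNReal.ofReal_add (by positivity) (by positivity)] at h3
  rw [setLIntegral_measure_zero {0} _ (by simp), add_zero]
  refine h3.trans_eq ?_
  congr 1
  ring

/-- Uniformity in `c` is the point. The part of the interval within its length `L` of `c`
contributes at most `4√L`, and on the rest the integrand is at most `1/√L`. -/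
lemma lintegral_inv_sqrt_abs_sub_le {a b : ℝ} (hab : a < b) (c : ℝ) :
    ∫⁻ x in Set.Ioo a b, (ENNReal.ofReal √|x - c|)⁻¹ ≤ ENNReal.ofReal (5 * √(b - a)) := by
  set L := b - a with hL
  have hL0 : 0 < L := sub_pos.2 hab
  have hs : 0 < √L := Real.sqrt_pos.2 hL0
  have h1 : ∫⁻ x in Set.Ioo (c - L) (c + L), (ENNReal.ofReal √|x - c|)⁻¹ ≤
      ENNReal.ofReal (4 * √L) := by
    refine le_trans (le_of_eq ?_) (lintegral_inv_sqrt_abs_le hL0.le)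
    have := (measurePreserving_sub_right (volume : Measure ℝ) c).setLIntegral_comp_preimage
      (s := Set.Ioo (-L) L) measurableSet_Ioo (f := fun x => (ENNReal.ofReal √|x|)⁻¹) (by fun_prop)
    rw [← this]
    simp [sub_eq_add_neg, add_comm]
  have h2 : ∫⁻ x in Set.Ioo a b \ Set.Ioo (c - L) (c + L), (ENNReal.ofReal √|x - c|)⁻¹ ≤
      ENNReal.ofReal √L := by
    calc _ ≤ ∫⁻ x in Set.Ioo a b \ Set.Ioo (c - L) (c + L), ENNReal.ofReal (√L)⁻¹ := by
          refine setLIntegral_mono (by fun_prop) fun x hx => ?_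
          rw [ENNReal.ofReal_inv_of_pos hs]
          refine ENNReal.inv_le_inv.2 (ENNReal.ofReal_le_ofReal (Real.sqrt_le_sqrt ?_))
          by_contra h
          rw [not_le, abs_lt] at h
          exact hx.2 ⟨by linarith [h.1], by linarith [h.2]⟩
      _ ≤ ENNReal.ofReal (√L)⁻¹ * ENNReal.ofReal L := by
          rw [setLIntegral_const]
          gcongr
          refine (measure_mono Set.sdiff_subset).trans_eq ?_
          rw [Real.volume_Ioo]
      _ = ENNReal.ofReal √L := by
          rw [← ENNReal.ofReal_mul (by positivity)]
          congr 1
          rw [inv_mul_eq_div, Real.div_sqrt]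
  calc ∫⁻ x in Set.Ioo a b, (ENNReal.ofReal √|x - c|)⁻¹
      ≤ ∫⁻ x in Set.Ioo (c - L) (c + L) ∪ (Set.Ioo a b \ Set.Ioo (c - L) (c + L)),
          (ENNReal.ofReal √|x - c|)⁻¹ := lintegral_mono_set (by
            rw [Set.union_sdiff_self]; exact Set.subset_union_right)
    _ ≤ ENNReal.ofReal (4 * √L) + ENNReal.ofReal √L :=
        (lintegral_union_le _ _ _).trans (add_le_add h1 h2)
    _ = _ := by rw [← ENNReal.ofReal_add (by positivity) (by positivity)]; congr 1; ring

/-- A radial majorant of the Poisson kernel and of Green's function of the upper half-plane for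
points of modulus `r` and `ρ`. -/
def radialKer (r ρ : ℝ) : ENNReal :=
  if 2 * r ≤ ρ then ENNReal.ofReal (r / ρ ^ 2) else (ENNReal.ofReal √(r * |r - ρ|))⁻¹

lemma measurable_radialKer : Measurable fun q : ℝ × ℝ => radialKer q.1 q.2 := by
  unfold radialKer
  refine Measurable.ite (measurableSet_le (by fun_prop) (by fun_prop)) (by fun_prop) ?_
  fun_prop

/-- At `ρ = r` the kernel is `⊤`, since `0⁻¹ = ⊤` in `ENNReal`. No bound is needed there, so a
kernel may be singular at `z = a`. -/
lemma ofReal_le_mul_radialKer {x C r ρ : ℝ} (hC : 0 < C) (hr : 0 < r)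
    (h1 : 2 * r ≤ ρ → x ≤ C * (r / ρ ^ 2))
    (h2 : ρ < 2 * r → ρ ≠ r → x ≤ C * (1 / √(r * |r - ρ|))) :
    ENNReal.ofReal x ≤ ENNReal.ofReal C * radialKer r ρ := by
  rw [radialKer]
  split_ifs with h
  · rw [← ENNReal.ofReal_mul hC.le]
    exact ENNReal.ofReal_le_ofReal (h1 h)
  · rcases eq_or_ne ρ r with hρ | hρ
    · rw [hρ, sub_self, abs_zero, mul_zero, Real.sqrt_zero, ENNReal.ofReal_zero, ENNReal.inv_zero,
        ENNReal.mul_top (by simpa using hC)]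
      exact le_top
    · have : 0 < r * |r - ρ| := mul_pos hr (abs_pos.2 (sub_ne_zero.2 hρ.symm))
      rw [← ENNReal.ofReal_inv_of_pos (Real.sqrt_pos.2 this), ← ENNReal.ofReal_mul hC.le,
        ← one_div]
      exact ENNReal.ofReal_le_ofReal (h2 (not_le.1 h) hρ)

lemma mul_radialKer_le {r ρ R : ℝ} (hr : 0 < r) (hrR : r ≤ R) :
    ENNReal.ofReal r * radialKer r ρ ≤ ENNReal.ofReal √R * (ENNReal.ofReal √|r - ρ|)⁻¹ := by
  have hR : 0 < R := by linarith
  rcases eq_or_ne ρ r with hρ | hρ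
  · rw [hρ, sub_self, abs_zero, Real.sqrt_zero, ENNReal.ofReal_zero, ENNReal.inv_zero,
        ENNReal.mul_top (by simpa using hR)]
    exact le_top
  have h0 : 0 < |r - ρ| := abs_pos.2 (sub_ne_zero.2 hρ.symm)
  have hs := Real.sqrt_pos.2 h0
  rw [← ENNReal.ofReal_inv_of_pos hs, ← ENNReal.ofReal_mul (by positivity), radialKer]
  have hsr : √r ≤ √R := Real.sqrt_le_sqrt hrR
  have hr2 := Real.mul_self_sqrt hr.le
  split_ifs with h
  · rw [← ENNReal.ofReal_mul hr.le]
    refine ENNReal.ofReal_le_ofReal ?_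
    have hρ0 : 0 < ρ := by linarith
    have e1 : √|r - ρ| ≤ √ρ := Real.sqrt_le_sqrt (by rw [abs_of_nonpos (by linarith)]; linarith)
    have e2 : √r ≤ √ρ := Real.sqrt_le_sqrt (by linarith)
    have hp2 := Real.mul_self_sqrt hρ0.le
    rw [← div_eq_mul_inv, ← mul_div_assoc, div_le_div_iff₀ (by positivity) hs]
    have e3 : r ≤ ρ := by linarith
    calc r * r * √|r - ρ| = √r * (√r * √|r - ρ|) * r := by
          nth_rw 1 [← hr2]; ring
      _ ≤ √R * (√ρ * √ρ) * ρ := by gcongr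
      _ = _ := by rw [hp2]; ring
  · rw [← ENNReal.ofReal_inv_of_pos (Real.sqrt_pos.2 (by positivity)), ← ENNReal.ofReal_mul hr.le]
    refine ENNReal.ofReal_le_ofReal ?_
    rw [Real.sqrt_mul hr.le, mul_inv, ← mul_assoc, ← div_eq_mul_inv r, Real.div_sqrt]
    gcongr

/-- The singularity at `r = ρ` is only an inverse square root, hence integrable in `r`. The decay
`ρ⁻²` of the result matches the weights in hypothesis (ii) and in the Blaschke sum. -/
lemma lintegral_mul_radialKer_le {R ρ : ℝ} (hR : 0 < R) (hρ : 0 ≤ ρ) :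
    ∫⁻ r in Set.Ioo 0 R, ENNReal.ofReal r * radialKer r ρ ≤
      ENNReal.ofReal (25 * R ^ 3 / (R ^ 2 + ρ ^ 2)) := by
  rcases le_or_gt (2 * R) ρ with h | h
  · calc ∫⁻ r in Set.Ioo 0 R, ENNReal.ofReal r * radialKer r ρ
        ≤ ∫⁻ _ in Set.Ioo 0 R, ENNReal.ofReal (R ^ 2 / ρ ^ 2) := by
          refine setLIntegral_mono (by fun_prop) fun r hr => ?_
          rw [radialKer, if_pos (by linarith [hr.2]), ← ENNReal.ofReal_mul hr.1.le, ← mul_div_assoc,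
            ← sq]
          have := hr.1.le
          have := hr.2.le
          gcongr
      _ = ENNReal.ofReal (R ^ 3 / ρ ^ 2) := by
          rw [setLIntegral_const, Real.volume_Ioo, ← ENNReal.ofReal_mul (by positivity)]
          congr 1
          ring
      _ ≤ _ := by
          refine ENNReal.ofReal_le_ofReal ?_
          have : 0 < ρ := by linarith
          rw [div_le_div_iff₀ (by positivity) (by positivity)]
          have h3 : 0 < R ^ 3 := by positivity
          have h4 : R ^ 2 + ρ ^ 2 ≤ 25 * ρ ^ 2 := by nlinarith
          nlinarith
  · calc ∫⁻ r in Set.Ioo 0 R, ENNReal.ofReal r * radialKer r ρ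
        ≤ ∫⁻ r in Set.Ioo 0 R, ENNReal.ofReal √R * (ENNReal.ofReal √|r - ρ|)⁻¹ :=
          setLIntegral_mono (by fun_prop) fun r hr => mul_radialKer_le hr.1 hr.2.le
      _ ≤ ENNReal.ofReal √R * ENNReal.ofReal (5 * √(R - 0)) := by
          rw [lintegral_const_mul _ (by fun_prop)]
          gcongr
          exact lintegral_inv_sqrt_abs_sub_le hR ρ
      _ = ENNReal.ofReal (5 * R) := by
          rw [← ENNReal.ofReal_mul (by positivity), sub_zero]
          congr 1
          nlinarith [Real.mul_self_sqrt hR.le]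
      _ ≤ _ := by
          refine ENNReal.ofReal_le_ofReal ?_
          rw [le_div_iff₀ (by positivity)]
          have : ρ ^ 2 ≤ 4 * R ^ 2 := by nlinarith
          nlinarith

/-- After Tonelli and `lintegral_mul_radialKer_le` the integrand is at most `25 / (R² + ρ²)` times
the weight: it tends to zero, and for `R ≥ 1` it is dominated by `25 / (1 + ρ²)` times the weight.
-/
lemma tendsto_lintegral_radialKer {ι : Type*} [MeasurableSpace ι] {μ : Measure ι} [SFinite μ]
    {w : ι → ENNReal} (hw : Measurable w) (hw' : ∀ i, w i ≠ ⊤) {ρ : ι → ℝ} (hρ : Measurable ρ)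
    (hρ0 : ∀ i, 0 ≤ ρ i) (hfin : ∫⁻ i, w i * ENNReal.ofReal (1 / (1 + ρ i ^ 2)) ∂μ ≠ ⊤) :
    Tendsto (fun R : ℝ => ENNReal.ofReal (1 / R ^ 3) *
      ∫⁻ r in Set.Ioo 0 R, ENNReal.ofReal r * ∫⁻ i, w i * radialKer r (ρ i) ∂μ) atTop (𝓝 0) := by
  have hk : Measurable fun q : ℝ × ι => radialKer q.1 (ρ q.2) :=
    measurable_radialKer.comp (measurable_fst.prodMk (hρ.comp measurable_snd))
  have hlim : Tendsto (fun R : ℝ => ∫⁻ i, w i * ENNReal.ofReal (25 / (R ^ 2 + ρ i ^ 2)) ∂μ) atTop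
      (𝓝 (∫⁻ _, 0 ∂μ)) := by
    refine tendsto_lintegral_filter_of_dominated_convergence
      (fun i => 25 * (w i * ENNReal.ofReal (1 / (1 + ρ i ^ 2)))) ?_ ?_ ?_ ?_
    · filter_upwards with R
      fun_prop
    · filter_upwards [eventually_ge_atTop 1] with R hR
      filter_upwards with i
      rw [mul_left_comm, show (25 : ENNReal) = ENNReal.ofReal 25 by simp,
        ← ENNReal.ofReal_mul (by norm_num), mul_one_div]
      have : 1 ≤ R ^ 2 := by nlinarith
      gcongr
    · rw [lintegral_const_mul _ (by fun_prop)]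
      exact ENNReal.mul_ne_top (by simp) hfin
    · filter_upwards with i
      have h1 : Tendsto (fun R : ℝ => 25 / (R ^ 2 + ρ i ^ 2)) atTop (𝓝 0) :=
        tendsto_const_nhds.div_atTop
          (tendsto_atTop_add_const_right _ _ (tendsto_pow_atTop two_ne_zero))
      have h2 := ENNReal.Tendsto.const_mul (a := w i) (ENNReal.tendsto_ofReal h1) (Or.inr (hw' i))
      simpa using h2
  rw [lintegral_zero] at hlim
  refine tendsto_of_tendsto_of_tendsto_of_le_of_le' tendsto_const_nhds hlim
    (Eventually.of_forall fun _ => bot_le) ?_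
  filter_upwards [eventually_gt_atTop 0] with R hR
  calc ENNReal.ofReal (1 / R ^ 3) *
      ∫⁻ r in Set.Ioo 0 R, ENNReal.ofReal r * ∫⁻ i, w i * radialKer r (ρ i) ∂μ
      = ENNReal.ofReal (1 / R ^ 3) *
        ∫⁻ r in Set.Ioo 0 R, ∫⁻ i, ENNReal.ofReal r * (w i * radialKer r (ρ i)) ∂μ := by
        congr 1
        refine lintegral_congr fun r => ?_
        rw [lintegral_const_mul]
        exact hw.mul (hk.comp measurable_prodMk_left)
    _ = ENNReal.ofReal (1 / R ^ 3) *
        ∫⁻ i, (∫⁻ r in Set.Ioo 0 R, ENNReal.ofReal r * (w i * radialKer r (ρ i))) ∂μ := by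
        rw [lintegral_lintegral_swap]
        exact ((ENNReal.measurable_ofReal.comp measurable_fst).mul
          ((hw.comp measurable_snd).mul hk)).aemeasurable
    _ = ∫⁻ i, ENNReal.ofReal (1 / R ^ 3) *
        (w i * ∫⁻ r in Set.Ioo 0 R, ENNReal.ofReal r * radialKer r (ρ i)) ∂μ := by
        rw [← lintegral_const_mul' _ _ ENNReal.ofReal_ne_top]
        refine lintegral_congr fun i => ?_
        rw [← lintegral_const_mul' _ _ (hw' i)]
        congr 1
        exact lintegral_congr fun r => mul_left_comm _ _ _
    _ ≤ _ := by
        refine lintegral_mono fun i => ?_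
        rw [mul_left_comm]
        gcongr
        refine (mul_le_mul_right (lintegral_mul_radialKer_le hR (hρ0 i)) _).trans_eq ?_
        rw [← ENNReal.ofReal_mul (by positivity)]
        congr 1
        field_simp
end

/-! ### Half-plane kernels bounded by the radial kernel. -/

noncomputable section

variable {z : ℂ} {f : ℂ → ℂ}

lemma log_one_add_le_two_mul_sqrt {x : ℝ} (hx : 0 ≤ x) : Real.log (1 + x) ≤ 2 * √x := by
  have h1 : 0 ≤ √x := Real.sqrt_nonneg x
  calc Real.log (1 + x) ≤ Real.log ((1 + √x) ^ 2) :=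
        Real.log_le_log (by linarith) (by nlinarith [Real.sq_sqrt hx])
    _ = 2 * Real.log (1 + √x) := by rw [Real.log_pow]; norm_cast
    _ ≤ 2 * √x := by linarith [Real.log_le_sub_one_of_pos (by linarith : 0 < 1 + √x)]

lemma halfPlaneGreen_le_log {a : ℂ} (hz : 0 < z.im) (ha : 0 ≤ a.im) (hza : z ≠ a) :
    halfPlaneGreen z a ≤ Real.log (1 + 2 * a.im / ‖z - a‖) := by
  have h0 : 0 < ‖z - a‖ := norm_pos_iff.2 (sub_ne_zero.2 hza)
  have h1 : 0 < ‖z - (starRingEnd ℂ) a‖ := norm_pos_iff.2 (sub_conj_ne_zero hz ha)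
  rw [halfPlaneGreen, ← Real.log_div h1.ne' h0.ne']
  refine Real.log_le_log (by positivity) ?_
  rw [div_le_iff₀ h0, add_mul, one_mul, div_mul_cancel₀ _ h0.ne']
  calc ‖z - (starRingEnd ℂ) a‖ = ‖(z - a) + (a - (starRingEnd ℂ) a)‖ := by ring_nf
    _ ≤ ‖z - a‖ + ‖a - (starRingEnd ℂ) a‖ := norm_add_le _ _
    _ = _ := by
      rw [Complex.sub_conj, norm_mul, Complex.norm_I, mul_one, Complex.norm_real,
        Real.norm_of_nonneg (by positivity)]

lemma halfPlaneGreen_le_div {a : ℂ} (hz : 0 < z.im) (ha : 0 ≤ a.im) (hza : z ≠ a) :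
    halfPlaneGreen z a ≤ 2 * a.im * (1 / ‖z - a‖) := by
  have h0 : 0 < ‖z - a‖ := norm_pos_iff.2 (sub_ne_zero.2 hza)
  have h1 : 0 ≤ 2 * a.im / ‖z - a‖ := by positivity
  rw [mul_one_div]
  linarith [halfPlaneGreen_le_log hz ha hza,
    Real.log_le_sub_one_of_pos (by linarith : 0 < 1 + 2 * a.im / ‖z - a‖)]

lemma halfPlaneGreen_le_div_sq {a : ℂ} (hz : 0 < z.im) (ha : 0 ≤ a.im) (hza : z ≠ a) :
    halfPlaneGreen z a ≤ 2 * a.im * (z.im / ‖z - a‖ ^ 2) := by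
  have h0 : 0 < Complex.normSq (z - a) := Complex.normSq_pos.2 (sub_ne_zero.2 hza)
  have h1 : 0 ≤ 4 * (z.im * a.im) := by positivity
  have h2 : 0 < Complex.normSq (z - (starRingEnd ℂ) a) := by rw [normSq_sub_conj]; linarith
  rw [halfPlaneGreen, log_norm_eq_half_log_normSq, log_norm_eq_half_log_normSq, ← mul_sub,
    ← Real.log_div h2.ne' h0.ne', ← Complex.normSq_eq_norm_sq]
  have h3 := Real.log_le_sub_one_of_pos (div_pos h2 h0)
  have h4 : Complex.normSq (z - (starRingEnd ℂ) a) / Complex.normSq (z - a) - 1 =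
      4 * a.im * (z.im / Complex.normSq (z - a)) := by
    rw [normSq_sub_conj]; field_simp; ring
  linarith

/-- Far zeros use the quadratic bound. Among the others, if `Im a` is at least `r sin θ / 4`, then
`log (1 + x) ≤ 2√x` turns the logarithmic singularity into the inverse square root of `radialKer`;
otherwise `a` stays at distance at least `r sin θ / 2` from `z` and there is no singularity. -/
lemma halfPlaneGreen_le_of_sin {r θ : ℝ} (hr : 0 < r) (hθ : 0 < Real.sin θ) {a : ℂ} (ha : 0 < a.im) :
    ENNReal.ofReal (halfPlaneGreen (circleMap 0 r θ) a) ≤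
      ENNReal.ofReal (16 / Real.sin θ * a.im) * radialKer r ‖a‖ := by
  set s := Real.sin θ with hs
  have hs1 : s ≤ 1 := Real.sin_le_one θ
  set z := circleMap 0 r θ with hz
  have hy : z.im = r * s := circleMap_zero_im r θ
  have hn : ‖z‖ = r := by rw [hz, norm_circleMap_zero, abs_of_pos hr]
  have hz0 : 0 < z.im := by rw [hy]; positivity
  have h16 : 16 ≤ 16 / s := by rw [le_div_iff₀ hθ]; linarith
  have hd : |r - ‖a‖| ≤ ‖z - a‖ := by rw [← hn]; exact abs_norm_sub_norm_le z a
  refine ofReal_le_mul_radialKer (by positivity) hr (fun h => ?_) fun h hne => ?_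
  · have h1 : ‖a‖ / 2 ≤ ‖z - a‖ := by rw [abs_sub_comm] at hd; linarith [le_abs_self (‖a‖ - r)]
    have hρ : 0 < ‖a‖ := by linarith
    have hza : z ≠ a := by intro e; rw [e, sub_self, norm_zero] at h1; linarith
    calc halfPlaneGreen z a ≤ 2 * a.im * (z.im / ‖z - a‖ ^ 2) := halfPlaneGreen_le_div_sq hz0 ha.le hza
      _ ≤ 2 * a.im * (r / (‖a‖ / 2) ^ 2) := by
          gcongr
          rw [hy]; nlinarith
      _ = 8 * a.im * (r / ‖a‖ ^ 2) := by field_simp; norm_num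
      _ ≤ 16 / s * a.im * (r / ‖a‖ ^ 2) := by gcongr; linarith
  · have hq : 0 < |r - ‖a‖| := abs_pos.2 (sub_ne_zero.2 hne.symm)
    have hd0 : 0 < ‖z - a‖ := hq.trans_le hd
    have hza : z ≠ a := by intro e; rw [e, sub_self, norm_zero] at hd0; exact lt_irrefl _ hd0
    have hsq : 0 < √(r * |r - ‖a‖|) := Real.sqrt_pos.2 (by positivity)
    rcases le_or_gt (s * r) (4 * a.im) with hb | hb
    · have h1 := (halfPlaneGreen_le_log hz0 ha.le hza).trans
        (log_one_add_le_two_mul_sqrt (by positivity))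
      have h2 : 2 * a.im / ‖z - a‖ ≤ (8 / s * a.im / √(r * |r - ‖a‖|)) ^ 2 := by
        rw [div_pow, Real.sq_sqrt (by positivity), div_le_div_iff₀ hd0 (by positivity)]
        have e1 : 2 * r ≤ (8 / s) ^ 2 * a.im := by
          rw [div_pow, div_mul_eq_mul_div, le_div_iff₀ (by positivity)]
          nlinarith
        calc 2 * a.im * (r * |r - ‖a‖|) = a.im * (2 * r) * |r - ‖a‖| := by ring
          _ ≤ a.im * ((8 / s) ^ 2 * a.im) * ‖z - a‖ := by gcongr
          _ = _ := by ring
      have h3 := Real.sqrt_le_sqrt h2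
      rw [Real.sqrt_sq (by positivity)] at h3
      calc halfPlaneGreen z a ≤ 2 * (8 / s * a.im / √(r * |r - ‖a‖|)) := by linarith
        _ = _ := by ring
    · have h1 : s * r / 2 ≤ ‖z - a‖ := by
        have := (le_abs_self _).trans (Complex.abs_im_le_norm (z - a))
        rw [Complex.sub_im, hy] at this
        nlinarith
      have h2 : √(r * |r - ‖a‖|) ≤ r := by
        rw [Real.sqrt_le_left hr.le, sq]
        gcongr
        rw [abs_le]
        constructor <;> linarith [norm_nonneg a]
      calc halfPlaneGreen z a ≤ 2 * a.im * (1 / ‖z - a‖) := halfPlaneGreen_le_div hz0 ha.le hza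
        _ ≤ 2 * a.im * (1 / (s * r / 2)) := by gcongr
        _ = 4 / s * a.im * (1 / r) := by field_simp; norm_num
        _ ≤ 16 / s * a.im * (1 / √(r * |r - ‖a‖|)) := by gcongr; norm_num

lemma poissonKer_le_of_sin {r θ : ℝ} (hr : 0 < r) (hθ : 0 < Real.sin θ) (t : ℝ) :
    ENNReal.ofReal ((circleMap 0 r θ).im / Real.pi *
      (1 / Complex.normSq (t - circleMap 0 r θ))) ≤
      ENNReal.ofReal (16 / Real.sin θ) * radialKer r |t| := by
  set s := Real.sin θ with hs
  have hs1 : s ≤ 1 := Real.sin_le_one θ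
  set z := circleMap 0 r θ with hz
  have hy : z.im = r * s := circleMap_zero_im r θ
  have hn : ‖z‖ = r := by rw [hz, norm_circleMap_zero, abs_of_pos hr]
  have hz0 : 0 < z.im := by rw [hy]; positivity
  have h16 : 16 ≤ 16 / s := by rw [le_div_iff₀ hθ]; linarith
  have hpi : 1 ≤ Real.pi := by linarith [Real.pi_gt_three]
  have hx : z.im / Real.pi * (1 / Complex.normSq (t - z)) ≤ z.im * (1 / ‖t - z‖ ^ 2) := by
    rw [← Complex.normSq_eq_norm_sq]
    have := normSq_ofReal_sub_pos hz0 t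
    gcongr
    exact div_le_self hz0.le hpi
  refine ofReal_le_mul_radialKer (by positivity) hr (fun h => hx.trans ?_)
    fun h hne => hx.trans ?_
  · have h1 : |t| / 2 ≤ ‖t - z‖ := by
      have := norm_sub_norm_le (t : ℂ) z
      rw [hn, Complex.norm_real, Real.norm_eq_abs] at this
      linarith
    have hρ : 0 < |t| := by linarith
    calc z.im * (1 / ‖t - z‖ ^ 2) ≤ r * (1 / (|t| / 2) ^ 2) := by
          gcongr
          rw [hy]; nlinarith
      _ = 4 * (r / |t| ^ 2) := by field_simp; norm_num
      _ ≤ 16 / s * (r / |t| ^ 2) := by gcongr; linarith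
  · have hq : 0 < (abs (r - |t|)) := abs_pos.2 (sub_ne_zero.2 hne.symm)
    have hsq : 0 < √(r * (abs (r - |t|))) := Real.sqrt_pos.2 (by positivity)
    have h1 : z.im ≤ ‖t - z‖ := by
      have := (neg_le_abs _).trans (Complex.abs_im_le_norm (t - z))
      simpa using this
    have h2 : √(r * (abs (r - |t|))) ≤ r := by
      rw [Real.sqrt_le_left hr.le, sq]
      gcongr
      rw [abs_le]
      constructor <;> linarith [abs_nonneg t]
    calc z.im * (1 / ‖t - z‖ ^ 2) ≤ z.im * (1 / z.im ^ 2) := by gcongr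
      _ = 1 / s * (1 / r) := by rw [hy]; field_simp
      _ ≤ 16 / s * (1 / √(r * (abs (r - |t|)))) := by gcongr; norm_num

/-- Moving `p` radially onto the circle of radius `r` at most doubles its distance to the point,
because the radial shift is itself at most that distance. On the circle, Jordan's inequality
compares chord and arc. -/
lemma mul_abs_arg_sub_le {r θ : ℝ} (hr : 0 < r) (hθ : θ ∈ Set.Ioo 0 Real.pi) {p : ℂ} (hp : 0 ≤ p.im) :
    r / Real.pi * |θ - p.arg| ≤ ‖circleMap 0 r θ - p‖ := by
  have hpi := Real.pi_pos
  have ha0 : 0 ≤ p.arg := Complex.arg_nonneg_iff.2 hp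
  have ha1 := Complex.arg_le_pi p
  set z := circleMap 0 r θ with hz
  have hn : ‖z‖ = r := by rw [hz, norm_circleMap_zero, abs_of_pos hr]
  have h1 : ‖z - r * Complex.exp (p.arg * Complex.I)‖ ≤ 2 * ‖z - p‖ := by
    have e : z - r * Complex.exp (p.arg * Complex.I) =
        (z - p) + ((‖p‖ - ‖z‖ : ℝ) : ℂ) * Complex.exp (p.arg * Complex.I) := by
      rw [hn]
      nth_rw 2 [← Complex.norm_mul_exp_arg_mul_I p]
      push_cast
      ring
    rw [e]
    refine (norm_add_le _ _).trans ?_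
    rw [norm_mul, Complex.norm_exp_ofReal_mul_I, mul_one, Complex.norm_real, Real.norm_eq_abs,
      abs_sub_comm]
    linarith [abs_norm_sub_norm_le z p]
  have h2 : z - r * Complex.exp (p.arg * Complex.I) =
      r * Complex.exp (p.arg * Complex.I) * (Complex.exp (Complex.I * ((θ - p.arg : ℝ) : ℂ)) - 1) := by
    rw [hz, circleMap_zero, mul_sub, mul_one, mul_assoc, ← Complex.exp_add]
    push_cast
    ring_nf
  have h3 : 2 / Real.pi * |θ - p.arg| ≤ ‖Complex.exp (Complex.I * ((θ - p.arg : ℝ) : ℂ)) - 1‖ := by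
    rw [Complex.norm_exp_I_mul_ofReal_sub_one, norm_mul, Real.norm_eq_abs, Real.norm_eq_abs, abs_two]
    have hle : |(θ - p.arg) / 2| ≤ Real.pi / 2 := by
      rw [abs_le]; constructor <;> linarith [hθ.1, hθ.2]
    have := Real.mul_abs_le_abs_sin hle
    rw [abs_div, abs_two] at this
    calc 2 / Real.pi * |θ - p.arg| = 2 * (2 / Real.pi * (|θ - p.arg| / 2)) := by ring
      _ ≤ _ := by gcongr
  rw [h2, norm_mul, norm_mul, Complex.norm_exp_ofReal_mul_I, mul_one, Complex.norm_real,
    Real.norm_of_nonneg hr.le] at h1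
  have h4 := mul_le_mul_of_nonneg_left h3 hr.le
  calc r / Real.pi * |θ - p.arg| = r * (2 / Real.pi * |θ - p.arg|) / 2 := by ring
    _ ≤ _ := by linarith

/-- The distance to `p` dominates both `|r - ‖p‖|` and `r |θ - arg p| / π`, hence their geometric
mean. This splits `1/‖z - p‖` into the radial kernel times `1/√|θ - arg p|`, which is integrable in
`θ`. No factor `1/sin θ` appears, so the bound covers the whole half-circle. -/
lemma lintegral_angle_le {r c : ℝ} (hr : 0 < r) (hc : 0 < c) {p : ℂ} (hp : 0 ≤ p.im) {x : ℝ → ℝ}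
    (h1 : ∀ θ ∈ Set.Ioo 0 Real.pi, circleMap 0 r θ ≠ p → x θ ≤ c * (1 / ‖circleMap 0 r θ - p‖))
    (h2 : ∀ θ ∈ Set.Ioo 0 Real.pi, circleMap 0 r θ ≠ p →
      x θ ≤ c * (r / ‖circleMap 0 r θ - p‖ ^ 2)) :
    ∫⁻ θ in Set.Ioo 0 Real.pi, ENNReal.ofReal (x θ) ≤
      ENNReal.ofReal (5 * Real.pi * c) * radialKer r ‖p‖ := by
  have hpi := Real.pi_pos
  have hn : ∀ θ, ‖circleMap 0 r θ‖ = r := fun θ => by rw [norm_circleMap_zero, abs_of_pos hr]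
  have hd : ∀ θ, |r - ‖p‖| ≤ ‖circleMap 0 r θ - p‖ := fun θ => by
    have := abs_norm_sub_norm_le (circleMap 0 r θ) p
    rwa [hn] at this
  rw [radialKer]
  split_ifs with h
  · have hρ : 0 < ‖p‖ := by linarith
    calc ∫⁻ θ in Set.Ioo 0 Real.pi, ENNReal.ofReal (x θ)
        ≤ ∫⁻ _ in Set.Ioo 0 Real.pi, ENNReal.ofReal (4 * c * (r / ‖p‖ ^ 2)) := by
          refine setLIntegral_mono measurable_const fun θ hθ => ENNReal.ofReal_le_ofReal ?_
          have e1 : ‖p‖ / 2 ≤ ‖circleMap 0 r θ - p‖ := by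
            have := hd θ
            rw [abs_sub_comm] at this
            linarith [le_abs_self (‖p‖ - r)]
          have hza : circleMap 0 r θ ≠ p := by
            intro e; rw [e, sub_self, norm_zero] at e1; linarith
          calc x θ ≤ c * (r / ‖circleMap 0 r θ - p‖ ^ 2) := h2 θ hθ hza
            _ ≤ c * (r / (‖p‖ / 2) ^ 2) := by gcongr
            _ = _ := by field_simp; norm_num
      _ = ENNReal.ofReal (4 * Real.pi * c * (r / ‖p‖ ^ 2)) := by
          rw [setLIntegral_const, Real.volume_Ioo, ← ENNReal.ofReal_mul (by positivity)]
          congr 1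
          ring
      _ ≤ _ := by
          rw [← ENNReal.ofReal_mul (by positivity)]
          refine ENNReal.ofReal_le_ofReal ?_
          gcongr
          norm_num
  · rcases eq_or_ne ‖p‖ r with hρ | hρ
    · rw [hρ, sub_self, abs_zero, mul_zero, Real.sqrt_zero, ENNReal.ofReal_zero, ENNReal.inv_zero,
        ENNReal.mul_top (by simp; positivity)]
      exact le_top
    have hq : 0 < |r - ‖p‖| := abs_pos.2 (sub_ne_zero.2 hρ.symm)
    have hs : 0 < √(r * |r - ‖p‖|) := Real.sqrt_pos.2 (by positivity)
    calc ∫⁻ θ in Set.Ioo 0 Real.pi, ENNReal.ofReal (x θ)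
        ≤ ∫⁻ θ in Set.Ioo 0 Real.pi, ENNReal.ofReal (c * √Real.pi / √(r * |r - ‖p‖|)) *
            (ENNReal.ofReal √|θ - p.arg|)⁻¹ := by
          refine setLIntegral_mono (by fun_prop) fun θ hθ => ?_
          rcases eq_or_ne θ p.arg with ht | ht
          · rw [ht, sub_self, abs_zero, Real.sqrt_zero, ENNReal.ofReal_zero, ENNReal.inv_zero,
              ENNReal.mul_top (by simp; positivity)]
            exact le_top
          have hθ0 : 0 < |θ - p.arg| := abs_pos.2 (sub_ne_zero.2 ht)
          have hst := Real.sqrt_pos.2 hθ0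
          rw [← ENNReal.ofReal_inv_of_pos hst, ← ENNReal.ofReal_mul (by positivity)]
          refine ENNReal.ofReal_le_ofReal ?_
          have hd0 : 0 < ‖circleMap 0 r θ - p‖ := hq.trans_le (hd θ)
          have hza : circleMap 0 r θ ≠ p := by
            intro e; rw [e, sub_self, norm_zero] at hd0; exact lt_irrefl _ hd0
          have e1 : √(r * |r - ‖p‖|) * √|θ - p.arg| ≤ √Real.pi * ‖circleMap 0 r θ - p‖ := by
            rw [← Real.sqrt_mul (by positivity)]
            refine Real.sqrt_le_iff.2 ⟨by positivity, ?_⟩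
            rw [mul_pow, Real.sq_sqrt hpi.le]
            have e2 := mul_abs_arg_sub_le hr hθ hp
            calc r * |r - ‖p‖| * |θ - p.arg|
                = Real.pi * (|r - ‖p‖| * (r / Real.pi * |θ - p.arg|)) := by field_simp
              _ ≤ Real.pi * (‖circleMap 0 r θ - p‖ * ‖circleMap 0 r θ - p‖) := by
                  gcongr
                  exact hd θ
              _ = _ := by ring
          refine (h1 θ hθ hza).trans ?_
          rw [← div_eq_mul_inv, div_div, mul_one_div, div_le_div_iff₀ hd0 (by positivity)]
          calc _ ≤ c * (√Real.pi * ‖circleMap 0 r θ - p‖) := by gcongr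
            _ = _ := by ring
      _ ≤ ENNReal.ofReal (c * √Real.pi / √(r * |r - ‖p‖|)) *
            ENNReal.ofReal (5 * √(Real.pi - 0)) := by
          rw [lintegral_const_mul _ (by fun_prop)]
          gcongr
          exact lintegral_inv_sqrt_abs_sub_le hpi _
      _ = _ := by
          rw [← ENNReal.ofReal_inv_of_pos hs, ← ENNReal.ofReal_mul (by positivity),
            ← ENNReal.ofReal_mul (by positivity), sub_zero]
          congr 1
          have := Real.mul_self_sqrt hpi.le
          rw [div_mul_eq_mul_div, div_eq_mul_inv]
          congr 1
          calc c * √Real.pi * (5 * √Real.pi) = 5 * (√Real.pi * √Real.pi) * c := by ring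
            _ = _ := by rw [this]

lemma lintegral_halfPlaneGreen_le {r : ℝ} (hr : 0 < r) {a : ℂ} (ha : 0 < a.im) :
    ∫⁻ θ in Set.Ioo 0 Real.pi, ENNReal.ofReal (halfPlaneGreen (circleMap 0 r θ) a) ≤
      ENNReal.ofReal (5 * Real.pi * (2 * a.im)) * radialKer r ‖a‖ := by
  have him : ∀ θ ∈ Set.Ioo 0 Real.pi, 0 < (circleMap 0 r θ).im ∧ (circleMap 0 r θ).im ≤ r :=
    fun θ hθ => by
      rw [circleMap_zero_im]
      exact ⟨mul_pos hr (Real.sin_pos_of_mem_Ioo hθ),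
        mul_le_of_le_one_right hr.le (Real.sin_le_one θ)⟩
  refine lintegral_angle_le hr (by positivity) ha.le
    (fun θ hθ h => halfPlaneGreen_le_div (him θ hθ).1 ha.le h) fun θ hθ h => ?_
  refine (halfPlaneGreen_le_div_sq (him θ hθ).1 ha.le h).trans ?_
  gcongr
  exact (him θ hθ).2

lemma lintegral_poissonKer_le {r : ℝ} (hr : 0 < r) (t : ℝ) :
    ∫⁻ θ in Set.Ioo 0 Real.pi, ENNReal.ofReal ((circleMap 0 r θ).im / Real.pi *
      (1 / Complex.normSq (t - circleMap 0 r θ))) ≤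
      ENNReal.ofReal (5 * Real.pi * 1) * radialKer r |t| := by
  have hpi : 1 ≤ Real.pi := by linarith [Real.pi_gt_three]
  have him : ∀ θ ∈ Set.Ioo 0 Real.pi, 0 < (circleMap 0 r θ).im ∧ (circleMap 0 r θ).im ≤ r :=
    fun θ hθ => by
      rw [circleMap_zero_im]
      exact ⟨mul_pos hr (Real.sin_pos_of_mem_Ioo hθ),
        mul_le_of_le_one_right hr.le (Real.sin_le_one θ)⟩
  have hx : ∀ θ ∈ Set.Ioo 0 Real.pi, (circleMap 0 r θ).im / Real.pi *
      (1 / Complex.normSq (t - circleMap 0 r θ)) ≤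
        (circleMap 0 r θ).im / ‖circleMap 0 r θ - t‖ ^ 2 := fun θ hθ => by
    rw [norm_sub_rev, ← Complex.normSq_eq_norm_sq, mul_one_div]
    have := normSq_ofReal_sub_pos (him θ hθ).1 t
    gcongr
    exact div_le_self (him θ hθ).1.le hpi
  have := lintegral_angle_le (p := t) hr one_pos (by simp) (x := fun θ =>
    (circleMap 0 r θ).im / Real.pi * (1 / Complex.normSq (t - circleMap 0 r θ)))
    (fun θ hθ h => (hx θ hθ).trans ?_) fun θ hθ h => (hx θ hθ).trans ?_
  · rwa [Complex.norm_real, Real.norm_eq_abs] at this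
  · have h1 : (circleMap 0 r θ).im ≤ ‖circleMap 0 r θ - t‖ := by
      have := (le_abs_self _).trans (Complex.abs_im_le_norm (circleMap 0 r θ - t))
      simpa using this
    have h0 : 0 < ‖circleMap 0 r θ - t‖ := (him θ hθ).1.trans_le h1
    rw [one_mul, div_le_div_iff₀ (by positivity) h0, sq, one_mul]
    gcongr
  · rw [one_mul]
    gcongr
    exact (him θ hθ).2
end

/-! ### The error terms are small on average. -/

noncomputable section

variable {z : ℂ} {f : ℂ → ℂ}

lemma countable_upperZeros (hf : AnalyticOnNhd ℂ f {z : ℂ | 0 ≤ z.im}) (hf0 : f 0 ≠ 0) :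
    (upperZeros f).Countable := by
  refine (Set.countable_iUnion fun n : ℕ => (finite_zeros_of_isCompact hf hf0
    (isCompact_closedHalfDisc n) fun z hz => hz.1).countable).mono fun a ha => ?_
  obtain ⟨n, hn⟩ := exists_nat_ge ‖a‖
  exact Set.mem_iUnion.2 ⟨n, ⟨ha.1.le, hn⟩, ha.2⟩

/-- A radial majorant of the Poisson integral of `|log ‖f‖|` and of the Green potential of the
zeros of `f`. -/
def radialMajorant (f : ℂ → ℂ) (r : ℝ) : ENNReal :=
  (∫⁻ t : ℝ, ‖Real.log ‖f t‖‖ₑ * radialKer r |t|) +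
    ∑' a : upperZeros f, ENNReal.ofReal (analyticOrderNatAt f a * (a : ℂ).im) * radialKer r ‖(a : ℂ)‖

lemma lineMajorant_add_greenPotential_le {r θ : ℝ} (hr : 0 < r) (hθ : 0 < Real.sin θ) :
    lineMajorant f (circleMap 0 r θ) + greenPotential f (circleMap 0 r θ) ≤
      ENNReal.ofReal (16 / Real.sin θ) * radialMajorant f r := by
  rw [radialMajorant, mul_add]
  refine add_le_add ?_ ?_
  · rw [lineMajorant, ← lintegral_const_mul' _ _ ENNReal.ofReal_ne_top]
    refine lintegral_mono fun t => ?_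
    rw [mul_left_comm]
    gcongr
    exact poissonKer_le_of_sin hr hθ t
  · rw [greenPotential, ← ENNReal.tsum_mul_left]
    refine ENNReal.tsum_le_tsum fun a => ?_
    rw [ENNReal.ofReal_mul (Nat.cast_nonneg _)]
    refine (mul_le_mul_right (halfPlaneGreen_le_of_sin hr hθ a.2.1) _).trans_eq ?_
    rw [ENNReal.ofReal_mul (by positivity), ENNReal.ofReal_mul (Nat.cast_nonneg _)]
    ring

lemma measurable_log_mul_poissonKer (hf : AnalyticOnNhd ℂ f {z : ℂ | 0 ≤ z.im}) (r : ℝ) :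
    Measurable fun q : ℝ × ℝ => ‖Real.log ‖f q.2‖‖ₑ * ENNReal.ofReal ((circleMap 0 r q.1).im / Real.pi *
      (1 / Complex.normSq (q.2 - circleMap 0 r q.1))) := by
  have h1 := ((measurable_log_norm_ofReal hf).comp (measurable_snd (α := ℝ))).enorm
  have h2 : Continuous fun q : ℝ × ℝ => Complex.normSq (q.2 - circleMap 0 r q.1) :=
    Complex.continuous_normSq.comp (by fun_prop)
  have h3 : Continuous fun q : ℝ × ℝ => (circleMap 0 r q.1).im := by fun_prop
  exact h1.mul (ENNReal.measurable_ofReal.comp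
    ((h3.measurable.div_const _).mul (measurable_const.div h2.measurable)))

lemma lintegral_lineMajorant_add_greenPotential_le (hf : AnalyticOnNhd ℂ f {z : ℂ | 0 ≤ z.im})
    (hf0 : f 0 ≠ 0) {r : ℝ} (hr : 0 < r) :
    ∫⁻ θ in Set.Ioo 0 Real.pi,
        (lineMajorant f (circleMap 0 r θ) + greenPotential f (circleMap 0 r θ)) ≤
      ENNReal.ofReal (10 * Real.pi) * radialMajorant f r := by
  have := (countable_upperZeros hf hf0).to_subtype
  have hm := measurable_log_mul_poissonKer hf r
  have hpi := Real.pi_pos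
  have hq : Measurable fun θ => lineMajorant f (circleMap 0 r θ) := hm.lintegral_prod_right'
  rw [lintegral_add_left hq, radialMajorant, mul_add]
  refine add_le_add ?_ ?_
  · simp only [lineMajorant]
    rw [lintegral_lintegral_swap hm.aemeasurable, ← lintegral_const_mul' _ _ ENNReal.ofReal_ne_top]
    refine lintegral_mono fun t => ?_
    rw [lintegral_const_mul' _ _ enorm_ne_top, mul_left_comm]
    gcongr
    refine (lintegral_poissonKer_le hr t).trans ?_
    rw [mul_one]
    gcongr
    norm_num
  · simp only [greenPotential]
    rw [lintegral_tsum, ← ENNReal.tsum_mul_left]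
    · refine ENNReal.tsum_le_tsum fun a => ?_
      simp_rw [ENNReal.ofReal_mul (Nat.cast_nonneg (analyticOrderNatAt f a))]
      rw [lintegral_const_mul' _ _ ENNReal.ofReal_ne_top]
      refine (mul_le_mul_right (lintegral_halfPlaneGreen_le hr a.2.1) _).trans_eq ?_
      rw [show 5 * Real.pi * (2 * (a : ℂ).im) = 10 * Real.pi * (a : ℂ).im by ring,
        ENNReal.ofReal_mul (by positivity)]
      ring
    · intro a
      unfold halfPlaneGreen
      have h1 : Continuous fun θ : ℝ => circleMap 0 r θ := by fun_prop
      refine Measurable.aemeasurable ?_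
      refine ENNReal.measurable_ofReal.comp (Measurable.const_mul (Measurable.sub ?_ ?_) _) <;>
      exact Real.measurable_log.comp (h1.sub continuous_const).norm.measurable

lemma measurable_lintegral_radialKer (hf : AnalyticOnNhd ℂ f {z : ℂ | 0 ≤ z.im}) :
    Measurable fun r => ∫⁻ t : ℝ, ‖Real.log ‖f t‖‖ₑ * radialKer r |t| := by
  have : Measurable fun q : ℝ × ℝ => ‖Real.log ‖f q.2‖‖ₑ * radialKer q.1 |q.2| :=
    ((measurable_log_norm_ofReal hf).comp measurable_snd).enorm.mul
      (measurable_radialKer.comp (measurable_fst.prodMk measurable_snd.abs))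
  exact this.lintegral_prod_right'

/-- `tendsto_lintegral_radialKer` is used twice: with Lebesgue measure and weight `|log ‖f(t)‖|`,
where finiteness is hypothesis (ii), and with counting measure on the zeros and weight `m Im a`,
where finiteness is the Blaschke condition. -/
lemma tendsto_lintegral_radialMajorant (hf : AnalyticOnNhd ℂ f {z : ℂ | 0 ≤ z.im}) (hf0 : f 0 ≠ 0)
    (hlog : Integrable (fun t : ℝ => Real.log ‖f (t : ℂ)‖ / (1 + t ^ 2)))
    (hsum : Summable (fun a : upperZeros f =>
        (analyticOrderNatAt f a : ℝ) * ((a : ℂ).im / (1 + ‖(a : ℂ)‖ ^ 2)))) :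
    Tendsto (fun R : ℝ => ENNReal.ofReal (1 / R ^ 3) *
      ∫⁻ r in Set.Ioo 0 R, ENNReal.ofReal r * radialMajorant f r) atTop (𝓝 0) := by
  have := (countable_upperZeros hf hf0).to_subtype
  have h1 := tendsto_lintegral_radialKer (μ := volume) (measurable_log_norm_ofReal hf).enorm
    (fun _ => enorm_ne_top) (ρ := fun t : ℝ => |t|) (by fun_prop) (fun _ => abs_nonneg _) (by
      refine ne_of_eq_of_ne (lintegral_congr fun t => ?_) hlog.2.ne
      rw [sq_abs, ← Real.enorm_of_nonneg (by positivity), ← enorm_mul, mul_one_div])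
  have h2 := tendsto_lintegral_radialKer (ι := upperZeros f) (μ := Measure.count)
    (w := fun a => ENNReal.ofReal (analyticOrderNatAt f a * (a : ℂ).im)) (measurable_of_countable _)
    (fun _ => ENNReal.ofReal_ne_top) (ρ := fun a => ‖(a : ℂ)‖) (measurable_of_countable _)
    (fun _ => norm_nonneg _) (by
      rw [lintegral_count]
      refine ne_of_eq_of_ne (tsum_congr fun a => ?_) hsum.tsum_ofReal_ne_top
      have := a.2.1
      rw [← ENNReal.ofReal_mul (by positivity)]
      congr 1
      ring)
  have h3 := h1.add h2
  rw [add_zero] at h3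
  refine h3.congr fun R => ?_
  have hm : Measurable fun r => ENNReal.ofReal r * ∫⁻ t : ℝ, ‖Real.log ‖f t‖‖ₑ * radialKer r |t| :=
    ENNReal.measurable_ofReal.mul (measurable_lintegral_radialKer hf)
  rw [← mul_add, ← lintegral_add_left hm]
  congr 1
  refine lintegral_congr fun r => ?_
  rw [lintegral_count, radialMajorant, mul_add]

/-- On a fixed ray `|t - z|² ≥ (sin² θ / 2)(r² + t²)`. The kernel divided by `r` is then dominated
by a multiple of `1/(1 + t²)` and tends to zero pointwise, so this term needs no averaging. -/
lemma tendsto_linePoisson_div (hf : AnalyticOnNhd ℂ f {z : ℂ | 0 ≤ z.im})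
    (hlog : Integrable (fun t : ℝ => Real.log ‖f (t : ℂ)‖ / (1 + t ^ 2))) {θ : ℝ}
    (hθ : 0 < Real.sin θ) :
    Tendsto (fun r : ℝ => linePoisson f (circleMap 0 r θ) / r) atTop (𝓝 0) := by
  set s := Real.sin θ with hs
  have hpi := Real.pi_pos
  have key : ∀ r t : ℝ, s ^ 2 / 2 * (r ^ 2 + t ^ 2) ≤ Complex.normSq (t - circleMap 0 r θ) :=
    fun r t => by
      have e : Complex.normSq (t - circleMap 0 r θ) = (t - r * Real.cos θ) ^ 2 + (r * s) ^ 2 := by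
        rw [Complex.normSq_apply, Complex.sub_re, Complex.sub_im, circleMap_zero_re,
          circleMap_zero_im, Complex.ofReal_re, Complex.ofReal_im]
        ring
      have hc : Real.cos θ ^ 2 = 1 - s ^ 2 := by rw [hs]; exact Real.cos_sq' θ
      have hs2 : s ^ 2 = 1 - Real.cos θ ^ 2 := by rw [hc]; ring
      rw [e, mul_pow, hs2]
      nlinarith [sq_nonneg (t - Real.cos θ * r), sq_nonneg (Real.cos θ * t - r)]
  have hmeas := measurable_log_norm_ofReal hf
  have h : Tendsto (fun r : ℝ => ∫ t : ℝ, Real.log ‖f t‖ *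
      (s / Real.pi * (1 / Complex.normSq (t - circleMap 0 r θ)))) atTop (𝓝 (∫ _ : ℝ, (0 : ℝ))) := by
    refine tendsto_integral_filter_of_dominated_convergence
      (fun t => 2 / s ^ 2 * (s / Real.pi) * |Real.log ‖f t‖ / (1 + t ^ 2)|) ?_ ?_
      (hlog.abs.const_mul _) ?_
    · filter_upwards with r
      refine (hmeas.mul (Measurable.const_mul (measurable_const.div ?_) _)).aestronglyMeasurable
      exact (Complex.continuous_normSq.comp (by fun_prop)).measurable
    · filter_upwards [eventually_ge_atTop 1] with r hr
      filter_upwards with t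
      have hp : 0 < s ^ 2 / 2 * (1 + t ^ 2) := by positivity
      have h1 : s ^ 2 / 2 * (1 + t ^ 2) ≤ Complex.normSq (t - circleMap 0 r θ) := by
        refine le_trans ?_ (key r t)
        have : 1 ≤ r ^ 2 := by nlinarith
        gcongr
      have h2 := hp.trans_le h1
      rw [norm_mul, Real.norm_eq_abs, Real.norm_of_nonneg (by positivity), abs_div,
        abs_of_pos (by positivity : 0 < 1 + t ^ 2)]
      calc |Real.log ‖f t‖| * (s / Real.pi * (1 / Complex.normSq (t - circleMap 0 r θ)))
          ≤ |Real.log ‖f t‖| * (s / Real.pi * (1 / (s ^ 2 / 2 * (1 + t ^ 2)))) := by gcongr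
        _ = _ := by field_simp
    · filter_upwards with t
      have h1 : Tendsto (fun r : ℝ => Complex.normSq (t - circleMap 0 r θ)) atTop atTop := by
        refine tendsto_atTop_mono (fun r => key r t) ?_
        exact (tendsto_atTop_add_const_right _ _ (tendsto_pow_atTop two_ne_zero)).const_mul_atTop
          (by positivity)
      have h2 := ((tendsto_const_nhds (x := (1 : ℝ))).div_atTop h1).const_mul (s / Real.pi)
      simpa using h2.const_mul (Real.log ‖f t‖)
  rw [integral_zero] at h
  refine h.congr' ?_
  filter_upwards [eventually_gt_atTop 0] with r hr
  rw [linePoisson, ← integral_div]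
  refine integral_congr_ae (Eventually.of_forall fun t => ?_)
  show _ = _ / r
  rw [circleMap_zero_im, ← hs]
  field_simp
end

/-! ### The indicator, and Tauberian steps for monotone functions. -/

noncomputable section

variable {f : ℂ → ℂ} {k : ℝ}

/-- Were `Λ(r) ≥ ε r` on the whole window, the integral up to `(1 + δ) R` would be at least `ε δ
R³`, and the normalised average at least the fixed number `ε δ / (1 + δ)³`. -/
lemma eventually_not_ae_le_of_tendsto {Λ : ℝ → ENNReal}
    (hΛ : Tendsto (fun R : ℝ => ENNReal.ofReal (1 / R ^ 3) *
      ∫⁻ r in Set.Ioo 0 R, ENNReal.ofReal r * Λ r) atTop (𝓝 0)) {ε δ : ℝ} (hε : 0 < ε) (hδ : 0 < δ) :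
    ∀ᶠ R : ℝ in atTop,
      ¬ ∀ᵐ r, r ∈ Set.Ioo R ((1 + δ) * R) → ENNReal.ofReal (ε * r) ≤ Λ r := by
  have hT : Tendsto (fun R : ℝ => (1 + δ) * R) atTop atTop :=
    tendsto_id.const_mul_atTop (by positivity)
  have h0 : 0 < ENNReal.ofReal (ε * δ / (1 + δ) ^ 3) := ENNReal.ofReal_pos.2 (by positivity)
  filter_upwards [(hΛ.comp hT).eventually_lt_const h0, eventually_gt_atTop 0] with R hR hR0 hae
  refine absurd hR (not_lt.2 ?_)
  have h1 : ENNReal.ofReal (ε * R ^ 2) * ENNReal.ofReal (δ * R) ≤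
      ∫⁻ r in Set.Ioo 0 ((1 + δ) * R), ENNReal.ofReal r * Λ r := by
    calc ENNReal.ofReal (ε * R ^ 2) * ENNReal.ofReal (δ * R)
        = ∫⁻ _ in Set.Ioo R ((1 + δ) * R), ENNReal.ofReal (ε * R ^ 2) := by
          rw [setLIntegral_const, Real.volume_Ioo]
          congr 2
          ring
      _ ≤ ∫⁻ r in Set.Ioo R ((1 + δ) * R), ENNReal.ofReal r * Λ r := by
          refine lintegral_mono_ae ?_
          filter_upwards [ae_restrict_of_ae hae, ae_restrict_mem measurableSet_Ioo] with r h1 h2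
          have hr : 0 < r := hR0.trans h2.1
          refine le_trans ?_ (mul_le_mul_right (h1 h2) _)
          rw [← ENNReal.ofReal_mul hr.le]
          refine ENNReal.ofReal_le_ofReal ?_
          have : R ^ 2 ≤ r ^ 2 := pow_le_pow_left₀ hR0.le h2.1.le 2
          nlinarith
      _ ≤ _ := lintegral_mono_set (Set.Ioo_subset_Ioo_left hR0.le)
  refine le_trans (le_of_eq ?_) (mul_le_mul_right h1 _)
  rw [← ENNReal.ofReal_mul (by positivity), ← ENNReal.ofReal_mul (by positivity)]
  congr 1
  field_simp

lemma log_enorm_div_coe {w : ℂ} (hw : w ≠ 0) (r : ℝ) :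
    ENNReal.log ‖w‖ₑ / (r : EReal) = ((Real.log ‖w‖ / r : ℝ) : EReal) := by
  rw [← ofReal_norm, ENNReal.log_ofReal_of_pos (norm_pos_iff.2 hw), EReal.coe_div]

/-- Zeros can only lower `log ‖f‖`, so the upper bound holds at every radius and the Poisson term
disappears by `tendsto_linePoisson_div`. -/
lemma indicatorFn_le (hf : AnalyticOnNhd ℂ f {z : ℂ | 0 ≤ z.im})
    (hlog : Integrable (fun t : ℝ => Real.log ‖f (t : ℂ)‖ / (1 + t ^ 2)))
    (hup : ∀ z : ℂ, 0 < z.im → f z ≠ 0 → Real.log ‖f z‖ ≤ linePoisson f z + k * z.im)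
    {φ : ℝ} (hφ : 0 < Real.sin φ) : indicatorFn f φ ≤ ((k * Real.sin φ : ℝ) : EReal) := by
  refine EReal.le_of_forall_lt_iff_le.1 fun c hc => ?_
  have hc' : 0 < c - k * Real.sin φ := sub_pos.2 (EReal.coe_lt_coe_iff.1 hc)
  refine limsup_le_of_le (h := ?_)
  filter_upwards [(tendsto_linePoisson_div hf hlog hφ).eventually_lt_const hc',
    eventually_gt_atTop 0] with r h1 hr
  rw [← circleMap_zero]
  rcases eq_or_ne (f (circleMap 0 r φ)) 0 with h0 | h0
  · rw [h0, enorm_zero, ENNReal.log_zero, EReal.bot_div_of_pos_ne_top (by exact_mod_cast hr)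
      (EReal.coe_ne_top r)]
    exact bot_le
  · rw [log_enorm_div_coe h0]
    refine EReal.coe_le_coe_iff.2 ?_
    have hz : (circleMap 0 r φ).im = r * Real.sin φ := circleMap_zero_im r φ
    have h2 := hup (circleMap 0 r φ) (by rw [hz]; positivity) h0
    rw [div_le_iff₀ hr]
    rw [div_lt_iff₀ hr] at h1
    rw [hz] at h2
    nlinarith

lemma ae_ray_ne_zero (hf : AnalyticOnNhd ℂ f {z : ℂ | 0 ≤ z.im}) (hf0 : f 0 ≠ 0) {φ : ℝ}
    (hφ : 0 < Real.sin φ) : ∀ᵐ r : ℝ, 0 < r → f (circleMap 0 r φ) ≠ 0 := by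
  have hinj : Function.Injective fun r : ℝ => circleMap 0 r φ := fun r s h => by
    simpa [circleMap_zero, Complex.exp_ne_zero] using h
  have hc := ((countable_upperZeros hf hf0).preimage hinj).ae_notMem volume
  filter_upwards [hc] with r h hr h0
  refine h ⟨?_, h0⟩
  rw [circleMap_zero_im]
  positivity

lemma ae_halfCircle_ne_zero (hf : AnalyticOnNhd ℂ f {z : ℂ | 0 ≤ z.im}) (hf0 : f 0 ≠ 0) {r : ℝ}
    (hr : 0 < r) : ∀ᵐ θ : ℝ, θ ∈ Set.Ioo 0 Real.pi → f (circleMap 0 r θ) ≠ 0 := by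
  have h1 : ∀ᵐ θ : ℝ, ∀ a ∈ upperZeros f, circleMap 0 r θ ≠ a :=
    (ae_ball_iff (countable_upperZeros hf hf0)).2 fun a _ => ae_circleMap_ne hr.ne' a
  filter_upwards [h1] with θ h hθ h0
  refine h _ ⟨?_, h0⟩ rfl
  rw [circleMap_zero_im]
  exact mul_pos hr (Real.sin_pos_of_mem_Ioo hθ)

/-- An upper limit needs only some good radii. If the quotient stayed below `c < k sin φ` for all
large `r`, the error would be at least `(k sin φ - c) r` at almost every such `r`, forcing
`radialMajorant` to be of linear size on a whole window `(R, 2R)`. -/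
lemma le_indicatorFn (hf : AnalyticOnNhd ℂ f {z : ℂ | 0 ≤ z.im}) (hf0 : f 0 ≠ 0)
    (hlow : ∀ z : ℂ, 0 < z.im → f z ≠ 0 →
      ‖Real.log ‖f z‖ - k * z.im‖ₑ ≤ lineMajorant f z + greenPotential f z)
    (hΛ : Tendsto (fun R : ℝ => ENNReal.ofReal (1 / R ^ 3) *
      ∫⁻ r in Set.Ioo 0 R, ENNReal.ofReal r * radialMajorant f r) atTop (𝓝 0))
    {φ : ℝ} (hφ : 0 < Real.sin φ) : ((k * Real.sin φ : ℝ) : EReal) ≤ indicatorFn f φ := by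
  refine EReal.ge_of_forall_gt_iff_ge.1 fun c hc => ?_
  have hc' : 0 < k * Real.sin φ - c := sub_pos.2 (EReal.coe_lt_coe_iff.1 hc)
  refine le_limsup_of_frequently_le' fun hnot => ?_
  set C := 16 / Real.sin φ with hC
  have hC0 : 0 < C := by positivity
  have h1 := eventually_not_ae_le_of_tendsto hΛ (ε := (k * Real.sin φ - c) / C) (δ := 1)
    (by positivity) one_pos
  obtain ⟨R₀, hR₀⟩ := eventually_atTop.1 hnot
  obtain ⟨R, ⟨h2, h3⟩, h4⟩ :=
    ((h1.and (eventually_ge_atTop R₀)).and (eventually_gt_atTop 0)).exists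
  refine h2 ?_
  filter_upwards [ae_ray_ne_zero hf hf0 hφ] with r hr hrm
  have hr0 : 0 < r := h4.trans hrm.1
  have h5 : ¬ ((c : EReal) ≤ ENNReal.log ‖f ((r : ℂ) * Complex.exp ((φ : ℂ) * Complex.I))‖ₑ / (r : EReal)) :=
    hR₀ r (h3.trans hrm.1.le)
  rw [← circleMap_zero, log_enorm_div_coe (hr hr0), EReal.coe_le_coe_iff, not_le,
    div_lt_iff₀ hr0] at h5
  have hz : (circleMap 0 r φ).im = r * Real.sin φ := circleMap_zero_im r φ
  have h6 := (hlow (circleMap 0 r φ) (by rw [hz]; positivity) (hr hr0)).trans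
    (lineMajorant_add_greenPotential_le hr0 hφ)
  have h7 : ENNReal.ofReal ((k * Real.sin φ - c) * r) ≤
      ‖Real.log ‖f (circleMap 0 r φ)‖ - k * (circleMap 0 r φ).im‖ₑ := by
    rw [Real.enorm_eq_ofReal_abs, hz]
    refine ENNReal.ofReal_le_ofReal (le_trans ?_ (neg_le_abs _))
    nlinarith
  have h8 := h7.trans h6
  rw [show (k * Real.sin φ - c) * r = C * ((k * Real.sin φ - c) / C * r) by field_simp,
    ENNReal.ofReal_mul hC0.le] at h8
  exact (ENNReal.mul_le_mul_iff_right (by simpa using hC0) ENNReal.ofReal_ne_top).1 h8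

/-- A monotone function which is asymptotically linear on average is asymptotically linear. -/
lemma tendsto_div_of_monotone_of_tendsto {Λ : ℝ → ENNReal}
    (hΛ : Tendsto (fun R : ℝ => ENNReal.ofReal (1 / R ^ 3) *
      ∫⁻ r in Set.Ioo 0 R, ENNReal.ofReal r * Λ r) atTop (𝓝 0)) {F : ℝ → ℝ} {κ : ℝ}
    (hF : ∀ r s : ℝ, 0 < r → r ≤ s → F r ≤ F s)
    (h : ∀ ε : ℝ, 0 < ε →
      ∀ᶠ r in atTop, ENNReal.ofReal |F r - κ * r| ≤ Λ r + ENNReal.ofReal (ε * r)) :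
    Tendsto (fun r => F r / r) atTop (𝓝 κ) := by
  have key : ∀ ε δ : ℝ, 0 < ε → 0 < δ → ∀ᶠ R : ℝ in atTop,
      ¬ ∀ r ∈ Set.Ioo R ((1 + δ) * R), ε * r ≤ |F r - κ * r| := by
    intro ε δ hε hδ
    obtain ⟨R₀, hR₀⟩ := eventually_atTop.1 (h (ε / 2) (by positivity))
    filter_upwards [eventually_not_ae_le_of_tendsto hΛ (half_pos hε) hδ, eventually_ge_atTop R₀,
      eventually_gt_atTop 0] with R h1 h2 h3 h4
    refine h1 (Eventually.of_forall fun r hr => ?_)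
    have hr0 : 0 < r := h3.trans hr.1
    have h5 := (ENNReal.ofReal_le_ofReal (h4 r hr)).trans (hR₀ r (h2.trans hr.1.le))
    rw [show ε * r = ε / 2 * r + ε / 2 * r by ring,
      ENNReal.ofReal_add (by positivity) (by positivity)] at h5
    exact (ENNReal.add_le_add_iff_right ENNReal.ofReal_ne_top).1 h5
  rw [Metric.tendsto_atTop']
  intro ε hε
  -- The window is so narrow that `κ r` changes by at most half of the allowed error across it;
  -- monotonicity then transports a bound at one good radius to `R`.
  set δ := ε / (2 * (|κ| + ε + 1)) with hδ
  have hκ := abs_nonneg κ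
  have hδ0 : 0 < δ := by positivity
  have hδ1 : δ ≤ 1 := by rw [hδ, div_le_one (by positivity)]; linarith
  have hδκ : δ * |κ| ≤ ε / 2 := by
    rw [hδ, div_mul_eq_mul_div, div_le_iff₀ (by positivity)]
    nlinarith
  have k1 := key (ε / 4) δ (by positivity) hδ0
  have hT : Tendsto (fun R : ℝ => R / (1 + δ)) atTop atTop :=
    tendsto_id.atTop_div_const (by positivity)
  -- The window starting at `R` gives the upper bound at `R`; the lower bound needs a good radius in
  -- the window ending at `R`.
  have k2 := hT.eventually k1
  obtain ⟨R₁, hR₁⟩ := eventually_atTop.1 ((k1.and k2).and (eventually_gt_atTop 0))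
  refine ⟨R₁, fun R hR => ?_⟩
  obtain ⟨⟨n1, n2⟩, hR0⟩ := hR₁ R hR.le
  rw [Real.dist_eq, abs_lt]
  constructor
  · by_contra hc
    rw [not_lt, sub_le_iff_le_add, div_le_iff₀ hR0] at hc
    refine n2 fun r hr => ?_
    rw [mul_div_cancel₀ R (by positivity : (1 + δ) ≠ 0)] at hr
    have hr0 : 0 < r := (div_pos hR0 (by positivity)).trans hr.1
    have h1 := hF r R hr0 hr.2.le
    have h2 : R - r ≤ δ * r := by
      have := hr.1
      rw [div_lt_iff₀ (by positivity)] at this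
      linarith
    have h3 : κ * (R - r) ≤ ε / 2 * r := by
      have h4 : 0 ≤ R - r := by linarith [hr.2]
      calc κ * (R - r) ≤ |κ| * (R - r) := by gcongr; exact le_abs_self κ
        _ ≤ |κ| * (δ * r) := by gcongr
        _ = δ * |κ| * r := by ring
        _ ≤ _ := by gcongr
    refine le_trans ?_ (neg_le_abs _)
    have := mul_pos hε hr0
    have := mul_lt_mul_of_pos_left hr.2 hε
    nlinarith
  · by_contra hc
    rw [not_lt, le_sub_iff_add_le, le_div_iff₀ hR0] at hc
    refine n1 fun r hr => ?_
    have hr0 : 0 < r := hR0.trans hr.1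
    have h1 := hF R r hR0 hr.1.le
    have h2 : r - R ≤ δ * R := by linarith [hr.2]
    have h3 : κ * (r - R) ≤ ε / 2 * R := by
      have h4 : 0 ≤ r - R := by linarith [hr.1]
      calc κ * (r - R) ≤ |κ| * (r - R) := by gcongr; exact le_abs_self κ
        _ ≤ |κ| * (δ * R) := by gcongr
        _ = δ * |κ| * R := by ring
        _ ≤ _ := by gcongr
    have h5 : r ≤ 2 * R := by nlinarith [hr.2]
    refine le_trans ?_ (le_abs_self _)
    have := mul_le_mul_of_nonneg_left h5 hε.le
    nlinarith

/-- A nonnegative monotone function whose logarithmic primitive is asymptotically linear is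
asymptotically linear. -/
lemma tendsto_div_of_tendsto_integral_div {n : ℝ → ℝ} (hn : Monotone n) (hn0 : ∀ r, 0 ≤ n r)
    (hi : ∀ r : ℝ, 0 < r → IntervalIntegrable (fun t => n t / t) volume 0 r) {κ : ℝ}
    (h : Tendsto (fun r => (∫ t in (0 : ℝ)..r, n t / t) / r) atTop (𝓝 κ)) :
    Tendsto (fun r => n r / r) atTop (𝓝 κ) := by
  have hsub : ∀ r s : ℝ, 0 < r → r < s →
      (s - r) * (n r / s) ≤ (∫ t in (0 : ℝ)..s, n t / t) - ∫ t in (0 : ℝ)..r, n t / t ∧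
      (∫ t in (0 : ℝ)..s, n t / t) - ∫ t in (0 : ℝ)..r, n t / t ≤ (s - r) * (n s / r) := by
    intro r s hr hrs
    have hs := hr.trans hrs
    rw [intervalIntegral.integral_interval_sub_left (hi s hs) (hi r hr)]
    have hI : IntervalIntegrable (fun t => n t / t) volume r s := (hi r hr).symm.trans (hi s hs)
    constructor
    · rw [← smul_eq_mul, ← intervalIntegral.integral_const]
      refine intervalIntegral.integral_mono_on hrs.le (by simp) hI fun t ht => ?_
      exact div_le_div₀ (hn0 t) (hn ht.1) (hr.trans_le ht.1) ht.2
    · rw [← smul_eq_mul, ← intervalIntegral.integral_const]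
      refine intervalIntegral.integral_mono_on hrs.le hI (by simp) fun t ht => ?_
      exact div_le_div₀ (hn0 s) (hn ht.2) hr ht.1
  set F : ℝ → ℝ := fun r => ∫ t in (0 : ℝ)..r, n t / t with hF
  have hscale : ∀ c : ℝ, 0 < c → Tendsto (fun r => F (c * r) / r) atTop (𝓝 (c * κ)) := by
    intro c hc
    have hT : Tendsto (fun R : ℝ => c * R) atTop atTop := tendsto_id.const_mul_atTop hc
    refine ((h.comp hT).const_mul c).congr fun r => ?_
    simp only [Function.comp]
    rw [hF]
    field_simp
  -- By `hsub`, the scaled increments of `F` between `c r` and `r` bound `n r / r`, from below for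
  -- `c < 1` and from above for `c > 1`. They tend to `c κ`, and `c` is taken close enough to `1`.
  refine tendsto_order.2 ⟨fun a ha => ?_, fun a ha => ?_⟩
  · have hc1 : Tendsto (fun c : ℝ => c * κ) (𝓝[<] 1) (𝓝 κ) := by
      have : ContinuousAt (fun c : ℝ => c * κ) 1 := by fun_prop
      simpa using this.tendsto.mono_left nhdsWithin_le_nhds
    obtain ⟨c, ⟨hca, hc1⟩, hc0⟩ := (((hc1.eventually_const_lt ha).and self_mem_nhdsWithin).and
      (nhdsWithin_le_nhds (lt_mem_nhds (one_pos : (0 : ℝ) < 1)))).exists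
    have hc1 : c < 1 := hc1
    have hlim := (((hscale 1 one_pos).sub (hscale c hc0)).const_mul (c / (1 - c)))
    rw [show c / (1 - c) * (1 * κ - c * κ) = c * κ by
      have : 1 - c ≠ 0 := by linarith
      field_simp] at hlim
    filter_upwards [hlim.eventually_const_lt hca, eventually_gt_atTop 0] with r h1 hr
    refine h1.trans_le ?_
    have h2 := (hsub (c * r) r (by positivity) (by nlinarith)).2
    have h3 : 0 < 1 - c := by linarith
    rw [one_mul, ← sub_div, ← mul_div_assoc, div_le_div_iff_of_pos_right hr]
    calc c / (1 - c) * (F r - F (c * r)) ≤ c / (1 - c) * ((r - c * r) * (n r / (c * r))) := by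
          gcongr
      _ = n r := by field_simp
  · have hc1 : Tendsto (fun c : ℝ => c * κ) (𝓝[>] 1) (𝓝 κ) := by
      have : ContinuousAt (fun c : ℝ => c * κ) 1 := by fun_prop
      simpa using this.tendsto.mono_left nhdsWithin_le_nhds
    obtain ⟨c, hca, hc1⟩ := ((hc1.eventually_lt_const ha).and self_mem_nhdsWithin).exists
    have hc1 : 1 < c := hc1
    have hlim := (((hscale c (by linarith)).sub (hscale 1 one_pos)).const_mul (c / (c - 1)))
    rw [show c / (c - 1) * (c * κ - 1 * κ) = c * κ by
      have : c - 1 ≠ 0 := by linarith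
      field_simp] at hlim
    filter_upwards [hlim.eventually_lt_const hca, eventually_gt_atTop 0] with r h1 hr
    refine lt_of_le_of_lt ?_ h1
    have h2 := (hsub r (c * r) hr (by nlinarith)).1
    have h3 : 0 < c - 1 := by linarith
    rw [one_mul, ← sub_div, ← mul_div_assoc, div_le_div_iff_of_pos_right hr]
    calc n r = c / (c - 1) * ((c * r - r) * (n r / (c * r))) := by field_simp
      _ ≤ c / (c - 1) * (F (c * r) - F r) := by gcongr
end

/-! ### The density of the zeros. -/

noncomputable section

variable {f : ℂ → ℂ} {k : ℝ}

lemma monotone_upperZeroCount (hf : AnalyticOnNhd ℂ f {z : ℂ | 0 ≤ z.im}) (hf0 : f 0 ≠ 0) :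
    Monotone fun r => (upperZeroCount f r : ℝ) := fun r s hrs => by
  show (upperZeroCount f r : ℝ) ≤ upperZeroCount f s
  rw [upperZeroCount_eq_sum hf hf0 hrs, upperZeroCount_eq_sum hf hf0 le_rfl]
  refine Finset.sum_le_sum fun a _ => mul_le_mul_of_nonneg_left ?_ (Nat.cast_nonneg _)
  unfold zeroMark
  split_ifs with h1 h2 <;> simp_all
  linarith

/-- The term `2 k r` is the half-circle integral of `k Im z`, so only the error in the
representation is left; zeros on the circle form a null set. -/
lemma enorm_halfCircle_integral_sub_le (hf : AnalyticOnNhd ℂ f {z : ℂ | 0 ≤ z.im}) (hf0 : f 0 ≠ 0)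
    (hlow : ∀ z : ℂ, 0 < z.im → f z ≠ 0 →
      ‖Real.log ‖f z‖ - k * z.im‖ₑ ≤ lineMajorant f z + greenPotential f z) {r : ℝ} (hr : 0 < r) :
    ‖(∫ θ in (0 : ℝ)..Real.pi, Real.log ‖f (circleMap 0 r θ)‖) - 2 * k * r‖ₑ ≤
      ENNReal.ofReal (10 * Real.pi) * radialMajorant f r := by
  have hpi := Real.pi_pos
  have e : (∫ θ in (0 : ℝ)..Real.pi, Real.log ‖f (circleMap 0 r θ)‖) - 2 * k * r =
      ∫ θ in Set.Ioo 0 Real.pi, (Real.log ‖f (circleMap 0 r θ)‖ - k * (circleMap 0 r θ).im) := by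
    rw [← integral_Ioc_eq_integral_Ioo, ← intervalIntegral.integral_of_le hpi.le,
      intervalIntegral.integral_sub (halfCircle_intervalIntegrable_log_norm hr hf)
      ((by fun_prop : Continuous fun θ => k * (circleMap 0 r θ).im).intervalIntegrable _ _)]
    congr 1
    simp only [circleMap_zero_im, ← mul_assoc]
    rw [intervalIntegral.integral_const_mul, integral_sin]
    simp only [Real.cos_zero, Real.cos_pi]
    ring
  rw [e]
  refine (enorm_integral_le_lintegral_enorm _).trans (le_trans ?_
    (lintegral_lineMajorant_add_greenPotential_le hf hf0 hr))
  refine lintegral_mono_ae ?_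
  filter_upwards [ae_restrict_of_ae (ae_halfCircle_ne_zero hf hf0 hr),
    ae_restrict_mem measurableSet_Ioo] with θ h1 h2
  refine hlow _ ?_ (h1 h2)
  rw [circleMap_zero_im]
  exact mul_pos hr (Real.sin_pos_of_mem_Ioo h2)

/-- Beyond `1` the bounded variation gives at most `M log r`. Near `0`, integrability of the
quotient comes from `halfDisc_jensen`. -/
lemma eventually_abs_integral_argVariation_le (hf : AnalyticOnNhd ℂ f {z : ℂ | 0 ≤ z.im})
    (hf0 : f 0 = 1) (harg : ∃ M : ℝ, ∀ r : ℝ, 0 < r → |argVariation f r| ≤ M) {ε : ℝ} (hε : 0 < ε) :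
    ∀ᶠ r : ℝ in atTop, |∫ t in (0 : ℝ)..r, argVariation f t / t| ≤ ε * r := by
  obtain ⟨M, hM⟩ := harg
  have hM0 : 0 ≤ M := (abs_nonneg _).trans (hM 1 one_pos)
  set A := ∫ t in (0 : ℝ)..1, argVariation f t / t with hA
  have hlim : Tendsto (fun r : ℝ => |A| / r + M * (Real.log r / r)) atTop (𝓝 0) := by
    have h1 := (tendsto_const_nhds (x := |A|)).div_atTop tendsto_id
    have h2 := Real.isLittleO_log_id_atTop.tendsto_div_nhds_zero.const_mul M
    simpa using h1.add h2
  filter_upwards [hlim.eventually_lt_const hε, eventually_ge_atTop 1] with r h1 hr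
  have hr0 : 0 < r := by linarith
  have i1 := (halfDisc_jensen hf hf0 one_pos).1
  have i2 := (halfDisc_jensen hf hf0 hr0).1
  have h2 : |∫ t in (1 : ℝ)..r, argVariation f t / t| ≤ M * Real.log r := by
    have e : ∫ t in (1 : ℝ)..r, M * t⁻¹ = M * Real.log r := by
      rw [intervalIntegral.integral_const_mul, integral_inv_of_pos one_pos hr0, div_one]
    rw [← e, ← Real.norm_eq_abs]
    refine intervalIntegral.norm_integral_le_of_norm_le hr (Eventually.of_forall fun t ht => ?_) ?_
    · have ht0 : 0 < t := by linarith [ht.1]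
      rw [Real.norm_eq_abs, abs_div, abs_of_pos ht0, ← div_eq_mul_inv]
      gcongr
      exact hM t ht0
    · refine ((intervalIntegral.intervalIntegrable_inv (fun t ht => ?_)
        continuousOn_id)).const_mul M
      rw [Set.uIcc_of_le hr] at ht
      exact (zero_lt_one.trans_le ht.1).ne'
  rw [← intervalIntegral.integral_add_adjacent_intervals i1 (i1.symm.trans i2)]
  have h3 := (abs_add_le A _).trans (add_le_add_right h2 |A|)
  refine h3.trans ?_
  have h4 := mul_le_mul_of_nonneg_right h1.le hr0.le
  have h5 : (|A| / r + M * (Real.log r / r)) * r = |A| + M * Real.log r := by field_simp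
  linarith

/-- Two Tauberian steps are needed. The half-circle means are controlled only on average, so
monotonicity is first used for `∫₀ʳ n(t)/t dt`, where Jensen's formula applies, and then again for
`n` itself. -/
lemma tendsto_upperZeroCount_div (hf : AnalyticOnNhd ℂ f {z : ℂ | 0 ≤ z.im})
    (hf0 : f 0 = 1) (harg : ∃ M : ℝ, ∀ r : ℝ, 0 < r → |argVariation f r| ≤ M)
    (hlow : ∀ z : ℂ, 0 < z.im → f z ≠ 0 →
      ‖Real.log ‖f z‖ - k * z.im‖ₑ ≤ lineMajorant f z + greenPotential f z)
    (hΛ : Tendsto (fun R : ℝ => ENNReal.ofReal (1 / R ^ 3) *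
      ∫⁻ r in Set.Ioo 0 R, ENNReal.ofReal r * radialMajorant f r) atTop (𝓝 0)) :
    Tendsto (fun r : ℝ => (upperZeroCount f r : ℝ) / r) atTop (𝓝 (k / Real.pi)) := by
  have hpi := Real.pi_pos
  have hne : f 0 ≠ 0 := by simp [hf0]
  have hi : ∀ r : ℝ, 0 < r → IntervalIntegrable (fun t => (upperZeroCount f t : ℝ) / t) volume 0 r :=
    fun r hr => (halfDisc_jensen hf hf0 hr).2.1
  refine tendsto_div_of_tendsto_integral_div (monotone_upperZeroCount hf hne)
    (fun _ => Nat.cast_nonneg _) hi ?_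
  have hΛ' : Tendsto (fun R : ℝ => ENNReal.ofReal (1 / R ^ 3) * ∫⁻ r in Set.Ioo 0 R,
      ENNReal.ofReal r * (ENNReal.ofReal (10 * Real.pi) * radialMajorant f r)) atTop (𝓝 0) := by
    have h := ENNReal.Tendsto.const_mul (a := ENNReal.ofReal (10 * Real.pi)) hΛ
      (Or.inr ENNReal.ofReal_ne_top)
    rw [mul_zero] at h
    refine h.congr fun R => ?_
    rw [mul_left_comm, ← lintegral_const_mul' _ _ ENNReal.ofReal_ne_top]
    congr 1
    exact lintegral_congr fun r => mul_left_comm _ _ _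
  refine tendsto_div_of_monotone_of_tendsto hΛ' (fun r s hr hrs => ?_) fun ε hε => ?_
  · rw [← sub_nonneg, intervalIntegral.integral_interval_sub_left (hi s (hr.trans_le hrs)) (hi r hr)]
    refine intervalIntegral.integral_nonneg hrs fun t ht => ?_
    have := hr.trans_le ht.1
    positivity
  · filter_upwards [eventually_abs_integral_argVariation_le hf hf0 harg hε, eventually_gt_atTop 0]
      with r h1 hr
    have hJ := (halfDisc_jensen hf hf0 hr).2.2
    have hE := enorm_halfCircle_integral_sub_le hf hne hlow hr
    set F := ∫ t in (0 : ℝ)..r, (upperZeroCount f t : ℝ) / t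
    set A := ∫ t in (0 : ℝ)..r, argVariation f t / t
    set I := ∫ θ in (0 : ℝ)..Real.pi, Real.log ‖f (circleMap 0 r θ)‖
    have e : F - k / Real.pi * r = ((I - 2 * k * r) + A) / (2 * Real.pi) := by
      rw [hJ]; field_simp; ring
    have h2 : |F - k / Real.pi * r| ≤ |I - 2 * k * r| + |A| := by
      rw [e, abs_div, abs_of_pos (by positivity : 0 < 2 * Real.pi)]
      exact (div_le_self (abs_nonneg _) (by linarith [Real.pi_gt_three])).trans (abs_add_le _ _)
    rw [Real.enorm_eq_ofReal_abs] at hE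
    calc ENNReal.ofReal |F - k / Real.pi * r| ≤ ENNReal.ofReal (|I - 2 * k * r| + ε * r) :=
          ENNReal.ofReal_le_ofReal (by linarith)
      _ ≤ ENNReal.ofReal |I - 2 * k * r| + ENNReal.ofReal (ε * r) := ENNReal.ofReal_add_le
      _ ≤ _ := by gcongr

end

theorem theorem2p1 (f : ℂ → ℂ)
    (hf : AnalyticOnNhd ℂ f {z : ℂ | 0 ≤ z.im})
    (hgrowth : ∃ C : ℝ, ∀ z : ℂ, 0 ≤ z.im → ‖f z‖ ≤ C * Real.exp (C * ‖z‖))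
    (hf0 : f 0 = 1)
    (harg : ∃ M : ℝ, ∀ r : ℝ, 0 < r → |argVariation f r| ≤ M)
    (hlog : Integrable (fun t : ℝ => Real.log ‖f (t : ℂ)‖ / (1 + t ^ 2))) :
    (∀ φ ∈ Set.Ioo 0 Real.pi, indicatorFn f φ ≠ ⊥ ∧ indicatorFn f φ ≠ ⊤) ∧
    IntervalIntegrable (fun φ : ℝ => (indicatorFn f φ).toReal) volume 0 Real.pi ∧
    Tendsto (fun r : ℝ => (upperZeroCount f r : ℝ) / r) atTop
      (𝓝 (1 / (2 * Real.pi) * ∫ φ in (0 : ℝ)..Real.pi, (indicatorFn f φ).toReal)) := by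
  have hpi := Real.pi_pos
  have hne : f 0 ≠ 0 := by simp [hf0]
  obtain ⟨k, hsum, hrep⟩ := exists_halfPlane_representation hf hgrowth hf0 hlog
  have hΛ := tendsto_lintegral_radialMajorant hf hne hlog hsum
  have hind : ∀ φ ∈ Set.Ioo 0 Real.pi, indicatorFn f φ = ((k * Real.sin φ : ℝ) : EReal) :=
    fun φ hφ => le_antisymm
      (indicatorFn_le hf hlog (fun z hz h => (hrep z hz h).1) (Real.sin_pos_of_mem_Ioo hφ))
      (le_indicatorFn hf hne (fun z hz h => (hrep z hz h).2) hΛ (Real.sin_pos_of_mem_Ioo hφ))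
  -- The indicator is known only on the open interval; the endpoint `π` is discarded as a null set.
  have hae : ∀ᵐ φ : ℝ, φ ∈ Set.uIoc 0 Real.pi → k * Real.sin φ = (indicatorFn f φ).toReal := by
    filter_upwards [compl_mem_ae_iff.2 (measure_singleton Real.pi)] with φ h1 h2
    rw [Set.uIoc_of_le hpi.le] at h2
    rw [hind φ ⟨h2.1, lt_of_le_of_ne h2.2 h1⟩, EReal.toReal_coe]
  refine ⟨fun φ hφ => ?_, ?_, ?_⟩
  · rw [hind φ hφ]
    exact ⟨EReal.coe_ne_bot _, EReal.coe_ne_top _⟩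
  · refine (Continuous.intervalIntegrable (u := fun φ => k * Real.sin φ) (by fun_prop) 0
      Real.pi).congr_ae ?_
    exact (ae_restrict_iff' measurableSet_uIoc).2 hae
  · rw [← intervalIntegral.integral_congr_ae hae, intervalIntegral.integral_const_mul, integral_sin,
      Real.cos_zero, Real.cos_pi]
    have e : 1 / (2 * Real.pi) * (k * (1 - -1)) = k / Real.pi := by field_simp; ring
    rw [e]
    exact tendsto_upperZeroCount_div hf hf0 harg (fun z hz h => (hrep z hz h).2) hΛ
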